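/- For $n\ge 1$ let $B(A_n)$ be the braid group on $n+1$ strands with its standard generators $\sigma_1,\dots,\sigma_n$; let $B(B_{n+1})$ be the Artin group of type $B_{n+1}$, with generators $\sigma_1,\dots,\sigma_n,t$, where $\sigma_1,\dots,\sigma_n$ satisfy the braid relations of $B(A_n)$, $t$ commutes with $\sigma_i$ for $i\ge 2$, and $\sigma_1t\sigma_1t=t\sigma_1t\sigma_1$; and let $B(\tilde A_n)$ be the affine braid group with generators $\sigma_1,\dots,\sigma_n,a_{n+1}$, where $\sigma_1,\dots,\sigma_n$ satisfy the braid relations of $B(A_n)$, $a_{n+1}$ commutes with $\sigma_i$ for $2\le i\le n-1$, and, if $n\ge2$, $\sigma_ia_{n+1}\sigma_i=a_{n+1}\sigma_ia_{n+1}$ for $i=1$ and $i=n$ (so $B(\tilde A_1)$ is free of rank two). Consider the homomorphisms * $F_n:B(\tilde A_{n-1})\to B(\tilde A_n)$ $(n\ge 2)$, $\sigma_i\mapsto\sigma_i$, $a_n\mapsto\sigma_na_{n+1}\sigma_n^{-1}$, through which elements of $B(\tilde A_{n-1})$ are viewed in $B(\tilde A_n)$; * $\phi_n:B(\tilde A_{n-1})\to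 B(\tilde A_{n-1})$ $(n\ge 2)$, the Dynkin automorphism $\sigma_1\mapsto\sigma_2\mapsto\cdots\mapsto\sigma_{n-1}\mapsto a_n\mapsto\sigma_1$; * $\bar x_n:B(\tilde A_{n-1})\to B(A_n)$ $(n\ge 2)$, the composite of $B(\tilde A_{n-1})\to B(B_n)$, $\sigma_i\mapsto\sigma_i$, $a_n\mapsto(t\sigma_1\cdots\sigma_{n-1})\,\sigma_{n-1}\,(t\sigma_1\cdots\sigma_{n-1})^{-1}$, and $B(B_n)\to B(A_n)$, $\sigma_i\mapsto\sigma_{i+1}$, $t\mapsto\sigma_1^2$. The closure $\hat b$ of a braid $b\in B(A_n)$ is the isotopy class of the oriented link in $\mathbb R^3$ obtained by closing a geometric braid that represents $b$, and the closure $\hat x$ of an affine braid $x\in B(\tilde A_{n-1})$ is the closure of $\bar x_n(x)\in B(A_n)$. Let $n\ge 2$ and $x\in B(\tilde A_{n-1})$. Then: 1. if $y\in B(\tilde A_{n-1})$ satisfies $\phi_n(y)=x$, then $\hat y=\hat x$; 2. $\widehat{x\,a_{n+1}}=\hat x$, where $x\,a_{n+1}=F_n(x)\,a_{n+1}\in B(\tilde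 A_n)$. -/

import Mathlib

namespace AffineLink

noncomputable section

/-! ### Braid groups of types `A`, `B` and affine `A`, by generators and relations -/

/-- The relators `u v⁻¹` of a family of relations `u = v`. -/
def relators {α : Type} (R : FreeGroup α → FreeGroup α → Prop) : Set (FreeGroup α) :=
  {r | ∃ u v, R u v ∧ r = u * v⁻¹}

theorem mk_eq_of_rel {α : Type} {R : FreeGroup α → FreeGroup α → Prop} {u v : FreeGroup α}
    (h : R u v) : PresentedGroup.mk (relators R) u = PresentedGroup.mk (relators R) v := by
  have h1 : PresentedGroup.mk (relators R) (u * v⁻¹) = 1 :=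
    PresentedGroup.one_of_mem ⟨u, v, h, rfl⟩
  rwa [map_mul, map_inv, mul_inv_eq_one] at h1

theorem lift_eq_one {α G : Type} [Group G] {R : FreeGroup α → FreeGroup α → Prop} {f : α → G}
    (h : ∀ u v, R u v → FreeGroup.lift f u = FreeGroup.lift f v) :
    ∀ r ∈ relators R, FreeGroup.lift f r = 1 := by
  rintro r ⟨u, v, huv, rfl⟩
  rw [map_mul, map_inv, h u v huv, mul_inv_cancel]

open FreeGroup (of)

/-- The relations of `B(A_n)`; the generator `i : Fin n` is `σ_{i+1}`. -/
inductive RelA (n : ℕ) : FreeGroup (Fin n) → FreeGroup (Fin n) → Prop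
  | comm (i j : Fin n) (h : i.val + 2 ≤ j.val) : RelA n (of i * of j) (of j * of i)
  | braid (i j : Fin n) (h : i.val + 1 = j.val) :
      RelA n (of i * of j * of i) (of j * of i * of j)

/-- The braid group `B(A_n)`, generated by `σ_1, …, σ_n` (braids on `n + 1` strands). -/
abbrev BraidA (n : ℕ) : Type := PresentedGroup (relators (RelA n))

/-- The generators `σ_1, …, σ_n, t` of `B(B_{n+1})`; `s i` stands for `σ_{i+1}`. -/
inductive GenB (n : ℕ) : Type
  | s (i : Fin n)
  | t

/-- The relations of `B(B_{n+1})`. -/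
inductive RelB (n : ℕ) : FreeGroup (GenB n) → FreeGroup (GenB n) → Prop
  | comm (i j : Fin n) (h : i.val + 2 ≤ j.val) :
      RelB n (of (.s i) * of (.s j)) (of (.s j) * of (.s i))
  | braid (i j : Fin n) (h : i.val + 1 = j.val) :
      RelB n (of (.s i) * of (.s j) * of (.s i)) (of (.s j) * of (.s i) * of (.s j))
  | comm_t (i : Fin n) (h : 1 ≤ i.val) :
      RelB n (of (.s i) * of .t) (of .t * of (.s i))
  | four_t (i : Fin n) (h : i.val = 0) :
      RelB n (of (.s i) * of .t * of (.s i) * of .t) (of .t * of (.s i) * of .t * of (.s i))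

/-- The braid group `B(B_{n+1})`, generated by `σ_1, …, σ_n, t`. -/
abbrev BraidB (n : ℕ) : Type := PresentedGroup (relators (RelB n))

/-- The generators `σ_1, …, σ_n, a_{n+1}` of `B(Ã_n)`; `s i` stands for `σ_{i+1}`. -/
inductive GenAff (n : ℕ) : Type
  | s (i : Fin n)
  | a

/-- The relations of `B(Ã_n)`, `n ≥ 1`. For `n = 1` there are none: `B(Ã_1)` is free of rank `2`,
the edge of its Dynkin diagram being labelled `∞`. -/
inductive RelAff (n : ℕ) : FreeGroup (GenAff n) → FreeGroup (GenAff n) → Prop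
  | comm (i j : Fin n) (h : i.val + 2 ≤ j.val) :
      RelAff n (of (.s i) * of (.s j)) (of (.s j) * of (.s i))
  | braid (i j : Fin n) (h : i.val + 1 = j.val) :
      RelAff n (of (.s i) * of (.s j) * of (.s i)) (of (.s j) * of (.s i) * of (.s j))
  | comm_a (i : Fin n) (h : 1 ≤ i.val) (h' : i.val + 1 < n) :
      RelAff n (of (.s i) * of .a) (of .a * of (.s i))
  | braid_first (i : Fin n) (hn : 2 ≤ n) (h : i.val = 0) :
      RelAff n (of (.s i) * of .a * of (.s i)) (of .a * of (.s i) * of .a)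
  | braid_last (i : Fin n) (hn : 2 ≤ n) (h : i.val + 1 = n) :
      RelAff n (of (.s i) * of .a * of (.s i)) (of .a * of (.s i) * of .a)

/-- The affine braid group `B(Ã_n)`, generated by `σ_1, …, σ_n, a_{n+1}`. -/
abbrev BraidAff (n : ℕ) : Type := PresentedGroup (relators (RelAff n))

/-- `σ_{i+1}` in `B(B_{n+1})` for `i < n` (and `1` for other `i`, which is never used). -/
def sB (n i : ℕ) : BraidB n := if h : i < n then PresentedGroup.of (.s ⟨i, h⟩) else 1

/-- `t` in `B(B_{n+1})`. -/
def tB (n : ℕ) : BraidB n := PresentedGroup.of .t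

/-- `σ_{i+1}` in `B(Ã_n)` for `i < n` (and `1` for other `i`, which is never used). -/
def sAff (n i : ℕ) : BraidAff n := if h : i < n then PresentedGroup.of (.s ⟨i, h⟩) else 1

/-- `a_{n+1}` in `B(Ã_n)`. -/
def aAff (n : ℕ) : BraidAff n := PresentedGroup.of .a

/-- `φ_{n+1} = t σ_1 ⋯ σ_n` in `B(B_{n+1})`. -/
def phiB (n : ℕ) : BraidB n := tB n * ((List.range n).map (sB n)).prod

/-- `a_{n+1} = φ_{n+1} σ_n φ_{n+1}⁻¹` in `B(B_{n+1})`. -/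
def aB (n : ℕ) : BraidB n := phiB n * sB n (n - 1) * (phiB n)⁻¹

theorem sB_comm {n i j : ℕ} (h : i + 2 ≤ j) : sB n i * sB n j = sB n j * sB n i := by
  by_cases hj : j < n
  · have hi : i < n := by omega
    simp only [sB, hi, hj, dif_pos]
    simpa [PresentedGroup.of] using mk_eq_of_rel (RelB.comm (⟨i, hi⟩ : Fin n) ⟨j, hj⟩ h)
  · simp [sB, hj]

theorem sB_braid {n i : ℕ} (h : i + 1 < n) :
    sB n i * sB n (i + 1) * sB n i = sB n (i + 1) * sB n i * sB n (i + 1) := by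
  have hi : i < n := by omega
  simp only [sB, hi, h, dif_pos]
  simpa [PresentedGroup.of] using mk_eq_of_rel (RelB.braid (⟨i, hi⟩ : Fin n) ⟨i + 1, h⟩ rfl)

theorem sB_comm_t {n i : ℕ} (h : 1 ≤ i) : sB n i * tB n = tB n * sB n i := by
  by_cases hi : i < n
  · simp only [sB, hi, dif_pos, tB]
    simpa [PresentedGroup.of] using mk_eq_of_rel (RelB.comm_t (⟨i, hi⟩ : Fin n) h)
  · simp [sB, hi]

theorem sB_four_t {n : ℕ} : sB n 0 * tB n * sB n 0 * tB n = tB n * sB n 0 * tB n * sB n 0 := by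
  by_cases hi : 0 < n
  · simp only [sB, hi, dif_pos, tB]
    simpa [PresentedGroup.of] using mk_eq_of_rel (RelB.four_t (⟨0, hi⟩ : Fin n) rfl)
  · simp [sB, hi]

/-- The product `σ_1 ⋯ σ_k` in `B(B_{n+1})`. -/
def prodB (n k : ℕ) : BraidB n := ((List.range k).map (sB n)).prod

theorem prodB_succ (n k : ℕ) : prodB n (k + 1) = prodB n k * sB n k := by
  simp [prodB, List.range_succ]

theorem prodB_comm {n k j : ℕ} (h : k + 1 ≤ j) : prodB n k * sB n j = sB n j * prodB n k := by
  induction k with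
  | zero => simp [prodB]
  | succ k ih =>
    rw [prodB_succ, mul_assoc, sB_comm (by omega : k + 2 ≤ j), ← mul_assoc, ih (by omega),
      mul_assoc]

/-- The product `σ_2 ⋯ σ_{k+1}` in `B(B_{n+1})`. -/
def tailB (n k : ℕ) : BraidB n := ((List.range k).map fun i => sB n (i + 1)).prod

theorem tailB_succ (n k : ℕ) : tailB n (k + 1) = tailB n k * sB n (k + 1) := by
  simp [tailB, List.range_succ]

theorem tailB_comm_t (n k : ℕ) : tailB n k * tB n = tB n * tailB n k := by
  induction k with
  | zero => simp [tailB]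
  | succ k ih =>
    rw [tailB_succ, mul_assoc, sB_comm_t (by omega), ← mul_assoc, ih, mul_assoc]

theorem prodB_eq_tail (n k : ℕ) : prodB n (k + 1) = sB n 0 * tailB n k := by
  induction k with
  | zero => simp [prodB, tailB]
  | succ k ih => rw [prodB_succ, ih, tailB_succ, mul_assoc]

theorem prodB_shift {n k i : ℕ} (hk : k ≤ n) (hi : i + 1 < k) :
    prodB n k * sB n i = sB n (i + 1) * prodB n k := by
  induction k with
  | zero => omega
  | succ k ih =>
    rcases Nat.lt_or_ge (i + 1) k with h | h
    · rw [prodB_succ, mul_assoc, ← sB_comm (by omega : i + 2 ≤ k), ← mul_assoc,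
        ih (by omega) h, mul_assoc]
    · obtain rfl : k = i + 1 := by omega
      rw [prodB_succ, prodB_succ]
      calc prodB n i * sB n i * sB n (i + 1) * sB n i
          = prodB n i * (sB n i * sB n (i + 1) * sB n i) := by group
        _ = prodB n i * sB n (i + 1) * (sB n i * sB n (i + 1)) := by
            rw [sB_braid (by omega)]; group
        _ = _ := by rw [prodB_comm le_rfl]; group

theorem tail_prodB {n k : ℕ} (hk : k + 1 ≤ n) :
    tailB n k * prodB n (k + 1) * sB n k = sB n 0 * (tailB n k * prodB n (k + 1)) := by
  induction k with
  | zero => simp [tailB, prodB]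
  | succ k ih =>
    have hb := sB_braid (n := n) (i := k) (by omega)
    have hc := prodB_comm (n := n) (k := k) (j := k + 1) le_rfl
    have ih' := ih (by omega)
    rw [prodB_succ n k] at ih'
    rw [tailB_succ, prodB_succ n (k + 1), prodB_succ n k]
    calc tailB n k * sB n (k + 1) * (prodB n k * sB n k * sB n (k + 1)) * sB n (k + 1)
        = tailB n k * (sB n (k + 1) * prodB n k) * sB n k * sB n (k + 1) * sB n (k + 1) := by group
      _ = tailB n k * prodB n k * (sB n (k + 1) * sB n k * sB n (k + 1)) * sB n (k + 1) := by
          rw [← hc]; group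
      _ = tailB n k * prodB n k * (sB n k * sB n (k + 1) * sB n k) * sB n (k + 1) := by rw [hb]
      _ = tailB n k * prodB n k * sB n k * (sB n (k + 1) * sB n k * sB n (k + 1)) := by group
      _ = (tailB n k * (prodB n k * sB n k) * sB n k) * sB n (k + 1) * sB n k := by
          rw [← hb]; group
      _ = sB n 0 * tailB n k * prodB n k * (sB n k * sB n (k + 1) * sB n k) := by
          rw [ih']; group
      _ = sB n 0 * tailB n k * (prodB n k * sB n (k + 1)) * sB n k * sB n (k + 1) := by
          rw [hb]; group
      _ = _ := by rw [hc]; group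

theorem phiB_shift {n i : ℕ} (hi : i + 1 < n) :
    phiB n * sB n i = sB n (i + 1) * phiB n := by
  change tB n * prodB n n * _ = _ * (tB n * prodB n n)
  rw [mul_assoc, prodB_shift le_rfl hi, ← mul_assoc, ← sB_comm_t (by omega), mul_assoc]

theorem phiB_aB {n : ℕ} (hn : 1 ≤ n) : phiB n * aB n = sB n 0 * phiB n := by
  obtain ⟨k, rfl⟩ : ∃ k, n = k + 1 := ⟨n - 1, by omega⟩
  have h1 := tail_prodB (n := k + 1) (k := k) le_rfl
  have h2 := tailB_comm_t (k + 1) k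
  have h3 := sB_four_t (n := k + 1)
  have hphi : phiB (k + 1) = tB (k + 1) * prodB (k + 1) (k + 1) := rfl
  have h4 := prodB_eq_tail (k + 1) k
  rw [aB, Nat.add_sub_cancel, ← mul_assoc, ← mul_assoc, mul_inv_eq_iff_eq_mul, hphi, mul_assoc,
    mul_assoc]
  generalize sB (k + 1) k = z at *
  generalize prodB (k + 1) (k + 1) = P at *
  generalize tailB (k + 1) k = Q at *
  generalize tB (k + 1) = t at *
  generalize sB (k + 1) 0 = s at *
  calc t * (P * (t * P * z)) = t * s * (Q * t) * P * z := by rw [h4]; group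
    _ = t * s * t * (Q * P * z) := by rw [h2]; group
    _ = (t * s * t * s) * Q * P := by rw [h1]; group
    _ = s * t * s * (t * Q) * P := by rw [← h3]; group
    _ = s * (t * (s * Q)) * t * P := by rw [← h2]; group
    _ = s * (t * P) * (t * P) := by rw [h4]; group

theorem braid_conj {G : Type} [Group G] {g a b c d : G} (ha : g * a = c * g) (hb : g * b = d * g)
    (h : a * b * a = b * a * b) : c * d * c = d * c * d := by
  obtain rfl : c = g * a * g⁻¹ := by rw [ha]; group
  obtain rfl : d = g * b * g⁻¹ := by rw [hb]; group
  calc _ = g * (a * b * a) * g⁻¹ := by group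
    _ = g * (b * a * b) * g⁻¹ := by rw [h]
    _ = _ := by group

theorem comm_conj {G : Type} [Group G] {g a b c d : G} (ha : g * a = c * g) (hb : g * b = d * g)
    (h : a * b = b * a) : c * d = d * c := by
  obtain rfl : c = g * a * g⁻¹ := by rw [ha]; group
  obtain rfl : d = g * b * g⁻¹ := by rw [hb]; group
  calc _ = g * (a * b) * g⁻¹ := by group
    _ = g * (b * a) * g⁻¹ := by rw [h]
    _ = _ := by group

/-- The homomorphism `i_n : B(Ã_n) → B(B_{n+1})`, `σ_i ↦ σ_i`,
`a_{n+1} ↦ φ_{n+1} σ_n φ_{n+1}⁻¹`. -/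
def affToB (n : ℕ) : BraidAff n →* BraidB n :=
  PresentedGroup.toGroup (f := fun g => match g with | .s i => sB n i | .a => aB n) <|
    lift_eq_one (by
      have hlast : ∀ i, i + 1 = n → phiB n * sB n i = aB n * phiB n := by
        rintro i rfl; simp [aB]
      rintro _ _ (⟨i, j, h⟩ | ⟨i, j, h⟩ | ⟨i, h, h'⟩ | ⟨i, hn, h⟩ | ⟨i, hn, h⟩) <;>
        simp only [map_mul, FreeGroup.lift_apply_of]
      · exact sB_comm h
      · rw [← h]; exact sB_braid (by omega)
      · obtain ⟨k, hk⟩ : ∃ k, i.val = k + 1 := ⟨i - 1, by omega⟩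
        rw [hk]
        exact comm_conj (phiB_shift (by omega)) (hlast (n - 1) (by omega))
          (sB_comm (by omega))
      · rw [h]
        refine braid_conj (g := (phiB n)⁻¹) (a := sB n 1) (b := sB n 0) ?_ ?_
          (sB_braid (i := 0) (by omega)).symm
        · rw [inv_mul_eq_iff_eq_mul, ← mul_assoc, phiB_shift (by omega)]; group
        · rw [inv_mul_eq_iff_eq_mul, ← mul_assoc, phiB_aB (by omega)]; group
      · obtain ⟨k, hk⟩ : ∃ k, i.val = k + 1 := ⟨i - 1, by omega⟩
        rw [hk]
        exact braid_conj (phiB_shift (by omega)) (hlast (k + 1) (by omega))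
          (sB_braid (by omega)))

/-- The homomorphism `_{n+1}I : B(B_{n+1}) → B(A_{n+1})`, `σ_i ↦ σ_{i+1}`, `t ↦ σ_1²`. -/
def bToA (n : ℕ) : BraidB n →* BraidA (n + 1) :=
  PresentedGroup.toGroup
    (f := fun g => match g with
      | .s i => PresentedGroup.of i.succ
      | .t => PresentedGroup.of 0 ^ 2) <|
    lift_eq_one (by
      have hc : ∀ i j : Fin (n + 1), i.val + 2 ≤ j.val →
          (PresentedGroup.of i * PresentedGroup.of j : BraidA (n + 1)) =
            PresentedGroup.of j * PresentedGroup.of i := fun i j h => by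
        simpa [PresentedGroup.of] using mk_eq_of_rel (RelA.comm i j h)
      have hb : ∀ i j : Fin (n + 1), i.val + 1 = j.val →
          (PresentedGroup.of i * PresentedGroup.of j * PresentedGroup.of i : BraidA (n + 1)) =
            PresentedGroup.of j * PresentedGroup.of i * PresentedGroup.of j := fun i j h => by
        simpa [PresentedGroup.of] using mk_eq_of_rel (RelA.braid i j h)
      rintro _ _ (⟨i, j, h⟩ | ⟨i, j, h⟩ | ⟨i, h⟩ | ⟨i, h⟩) <;>
        simp only [map_mul, FreeGroup.lift_apply_of]
      · exact hc _ _ (by simp; omega)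
      · exact hb _ _ (by simp; omega)
      · have := hc 0 i.succ (by simp; omega)
        exact ((show Commute _ _ from this).pow_left 2).symm
      · have := hb 0 i.succ (by simp; omega)
        generalize (PresentedGroup.of 0 : BraidA (n + 1)) = u at *
        generalize (PresentedGroup.of i.succ : BraidA (n + 1)) = v at *
        simp only [pow_two]
        calc v * (u * u) * v * (u * u) = v * u * (u * v * u) * u := by simp only [mul_assoc]
          _ = v * u * (v * u * v) * u := by rw [this]
          _ = (v * u * v) * (u * v * u) := by simp only [mul_assoc]
          _ = (u * v * u) * (v * u * v) := by rw [this]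
          _ = u * (v * u * v) * u * v := by simp only [mul_assoc]
          _ = u * (u * v * u) * u * v := by rw [this]
          _ = u * u * v * (u * u) * v := by simp only [mul_assoc])

/-- The homomorphism `x̄_{n+1} : B(Ã_n) → B(A_{n+1})`, the composite of `i_n` and `_{n+1}I`. -/
def affToA (n : ℕ) : BraidAff n →* BraidA (n + 1) := (bToA n).comp (affToB n)

theorem sAff_comm {n i j : ℕ} (h : i + 2 ≤ j) : sAff n i * sAff n j = sAff n j * sAff n i := by
  by_cases hj : j < n
  · have hi : i < n := by omega
    simp only [sAff, hi, hj, dif_pos]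
    simpa [PresentedGroup.of] using mk_eq_of_rel (RelAff.comm (⟨i, hi⟩ : Fin n) ⟨j, hj⟩ h)
  · simp [sAff, hj]

theorem sAff_braid {n i : ℕ} (h : i + 1 < n) :
    sAff n i * sAff n (i + 1) * sAff n i = sAff n (i + 1) * sAff n i * sAff n (i + 1) := by
  have hi : i < n := by omega
  simp only [sAff, hi, h, dif_pos]
  simpa [PresentedGroup.of] using mk_eq_of_rel (RelAff.braid (⟨i, hi⟩ : Fin n) ⟨i + 1, h⟩ rfl)

theorem sAff_comm_a {n i : ℕ} (h : 1 ≤ i) (h' : i + 1 < n) :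
    sAff n i * aAff n = aAff n * sAff n i := by
  have hi : i < n := by omega
  simp only [sAff, hi, dif_pos, aAff]
  simpa [PresentedGroup.of] using mk_eq_of_rel (RelAff.comm_a (⟨i, hi⟩ : Fin n) h h')

theorem sAff_braid_first {n : ℕ} (hn : 2 ≤ n) :
    sAff n 0 * aAff n * sAff n 0 = aAff n * sAff n 0 * aAff n := by
  have hi : 0 < n := by omega
  simp only [sAff, hi, dif_pos, aAff]
  simpa [PresentedGroup.of] using mk_eq_of_rel (RelAff.braid_first (⟨0, hi⟩ : Fin n) hn rfl)

theorem sAff_braid_last {n i : ℕ} (hn : 2 ≤ n) (h : i + 1 = n) :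
    sAff n i * aAff n * sAff n i = aAff n * sAff n i * aAff n := by
  have hi : i < n := by omega
  simp only [sAff, hi, dif_pos, aAff]
  simpa [PresentedGroup.of] using mk_eq_of_rel (RelAff.braid_last (⟨i, hi⟩ : Fin n) hn h)

/-- The homomorphism `F_{n+1} : B(Ã_n) → B(Ã_{n+1})`, `σ_i ↦ σ_i`,
`a_{n+1} ↦ σ_{n+1} a_{n+2} σ_{n+1}⁻¹`. -/
def affIncl (n : ℕ) : BraidAff n →* BraidAff (n + 1) :=
  PresentedGroup.toGroup
    (f := fun g => match g with
      | .s i => sAff (n + 1) i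
      | .a => sAff (n + 1) n * aAff (n + 1) * (sAff (n + 1) n)⁻¹) <|
    lift_eq_one (by
      rintro _ _ (⟨i, j, h⟩ | ⟨i, j, h⟩ | ⟨i, h, h'⟩ | ⟨i, hn, h⟩ | ⟨i, hn, h⟩) <;>
        simp only [map_mul, FreeGroup.lift_apply_of]
      · exact sAff_comm h
      · rw [← h]; exact sAff_braid (by omega)
      · exact comm_conj (g := sAff (n + 1) n) (sAff_comm (by omega)).symm (by group)
          (sAff_comm_a h (by omega))
      · rw [h]
        exact braid_conj (g := sAff (n + 1) n) (sAff_comm (by omega)).symm (by group)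
          (sAff_braid_first (by omega))
      · have hab := sAff_braid_last (n := n + 1) (i := n) (by omega) rfl
        refine braid_conj (g := (aAff (n + 1))⁻¹) (a := sAff (n + 1) i) (b := sAff (n + 1) n)
          ?_ ?_ ?_
        · rw [inv_mul_eq_iff_eq_mul, ← mul_assoc, ← sAff_comm_a (by omega) (by omega)]; group
        · generalize sAff (n + 1) n = u at *
          generalize aAff (n + 1) = v at *
          have h1 : u * v * u⁻¹ = v⁻¹ * u * v := by
            rw [mul_inv_eq_iff_eq_mul]
            calc u * v = v⁻¹ * (v * u * v) := by group
              _ = _ := by rw [← hab]; group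
          rw [h1]; group
        · have := sAff_braid (n := n + 1) (i := i) (by omega)
          rwa [h] at this)

/-- The Dynkin automorphism `φ_{n+1}` of `B(Ã_n)`:
`σ_1 ↦ σ_2 ↦ ⋯ ↦ σ_n ↦ a_{n+1} ↦ σ_1`. -/
def dynkin (n : ℕ) : BraidAff n →* BraidAff n :=
  PresentedGroup.toGroup
    (f := fun g => match g with
      | .s i => if i.val + 1 < n then sAff n (i + 1) else aAff n
      | .a => sAff n 0) <|
    lift_eq_one (by
      rintro _ _ (⟨i, j, h⟩ | ⟨i, j, h⟩ | ⟨i, h, h'⟩ | ⟨i, hn, h⟩ | ⟨i, hn, h⟩) <;>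
        simp only [map_mul, FreeGroup.lift_apply_of]
      · rw [if_pos (by omega)]
        split_ifs with hj
        · exact sAff_comm (by omega)
        · exact sAff_comm_a (by omega) (by omega)
      · rw [if_pos (by omega), ← h]
        split_ifs with hj
        · exact sAff_braid (by omega)
        · exact sAff_braid_last (by omega) (by omega)
      · rw [if_pos h']; exact (sAff_comm (by omega)).symm
      · rw [if_pos (by omega), h]; exact (sAff_braid (by omega)).symm
      · rw [if_neg (by omega)]; exact (sAff_braid_first hn).symm)

/-! ### Geometric braids -/

/-- Configurations of `m` distinct labelled points in the plane. -/
abbrev Conf (m : ℕ) : Type := {p : Fin m → ℂ // Function.Injective p}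

/-- The base configuration: the points `0, 1, …, m - 1` of the real line. -/
def basePt (m : ℕ) : Conf m :=
  ⟨fun k => ((k : ℕ) : ℂ), fun _ _ h => Fin.ext (Nat.cast_injective (R := ℂ) h)⟩

/-- The configuration `p` with its labels permuted. -/
def relabel {m : ℕ} (π : Equiv.Perm (Fin m)) (p : Conf m) : Conf m :=
  ⟨fun k => p.1 (π k), p.2.comp π.injective⟩

theorem continuous_relabel {m : ℕ} (π : Equiv.Perm (Fin m)) : Continuous (relabel π) :=
  Continuous.subtype_mk
    (f := fun (p : Conf m) k => p.1 (π k))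
    (continuous_pi fun k => (continuous_apply (π k)).comp continuous_subtype_val) _

/-- A rough braid on `m` strands: `m` paths in the plane, at each time pairwise distinct, the
`k`-th of which goes from the `k`-th base point to the `perm k`-th base point. -/
structure RoughBraid (m : ℕ) where
  perm : Equiv.Perm (Fin m)
  path : Path (basePt m) (relabel perm (basePt m))

namespace RoughBraid

/-- Two rough braids are homotopic if they are joined by a continuous family of rough braids. -/
def Homotopic {m : ℕ} (β γ : RoughBraid m) : Prop :=
  ContinuousMap.HomotopicRel β.path.toContinuousMap γ.path.toContinuousMap {0, 1}

/-- The trivial braid. -/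
def one (m : ℕ) : RoughBraid m := ⟨1, Path.refl (basePt m)⟩

/-- The composite: `β` at the top, `γ` at the bottom (time runs from top to bottom). -/
def mul {m : ℕ} (β γ : RoughBraid m) : RoughBraid m where
  perm := γ.perm * β.perm
  path := β.path.trans (γ.path.map (continuous_relabel β.perm))

/-- The strands of the half twist of the strands `i` and `i + 1` around their midpoint,
through the angle `θ`. -/
def twist {n : ℕ} (i : Fin n) (θ : ℝ) (k : Fin (n + 1)) : ℂ :=
  if k = i.castSucc then (i : ℕ) + 1 / 2 - 1 / 2 * Complex.exp (θ * Complex.I)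
  else if k = i.succ then (i : ℕ) + 1 / 2 + 1 / 2 * Complex.exp (θ * Complex.I)
  else ((k : ℕ) : ℂ)

theorem twist_injective {n : ℕ} (i : Fin n) (θ : ℝ) : Function.Injective (twist i θ) := by
  have he : ‖Complex.exp (θ * Complex.I)‖ = 1 := Complex.norm_exp_ofReal_mul_I θ
  have hne : Complex.exp (θ * Complex.I) ≠ 0 := Complex.exp_ne_zero _
  set e := Complex.exp (θ * Complex.I)
  have key : ∀ (k : Fin (n + 1)) (c : ℂ), ‖c‖ = 1 / 2 → k ≠ i.castSucc → k ≠ i.succ →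
      ((i : ℕ) : ℂ) + 1 / 2 + c ≠ ((k : ℕ) : ℂ) := by
    intro k c hc h1 h2 h
    have h3 : c = (((k : ℕ) : ℝ) - (i : ℕ) - 1 / 2 : ℝ) := by
      push_cast; linear_combination h
    rw [h3, Complex.norm_real, Real.norm_eq_abs] at hc
    rcases (abs_eq (by norm_num)).1 hc with h4 | h4
    · apply h2; ext
      have : ((k : ℕ) : ℝ) = ((i : ℕ) : ℝ) + 1 := by linarith
      simpa using (by exact_mod_cast this : (k : ℕ) = i + 1)
    · apply h1; ext
      have : ((k : ℕ) : ℝ) = ((i : ℕ) : ℝ) := by linarith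
      simpa using (by exact_mod_cast this : (k : ℕ) = i)
  have hp : ‖1 / 2 * e‖ = 1 / 2 := by rw [norm_mul, he]; norm_num
  have hm : ‖-(1 / 2 * e)‖ = 1 / 2 := by rw [norm_neg, hp]
  intro k l hkl
  unfold twist at hkl
  split_ifs at hkl with h1 h2 h3 h4 h5 h6 h7 h8
  · rw [h1, h2]
  · exact absurd (by linear_combination -hkl : e = 0) hne
  · exact absurd (by simpa [sub_eq_add_neg] using hkl) (key l _ hm h2 h3)
  · exact absurd (by linear_combination hkl : e = 0) hne
  · rw [h4, h6]
  · exact absurd hkl (key l _ hp h5 h6)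
  · exact absurd (by simpa [sub_eq_add_neg] using hkl.symm) (key k _ hm h1 h4)
  · exact absurd hkl.symm (key k _ hp h1 h4)
  · exact Fin.ext (by exact_mod_cast hkl)

/-- The half twist of the strands `i` and `i + 1`: a positive one, which is the geometric braid of
the generator `σ_{i+1}`, if `ε` is true, and the inverse one otherwise. -/
def gen {n : ℕ} (i : Fin n) (ε : Bool) : RoughBraid (n + 1) where
  perm := Equiv.swap i.castSucc i.succ
  path :=
    { toFun := fun s => ⟨twist i ((if ε then Real.pi else -Real.pi) * (s : ℝ)),
        twist_injective i _⟩
      continuous_toFun := by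
        refine Continuous.subtype_mk (continuous_pi fun k => ?_) _
        unfold twist
        split_ifs <;> fun_prop
      source' := by
        refine Subtype.ext (funext fun k => ?_)
        simp only [twist, basePt, Set.Icc.coe_zero, mul_zero, Complex.ofReal_zero, zero_mul,
          Complex.exp_zero]
        split_ifs with h1 h2
        · rw [h1]; simp
        · rw [h2]; push_cast [Fin.val_succ]; ring
        · rfl
      target' := by
        refine Subtype.ext (funext fun k => ?_)
        have he : Complex.exp (((if ε then Real.pi else -Real.pi) * 1 : ℝ) * Complex.I) = -1 := by
          cases ε <;> simp [Complex.exp_neg, Complex.exp_pi_mul_I]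
        simp only [twist, basePt, relabel, Set.Icc.coe_one, he]
        split_ifs with h1 h2
        · rw [h1, Equiv.swap_apply_left]; push_cast [Fin.val_succ]; ring
        · rw [h2, Equiv.swap_apply_right]; simp
        · rw [Equiv.swap_apply_of_ne_of_ne h1 h2] }

/-- The geometric braid of a word in the letters `σ_i` (`true`) and `σ_i⁻¹` (`false`). -/
def ofWord {n : ℕ} : List (Fin n × Bool) → RoughBraid (n + 1)
  | [] => one (n + 1)
  | (i, ε) :: w => mul (gen i ε) (ofWord w)

/-- The rough braid `β` represents the element `b` of `B(A_n)`. -/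
def Represents {n : ℕ} (β : RoughBraid (n + 1)) (b : BraidA n) : Prop :=
  ∃ w : List (Fin n × Bool),
    PresentedGroup.mk (relators (RelA n)) (FreeGroup.mk w) = b ∧ β.Homotopic (ofWord w)

end RoughBraid

/-! ### Oriented links -/

/-- Euclidean three-space, with the coordinates `(u, h)`, `u ∈ ℂ = ℝ²` and `h ∈ ℝ`. -/
abbrev Space : Type := ℂ × ℝ

/-- A rough oriented link: finitely many disjoint oriented simple closed curves in space. -/
structure OrientedLink where
  ι : Type
  finite : Finite ι
  curve : ι → UnitAddCircle → Space
  continuous : ∀ i, Continuous (curve i)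
  injective : Function.Injective fun p : ι × UnitAddCircle => curve p.1 p.2

/-- An ambient isotopy of space: a continuous family of homeomorphisms, with continuous inverses,
that starts at the identity. -/
structure AmbientIsotopy where
  homeo : unitInterval × Space ≃ₜ unitInterval × Space
  level : ∀ p, (homeo p).1 = p.1
  start : ∀ x, homeo (0, x) = (0, x)

/-- The homeomorphism at the end of an ambient isotopy. -/
def AmbientIsotopy.final (Φ : AmbientIsotopy) (x : Space) : Space := (Φ.homeo (1, x)).2

/-- Isotopy of oriented links: an ambient isotopy carries one to the other, up to an
orientation-preserving reparametrization of each component, that is, one which lifts to an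
increasing bijection of `ℝ` commuting with `s ↦ s + 1`. -/
def OrientedLink.Isotopic (L M : OrientedLink) : Prop :=
  ∃ (Φ : AmbientIsotopy) (e : L.ι ≃ M.ι) (g : L.ι → (ℝ ≃o ℝ)),
    (∀ i s, g i (s + 1) = g i s + 1) ∧
    ∀ i (s : ℝ), Φ.final (L.curve i (s : UnitAddCircle)) = M.curve (e i) (g i s : UnitAddCircle)

theorem AmbientIsotopy.homeo_one (Φ : AmbientIsotopy) (x : Space) :
    Φ.homeo (1, x) = (1, Φ.final x) := Prod.ext (Φ.level _) rfl

theorem OrientedLink.isotopic_equivalence : Equivalence OrientedLink.Isotopic where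
  refl L := ⟨⟨Homeomorph.refl _, fun _ => rfl, fun _ => rfl⟩, Equiv.refl _,
    fun _ => OrderIso.refl ℝ, fun _ _ => rfl, fun _ _ => rfl⟩
  symm := by
    rintro L M ⟨Φ, e, g, hg, h⟩
    refine ⟨⟨Φ.homeo.symm, fun p => ?_, fun x => ?_⟩, e.symm, fun j => (g (e.symm j)).symm,
      fun j s => ?_, fun j s => ?_⟩
    · have := Φ.level (Φ.homeo.symm p)
      rw [Homeomorph.apply_symm_apply] at this
      exact this.symm
    · rw [Homeomorph.symm_apply_eq]; exact (Φ.start x).symm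
    · rw [OrderIso.symm_apply_eq, hg, OrderIso.apply_symm_apply]
    · have h1 := h (e.symm j) ((g (e.symm j)).symm s)
      rw [OrderIso.apply_symm_apply, Equiv.apply_symm_apply] at h1
      simp only [AmbientIsotopy.final]
      rw [← h1, ← Φ.homeo_one, Homeomorph.symm_apply_apply]
  trans := by
    rintro L M N ⟨Φ, e, g, hg, h⟩ ⟨Ψ, e', g', hg', h'⟩
    refine ⟨⟨Φ.homeo.trans Ψ.homeo, fun p => ?_, fun x => ?_⟩, e.trans e',
      fun i => (g i).trans (g' (e i)), fun i s => ?_, fun i s => ?_⟩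
    · rw [Homeomorph.trans_apply, Ψ.level, Φ.level]
    · rw [Homeomorph.trans_apply, Φ.start, Ψ.start]
    · simp only [OrderIso.trans_apply, hg, hg']
    · simp only [AmbientIsotopy.final, Homeomorph.trans_apply]
      rw [Φ.homeo_one, h]
      exact h' _ _

/-- The isotopy relation on rough oriented links. -/
def linkSetoid : Setoid OrientedLink := ⟨OrientedLink.Isotopic, OrientedLink.isotopic_equivalence⟩

/-- An (oriented) link: an isotopy class of rough oriented links. -/
def Link : Type 1 := Quotient linkSetoid

/-! ### Closures -/

/-- The point of space at angle `2 π s` around the vertical axis which corresponds to the point `z`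
of the plane. This identifies the product of the plane and the circle with the complement of the
axis; points further to the right are closer to the axis. -/
def around (z : ℂ) (s : ℝ) : Space :=
  (Real.exp (-z.re) * Complex.exp (2 * Real.pi * s * Complex.I), z.im)

/-- The position at time `s` of the point that starts at the `k`-th base point and goes through the
braid again and again, each time along the strand that starts where the previous one ended. -/
def RoughBraid.track {m : ℕ} (β : RoughBraid m) (k : Fin m) (s : ℝ) : ℂ :=
  (β.path ⟨Int.fract s, Int.fract_nonneg s, (Int.fract_lt_one s).le⟩).1 ((β.perm ^ ⌊s⌋) k)

/-- The number of turns after which the closed strand through the `k`-th base point closes up. -/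
def RoughBraid.period {m : ℕ} (β : RoughBraid m) (k : Fin m) : ℕ :=
  Function.minimalPeriod β.perm k

theorem continuous_around : Continuous fun p : ℂ × ℝ => around p.1 p.2 := by
  unfold around; fun_prop

theorem around_inj {z w : ℂ} {s r : ℝ} (h : around z s = around w r) :
    z = w ∧ ∃ j : ℤ, s = r + j := by
  obtain ⟨h1, h2⟩ := Prod.ext_iff.1 h
  simp only [around] at h1 h2
  have hn := congrArg norm h1
  have e : ∀ x : ℝ, (2 * Real.pi * x * Complex.I : ℂ) = ((2 * Real.pi * x : ℝ) : ℂ) * Complex.I := by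
    intro x; push_cast; ring
  rw [norm_mul, norm_mul, e, e, Complex.norm_exp_ofReal_mul_I, Complex.norm_exp_ofReal_mul_I,
    mul_one, mul_one, Complex.norm_real, Complex.norm_real, Real.norm_eq_abs, Real.norm_eq_abs,
    Real.abs_exp, Real.abs_exp, Real.exp_eq_exp, neg_inj] at hn
  refine ⟨Complex.ext hn h2, ?_⟩
  rw [hn] at h1
  have h3 := mul_left_cancel₀ (by exact_mod_cast (Real.exp_pos _).ne') h1
  obtain ⟨j, hj⟩ := Complex.exp_eq_exp_iff_exists_int.1 h3
  refine ⟨j, ?_⟩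
  have hpi : (2 * Real.pi * Complex.I : ℂ) ≠ 0 := Complex.two_pi_I_ne_zero
  have : (s : ℂ) = r + j := by
    apply mul_left_cancel₀ hpi
    linear_combination hj
  exact_mod_cast this

theorem around_add_int (z : ℂ) (s : ℝ) (j : ℤ) : around z (s + j) = around z s := by
  unfold around
  congr 2
  rw [Complex.exp_eq_exp_iff_exists_int]
  exact ⟨j, by push_cast; ring⟩

namespace RoughBraid

variable {m : ℕ} (β : RoughBraid m)

theorem period_pos (k : Fin m) : 0 < β.period k :=
  Function.minimalPeriod_pos_of_mem_periodicPts
    (Function.mem_periodicPts.2 ⟨orderOf β.perm, orderOf_pos _, by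
      rw [Function.IsPeriodicPt, Function.IsFixedPt, Equiv.Perm.iterate_eq_pow, pow_orderOf_eq_one]
      rfl⟩)

theorem zpow_apply_eq_iff (k : Fin m) (j : ℤ) :
    (β.perm ^ j) k = k ↔ (β.period k : ℤ) ∣ j := by
  have key : ∀ a : ℕ, (β.perm ^ a) k = k ↔ β.period k ∣ a := fun a => by
    rw [← Equiv.Perm.iterate_eq_pow]
    exact Function.isPeriodicPt_iff_minimalPeriod_dvd
  rcases Int.eq_nat_or_neg j with ⟨a, rfl | rfl⟩
  · rw [zpow_natCast, key, Int.natCast_dvd_natCast]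
  · rw [zpow_neg, Equiv.Perm.inv_eq_iff_eq, zpow_natCast, eq_comm, key, dvd_neg,
      Int.natCast_dvd_natCast]

theorem track_eq {k : Fin m} {s : ℝ} {j : ℤ} (h : s ∈ Set.Icc (j : ℝ) (j + 1)) :
    β.track k s = (β.path (Set.projIcc 0 1 zero_le_one (s - j))).1 ((β.perm ^ j) k) := by
  have hmem : s - j ∈ Set.Icc (0 : ℝ) 1 := ⟨by linarith [h.1], by linarith [h.2]⟩
  rw [Set.projIcc_of_mem _ hmem]
  rcases h.2.eq_or_lt with hs | hs
  · have hs' : s = ((j + 1 : ℤ) : ℝ) := by push_cast; exact hs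
    have h0 : (⟨Int.fract s, Int.fract_nonneg s, (Int.fract_lt_one s).le⟩ : unitInterval) = 0 :=
      Subtype.ext (by rw [hs']; simp)
    have h1 : (⟨s - j, hmem⟩ : unitInterval) = 1 := Subtype.ext (by simp [hs])
    rw [track, h0, h1, Path.source, Path.target, hs', Int.floor_intCast]
    simp only [relabel]
    rw [add_comm, zpow_add, zpow_one, Equiv.Perm.mul_apply]
  · have hf : ⌊s⌋ = j := Int.floor_eq_iff.2 ⟨h.1, hs⟩
    have h0 : (⟨Int.fract s, Int.fract_nonneg s, (Int.fract_lt_one s).le⟩ : unitInterval) =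
        ⟨s - j, hmem⟩ := Subtype.ext (by simp [Int.fract, hf])
    rw [track, h0, hf]

theorem continuous_track (k : Fin m) : Continuous (β.track k) := by
  have hlf : LocallyFinite fun j : ℤ => Set.Icc (j : ℝ) (j + 1) := by
    intro x
    refine ⟨Set.Ioo (x - 1) (x + 1), Ioo_mem_nhds (by linarith) (by linarith), ?_⟩
    refine (Set.finite_Icc (⌊x⌋ - 2) (⌊x⌋ + 2)).subset ?_
    rintro j ⟨y, hy1, hy2⟩
    have h1 := Int.floor_le x
    have h2 := Int.lt_floor_add_one x
    have h3 : (⌊x⌋ : ℝ) - 2 ≤ j := by linarith [hy1.2, hy2.1]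
    have h4 : (j : ℝ) ≤ ⌊x⌋ + 2 := by linarith [hy1.1, hy2.2]
    exact ⟨by exact_mod_cast h3, by exact_mod_cast h4⟩
  refine hlf.continuous (Set.eq_univ_of_forall fun x => Set.mem_iUnion.2
    ⟨⌊x⌋, Int.floor_le x, (Int.lt_floor_add_one x).le⟩) (fun j => isClosed_Icc) fun j => ?_
  refine ContinuousOn.congr (f := fun s : ℝ =>
    (β.path (Set.projIcc 0 1 zero_le_one (s - j))).1 ((β.perm ^ j) k)) ?_
    fun s hs => β.track_eq hs
  refine Continuous.continuousOn ?_
  exact (continuous_apply _).comp (continuous_subtype_val.comp (β.path.continuous.comp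
    (continuous_projIcc.comp (continuous_id.sub continuous_const))))

theorem track_periodic (k : Fin m) (s : ℝ) : β.track k (s + β.period k) = β.track k s := by
  have h1 : s + (β.period k : ℝ) = s + ((β.period k : ℤ) : ℝ) := by push_cast; rfl
  have h2 : (β.perm ^ (⌊s⌋ + (β.period k : ℤ))) k = (β.perm ^ ⌊s⌋) k := by
    rw [zpow_add, Equiv.Perm.mul_apply, (β.zpow_apply_eq_iff k _).2 dvd_rfl]
  unfold track
  simp only [h1, Int.fract_add_intCast, Int.floor_add_intCast, h2]

/-- The closed curve of the closure through the `k`-th base point, as a `1`-periodic function. -/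
def loop (k : Fin m) (s : ℝ) : Space := around (β.track k (β.period k * s)) (β.period k * s)

theorem loop_periodic (k : Fin m) : Function.Periodic (β.loop k) 1 := by
  intro s
  have := around_add_int (β.track k (β.period k * s)) (β.period k * s) (β.period k : ℤ)
  simp only [loop, mul_add, mul_one, track_periodic]
  simpa using this

/-- The closure of a rough braid: the braid is bent once around a vertical axis to the right of
the braid, and its top is glued to its bottom. The components correspond to the cycles of the
permutation of the braid, and they are oriented in the direction of time. -/
def closure : OrientedLink where
  ι := Quotient (Equiv.Perm.SameCycle.setoid β.perm)
  finite := inferInstance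
  curve q := (β.loop_periodic q.out).lift
  continuous q := by
    refine continuous_quot_lift _ ?_
    have : Continuous fun s : ℝ => (β.period q.out : ℝ) * s := continuous_const.mul continuous_id
    exact continuous_around.comp (((β.continuous_track _).comp this).prodMk this)
  injective := by
    rintro ⟨q, x⟩ ⟨q', x'⟩ h
    induction x using QuotientAddGroup.induction_on with | H s => ?_
    induction x' using QuotientAddGroup.induction_on with | H s' => ?_
    obtain ⟨h1, j, hj⟩ := around_inj (show β.loop q.out s = β.loop q'.out s' from h)
    set k := q.out with hk
    set k' := q'.out with hk'
    have hfr : Int.fract ((β.period k : ℝ) * s) = Int.fract ((β.period k' : ℝ) * s') := by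
      rw [hj, Int.fract_add_intCast]
    unfold track at h1
    simp only [hfr] at h1
    have h2 := (β.path _).2 h1
    rw [hj, Int.floor_add_intCast] at h2
    have hqq : q = q' := by
      rw [← Quotient.out_eq q, ← Quotient.out_eq q']
      refine Quotient.sound (?_ : Equiv.Perm.SameCycle β.perm q.out q'.out)
      refine ⟨-⌊(β.period k' : ℝ) * s'⌋ + (⌊(β.period k' : ℝ) * s'⌋ + j), ?_⟩
      rw [zpow_add, Equiv.Perm.mul_apply, h2, ← Equiv.Perm.mul_apply, ← zpow_add]
      simp [hk']
    subst hqq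
    refine Prod.ext rfl ?_
    have h3 : (β.perm ^ j) k = k := by
      rw [zpow_add, Equiv.Perm.mul_apply] at h2
      exact (β.perm ^ _).injective h2
    obtain ⟨l, rfl⟩ := (β.zpow_apply_eq_iff k j).1 h3
    have hp : (β.period k : ℝ) ≠ 0 := by exact_mod_cast (β.period_pos k).ne'
    have h4 : s = s' + l := by
      apply mul_left_cancel₀ hp
      rw [hj]; push_cast; ring
    change (s : UnitAddCircle) = s'
    rw [h4, AddCircle.coe_add]
    have : ((l : ℝ) : UnitAddCircle) = 0 := (AddCircle.coe_eq_zero_iff 1).2 ⟨l, by simp⟩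
    rw [this, add_zero]

end RoughBraid

/-- `ℓ` is the closure `b̂` of `b ∈ B(A_n)`: the isotopy class of the closure of a rough braid that
represents `b`. -/
def IsClosure {n : ℕ} (b : BraidA n) (ℓ : Link) : Prop :=
  ∃ β : RoughBraid (n + 1), β.Represents b ∧ ℓ = Quotient.mk linkSetoid β.closure

/-- `ℓ` is the closure `x̂` of the affine braid `x ∈ B(Ã_n)`, that is, the closure of its image
under `x̄_{n+1} : B(Ã_n) → B(A_{n+1})`. -/
def IsAffineClosure {n : ℕ} (x : BraidAff n) (ℓ : Link) : Prop := IsClosure (affToA n x) ℓ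

/-- Every affine braid has a closure. -/
theorem exists_isAffineClosure {n : ℕ} (x : BraidAff n) : ∃ ℓ, IsAffineClosure x ℓ := by
  obtain ⟨u, hu⟩ := PresentedGroup.mk_surjective _ (affToA n x)
  exact ⟨_, RoughBraid.ofWord u.toWord, ⟨u.toWord, by rw [FreeGroup.mk_toWord, hu],
    ContinuousMap.HomotopicRel.refl _⟩, rfl⟩

end

end AffineLink

open AffineLink

namespace AffineLink

noncomputable section

open Topology

/-! The algebra turns both claims into Markov moves. Write `φ` for `phiB n`. In the type `B` Artin
group the Dynkin automorphism is conjugation by `φ` (`affToB_dynkin`), so in claim 1 the images of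
`x` and `y` in `B(A_{n+1})` are conjugate. For claim 2, viewing `x` in the next affine group amounts
to adding a fixed strand (`affToA_affIncl`), and the new affine generator becomes `g σ g⁻¹`, where
`σ` is the last standard generator and `g` is the image of `φ`, which involves only the earlier
strands (`aB_succ`, `bToA_phiBIncl`). Hence the image of the product is `g (g⁻¹ x g · σ) g⁻¹`: a
conjugate of the stabilization of a conjugate of `x`.

It remains to prove that closures are well defined and invariant under conjugation and positive
stabilization (`IsClosure.unique`, `IsClosure.conj`, `IsClosure.stabilize`), for merely continuous
braids.

Well-definedness has two halves. The braid relations hold up to homotopy because both sides of each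
one stay in a star-shaped set of configurations (`homotopic_of_mem_cutConf`); this gives `classHom`.
A homotopy of closed braids extends to an ambient isotopy (`exists_isotopy_of_homotopy`): for nearby
braids the points are pushed by a displacement of Lipschitz constant less than one, which is
invertible by Banach's fixed point theorem, and connectedness of the interval chains the small
steps. Conjugation invariance follows by rotating the closure of `βγ` through half a turn.

For stabilization, linear homotopies give the two closures a standard form. In one of them the last
strand makes a short excursion near the axis; in the other it makes the same excursion along a helix
with one more turn. A compactly supported horizontal translation of each level, inside a cylinder
around the axis that no other strand enters, carries the short arc to the helix
(`exists_isotopy_curl`). What remains is to reparametrize the components. -/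

/-! ### Ambient isotopies with compact support -/

/-- A continuous bijection which is the identity outside a compact set is a closed map. -/
theorem isClosedMap_of_compact_support {X : Type*} [TopologicalSpace X] [T2Space X] {f : X → X}
    (hf : Continuous f) {K : Set X} (hK : IsCompact K) (h : ∀ x ∉ K, f x = x) : IsClosedMap f := by
  -- Passing to the closure of the complement makes the part of `f '' C` coming from outside `K`
  -- closed; the part coming from `K` is compact.
  have hid : ∀ x ∈ closure Kᶜ, f x = x := fun x hx =>
    closure_minimal (t := {x | f x = x}) (fun x hx => h x hx) (isClosed_eq hf continuous_id) hx
  intro C hC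
  have : f '' C = f '' (K ∩ C) ∪ (C ∩ closure Kᶜ) := by
    ext y
    constructor
    · rintro ⟨x, hx, rfl⟩
      by_cases hxK : x ∈ K
      · exact Or.inl ⟨x, ⟨hxK, hx⟩, rfl⟩
      · rw [h x hxK]
        exact Or.inr ⟨hx, subset_closure hxK⟩
    · rintro (⟨x, hx, rfl⟩ | hy)
      · exact ⟨x, hx.2, rfl⟩
      · exact ⟨y, hy.1, hid y hy.2⟩
  rw [this]
  exact ((hK.inter_right hC).image hf).isClosed.union (hC.inter isClosed_closure)

/-- A continuous family of bijections of space that starts at the identity and has a common compact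
support is an ambient isotopy. -/
theorem AmbientIsotopy.exists_of_compact_support (Ψ : unitInterval → Space → Space)
    (hc : Continuous fun p : unitInterval × Space => Ψ p.1 p.2)
    (hbij : ∀ u, Function.Bijective (Ψ u)) (h0 : ∀ x, Ψ 0 x = x)
    {K : Set Space} (hK : IsCompact K) (h : ∀ u, ∀ x ∉ K, Ψ u x = x) :
    ∃ Φ : AmbientIsotopy, ∀ x, Φ.final x = Ψ 1 x := by
  let F : unitInterval × Space → unitInterval × Space := fun p => (p.1, Ψ p.1 p.2)
  have hF : Continuous F := continuous_fst.prodMk hc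
  have hFb : Function.Bijective F := by
    constructor
    · rintro ⟨u, x⟩ ⟨v, y⟩ hxy
      obtain ⟨h1, h2⟩ := Prod.ext_iff.1 hxy
      obtain rfl : u = v := h1
      exact Prod.ext rfl ((hbij u).1 h2)
    · rintro ⟨u, y⟩
      obtain ⟨x, rfl⟩ := (hbij u).2 y
      exact ⟨(u, x), rfl⟩
  have hcl : IsClosedMap F := by
    refine isClosedMap_of_compact_support hF (isCompact_univ.prod hK) ?_
    rintro ⟨u, x⟩ hx
    have : x ∉ K := fun hxK => hx ⟨trivial, hxK⟩
    exact Prod.ext rfl (h u x this)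
  refine ⟨⟨(Equiv.ofBijective F hFb).toHomeomorphOfIsInducing ?_, fun _ => rfl, fun x => ?_⟩,
    fun _ => rfl⟩
  · exact (IsClosedEmbedding.of_continuous_injective_isClosedMap hF hFb.1 hcl).isInducing
  · exact Prod.ext rfl (h0 x)

/-- One ambient isotopy followed by another one. -/
def AmbientIsotopy.trans (Φ Ψ : AmbientIsotopy) : AmbientIsotopy where
  homeo := Φ.homeo.trans Ψ.homeo
  level p := by rw [Homeomorph.trans_apply, Ψ.level, Φ.level]
  start x := by rw [Homeomorph.trans_apply, Φ.start, Ψ.start]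

theorem AmbientIsotopy.final_trans (Φ Ψ : AmbientIsotopy) (x : Space) :
    (Φ.trans Ψ).final x = Ψ.final (Φ.final x) := by
  simp only [AmbientIsotopy.final, AmbientIsotopy.trans, Homeomorph.trans_apply]
  rw [Φ.homeo_one]

/-- The inverse of an ambient isotopy. -/
def AmbientIsotopy.symm (Φ : AmbientIsotopy) : AmbientIsotopy where
  homeo := Φ.homeo.symm
  level p := by
    have := Φ.level (Φ.homeo.symm p)
    rw [Homeomorph.apply_symm_apply] at this
    exact this.symm
  start x := by rw [Homeomorph.symm_apply_eq]; exact (Φ.start x).symm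

theorem AmbientIsotopy.final_symm (Φ : AmbientIsotopy) (x : Space) :
    Φ.symm.final (Φ.final x) = x := by
  simp only [AmbientIsotopy.final, AmbientIsotopy.symm]
  have := Φ.homeo_one x
  rw [AmbientIsotopy.final] at this
  rw [← this, Homeomorph.symm_apply_apply]

theorem AmbientIsotopy.final_injective (Φ : AmbientIsotopy) : Function.Injective Φ.final :=
  Function.LeftInverse.injective Φ.final_symm

/-- A contractive perturbation of the identity of a Banach space is bijective. -/
theorem bijective_add_of_lipschitz {E : Type*} [NormedAddCommGroup E] [CompleteSpace E] {f : E → E}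
    {K : NNReal} (hK : K < 1) (hf : LipschitzWith K f) :
    Function.Bijective fun z => z + f z := by
  -- Solving `z + f z = y` means finding a fixed point of `z ↦ y - f z`.
  have hcon : ∀ y, ContractingWith K fun z => y - f z := fun y => by
    refine ⟨hK, LipschitzWith.of_dist_le_mul fun a b => ?_⟩
    rw [dist_sub_left]
    exact hf.dist_le_mul a b
  constructor
  · intro a b hab
    dsimp only at hab
    refine (hcon (a + f a)).fixedPoint_unique' (x := a) (y := b) ?_ ?_
    · simp [Function.IsFixedPt]
    · rw [Function.IsFixedPt, hab]; simp
  · intro y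
    refine ⟨(hcon y).fixedPoint, ?_⟩
    have := (hcon y).fixedPoint_isFixedPt
    rw [Function.IsFixedPt] at this
    dsimp only at this ⊢
    exact (eq_sub_iff_add_eq.1 this.symm)

/-! ### Displacements around the axis -/

/-- The point of the plane which corresponds to a point of space outside the axis. -/
def planePart (x : Space) : ℂ := ⟨-Real.log ‖x.1‖, x.2⟩

theorem planePart_around (z : ℂ) (s : ℝ) : planePart (around z s) = z := by
  have e : (2 * Real.pi * s * Complex.I : ℂ) = ((2 * Real.pi * s : ℝ) : ℂ) * Complex.I := by
    push_cast; ring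
  apply Complex.ext
  · simp only [planePart, around]
    rw [norm_mul, e, Complex.norm_exp_ofReal_mul_I, mul_one, Complex.norm_real, Real.norm_eq_abs,
      Real.abs_exp, Real.log_exp, neg_neg]
  · rfl

theorem around_fst_ne_zero (z : ℂ) (s : ℝ) : (around z s).1 ≠ 0 :=
  mul_ne_zero (by exact_mod_cast (Real.exp_pos _).ne') (Complex.exp_ne_zero _)

/-- The reference angle `s₀` is free: it rotates the branch cut of `Complex.arg` away from any given
point, so that the angle can be chosen continuously near that point. -/
theorem around_planePart {x : Space} (hx : x.1 ≠ 0) {s₀ s : ℝ}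
    (hs : s = s₀ + Complex.arg (x.1 * Complex.exp (-(2 * Real.pi * s₀ * Complex.I))) /
      (2 * Real.pi)) :
    around (planePart x) s = x := by
  have hpi : (Real.pi : ℂ) ≠ 0 := by exact_mod_cast Real.pi_ne_zero
  refine Prod.ext ?_ rfl
  simp only [around, planePart, neg_neg]
  rw [Real.exp_log (norm_pos_iff.2 hx)]
  set y := x.1 * Complex.exp (-(2 * Real.pi * s₀ * Complex.I)) with hy
  have hny : ‖y‖ = ‖x.1‖ := by
    have e : (-(2 * Real.pi * s₀ * Complex.I) : ℂ) =
        ((-(2 * Real.pi * s₀) : ℝ) : ℂ) * Complex.I := by push_cast; ring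
    rw [hy, norm_mul, e, Complex.norm_exp_ofReal_mul_I, mul_one]
  have h1 : (2 * Real.pi * s * Complex.I : ℂ) =
      Complex.arg y * Complex.I + 2 * Real.pi * s₀ * Complex.I := by
    rw [hs]; push_cast; field_simp; ring
  rw [h1, Complex.exp_add, ← mul_assoc, ← hny, Complex.norm_mul_exp_arg_mul_I, hy, mul_assoc,
    ← Complex.exp_add]
  simp

theorem exists_around_eq {x : Space} (hx : x.1 ≠ 0) : ∃ s, around (planePart x) s = x :=
  ⟨_, around_planePart hx (s₀ := 0) rfl⟩

theorem continuousAt_planePart {x : Space} (hx : x.1 ≠ 0) : ContinuousAt planePart x := by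
  have h : ContinuousAt (fun x : Space => -Real.log ‖x.1‖) x :=
    (continuous_fst.norm.continuousAt.log (norm_ne_zero_iff.2 hx)).neg
  have h2 : planePart = fun x : Space => ((-Real.log ‖x.1‖ : ℝ) : ℂ) + (x.2 : ℂ) * Complex.I := by
    funext x; apply Complex.ext <;> simp [planePart]
  rw [h2]
  exact (Complex.continuous_ofReal.continuousAt.comp h).add
    ((Complex.continuous_ofReal.comp continuous_snd).continuousAt.mul continuousAt_const)

/-- A displacement of the plane which depends `1`-periodically on the angle, is contractive and has
bounded support gives an ambient isotopy which fixes the axis. -/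
theorem exists_isotopy_around (f : ℝ → ℂ → ℂ) (hc : Continuous fun p : ℝ × ℂ => f p.1 p.2)
    (hper : ∀ s z, f (s + 1) z = f s z) {K : NNReal} (hK : K < 1)
    (hlip : ∀ s, LipschitzWith K (f s)) {M : ℝ} (hM : ∀ s z, M ≤ ‖z‖ → f s z = 0) :
    ∃ Φ : AmbientIsotopy, ∀ z s, Φ.final (around z s) = around (z + f s z) s := by
  classical
  have hper_int : ∀ (s : ℝ) (j : ℤ) z, f (s + j) z = f s z := fun s j z => by
    have hp : Function.Periodic (fun s => f s z) 1 := fun s => hper s z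
    simpa using hp.int_mul j s
  -- This angle jumps along the cut of `arg`. That is harmless: by periodicity, `key` computes `Ψ`
  -- with any angle.
  let ang : Space → ℝ := fun x => Complex.arg x.1 / (2 * Real.pi)
  have hang : ∀ x : Space, x.1 ≠ 0 → around (planePart x) (ang x) = x := fun x hx =>
    around_planePart hx (s₀ := 0) (by simp [ang])
  let Ψ : unitInterval → Space → Space := fun u x =>
    if x.1 = 0 then x else around (planePart x + (u : ℝ) • f (ang x) (planePart x)) (ang x)
  have key : ∀ u z s, Ψ u (around z s) = around (z + (u : ℝ) • f s z) s := by
    intro u z s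
    have h1 := hang _ (around_fst_ne_zero z s)
    rw [planePart_around] at h1
    obtain ⟨-, j, hj⟩ := around_inj h1
    simp only [Ψ, if_neg (around_fst_ne_zero z s), planePart_around]
    rw [hj, around_add_int, hper_int]
  have hL : ∀ (u : unitInterval) s, Function.Bijective fun z => z + (u : ℝ) • f s z := by
    intro u s
    refine bijective_add_of_lipschitz hK (LipschitzWith.of_dist_le_mul fun a b => ?_)
    rw [dist_smul₀, Real.norm_of_nonneg u.2.1]
    calc (u : ℝ) * dist (f s a) (f s b) ≤ 1 * dist (f s a) (f s b) :=
          mul_le_mul_of_nonneg_right u.2.2 dist_nonneg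
      _ ≤ _ := by rw [one_mul]; exact (hlip s).dist_le_mul a b
  have hbij : ∀ u, Function.Bijective (Ψ u) := by
    intro u
    constructor
    · intro x y hxy
      by_cases hx : x.1 = 0 <;> by_cases hy : y.1 = 0
      · simpa [Ψ, hx, hy] using hxy
      · obtain ⟨s, hs⟩ := exists_around_eq hy
        rw [← hs, key] at hxy
        simp only [Ψ, if_pos hx] at hxy
        exact absurd (hxy ▸ hx) (around_fst_ne_zero _ _)
      · obtain ⟨s, hs⟩ := exists_around_eq hx
        rw [← hs, key] at hxy
        simp only [Ψ, if_pos hy] at hxy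
        exact absurd (hxy ▸ hy) (around_fst_ne_zero _ _)
      · obtain ⟨s, hs⟩ := exists_around_eq hx
        obtain ⟨r, hr⟩ := exists_around_eq hy
        rw [← hs, ← hr, key, key] at hxy
        obtain ⟨h1, j, rfl⟩ := around_inj hxy
        rw [hper_int] at h1
        have h2 := (hL u r).1 h1
        rw [← hs, ← hr, around_add_int, h2]
    · intro y
      by_cases hy : y.1 = 0
      · exact ⟨y, by simp [Ψ, hy]⟩
      · obtain ⟨s, hs⟩ := exists_around_eq hy
        obtain ⟨z, hz⟩ := (hL u s).2 (planePart y)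
        exact ⟨around z s, by rw [key, ← hs]; exact congrArg (around · s) hz⟩
  have hout : ∀ u x, ¬ ‖x.1‖ = 0 → M ≤ ‖planePart x‖ → Ψ u x = x := by
    intro u x hx h
    have hx : x.1 ≠ 0 := norm_ne_zero_iff.1 hx
    obtain ⟨s, hs⟩ := exists_around_eq hx
    have := key u (planePart x) s
    rwa [hM _ _ h, smul_zero, add_zero, hs] at this
  -- Close to the axis `planePart` has large real part, hence lies outside the support of `f`. So
  -- `Ψ` is the identity near the axis, which gives continuity there.
  have hin : ∀ u (x : Space), ‖x.1‖ < Real.exp (-|M|) → Ψ u x = x := by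
    intro u x hx
    by_cases h0 : x.1 = 0
    · simp [Ψ, h0]
    · refine hout u x (norm_ne_zero_iff.2 h0) ((le_abs_self M).trans ?_)
      refine le_trans ?_ (Complex.abs_re_le_norm _)
      have h1 := Real.log_lt_log (norm_pos_iff.2 h0) hx
      rw [Real.log_exp] at h1
      have h2 := le_abs_self (planePart x).re
      simp only [planePart] at h2 ⊢
      linarith
  have hcont : Continuous fun p : unitInterval × Space => Ψ p.1 p.2 := by
    rw [continuous_iff_continuousAt]
    rintro ⟨u, x⟩
    by_cases h0 : x.1 = 0
    · have hev : (fun p : unitInterval × Space => Ψ p.1 p.2) =ᶠ[𝓝 (u, x)] fun p => p.2 := by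
        have hopen : IsOpen {p : unitInterval × Space | ‖p.2.1‖ < Real.exp (-|M|)} :=
          isOpen_lt (by fun_prop) continuous_const
        filter_upwards [hopen.mem_nhds (by simp [h0, Real.exp_pos])] with p hp
        exact hin _ _ hp
      exact continuousAt_snd.congr_of_eventuallyEq hev
    · obtain ⟨s₀, hs₀⟩ := exists_around_eq h0
      -- A local branch of the angle, continuous at the given point.
      let σ : Space → ℝ := fun x =>
        s₀ + Complex.arg (x.1 * Complex.exp (-(2 * Real.pi * s₀ * Complex.I))) / (2 * Real.pi)
      have hev : (fun p : unitInterval × Space => Ψ p.1 p.2) =ᶠ[𝓝 (u, x)] fun p =>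
          around (planePart p.2 + (p.1 : ℝ) • f (σ p.2) (planePart p.2)) (σ p.2) := by
        have hopen : IsOpen {p : unitInterval × Space | p.2.1 ≠ 0} :=
          isOpen_ne_fun (by fun_prop) continuous_const
        filter_upwards [hopen.mem_nhds h0] with p hp
        conv_lhs => rw [← around_planePart (x := p.2) hp (s := σ p.2) rfl]
        rw [key]
      refine ContinuousAt.congr_of_eventuallyEq ?_ hev
      have hσ : ContinuousAt σ x := by
        have harg : ContinuousAt Complex.arg
            (x.1 * Complex.exp (-(2 * Real.pi * s₀ * Complex.I))) := by
          apply Complex.continuousAt_arg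
          rw [← hs₀]
          simp only [around]
          rw [mul_assoc, ← Complex.exp_add, add_neg_cancel, Complex.exp_zero, mul_one]
          exact Complex.ofReal_mem_slitPlane.2 (Real.exp_pos _)
        have h2 : ContinuousAt (fun x : Space =>
            x.1 * Complex.exp (-(2 * Real.pi * s₀ * Complex.I))) x := by fun_prop
        exact continuousAt_const.add ((ContinuousAt.comp (f := fun x : Space =>
            x.1 * Complex.exp (-(2 * Real.pi * s₀ * Complex.I))) harg h2).div_const _)
      have hσ' : ContinuousAt (fun p : unitInterval × Space => σ p.2) (u, x) :=
        ContinuousAt.comp (f := Prod.snd) (g := σ) hσ continuousAt_snd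
      have hz' : ContinuousAt (fun p : unitInterval × Space => planePart p.2) (u, x) :=
        ContinuousAt.comp (f := Prod.snd) (g := planePart) (continuousAt_planePart h0)
          continuousAt_snd
      have hf' : ContinuousAt (fun p : unitInterval × Space => f (σ p.2) (planePart p.2)) (u, x) :=
        ContinuousAt.comp (g := fun p : ℝ × ℂ => f p.1 p.2)
          (f := fun p : unitInterval × Space => (σ p.2, planePart p.2))
          hc.continuousAt (hσ'.prodMk hz')
      have hu : ContinuousAt (fun p : unitInterval × Space => (p.1 : ℝ)) (u, x) := by fun_prop
      exact ContinuousAt.comp (g := fun p : ℂ × ℝ => around p.1 p.2)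
        (f := fun p : unitInterval × Space =>
          (planePart p.2 + (p.1 : ℝ) • f (σ p.2) (planePart p.2), σ p.2))
        continuous_around.continuousAt ((hz'.add (hu.smul hf')).prodMk hσ')
  have hstart : ∀ x, Ψ 0 x = x := by
    intro x
    by_cases hx : x.1 = 0
    · simp [Ψ, hx]
    · simp [Ψ, hx, hang]
  have hsupp : ∀ u, ∀ x ∉ Metric.closedBall (0 : Space) (Real.exp |M| + |M|), Ψ u x = x := by
    intro u x hx
    by_cases h0 : x.1 = 0
    · simp [Ψ, h0]
    refine hout u x (norm_ne_zero_iff.2 h0) ((le_abs_self M).trans ?_)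
    by_contra! hlt
    apply hx
    rw [mem_closedBall_zero_iff, Prod.norm_def]
    have h1 := (Complex.abs_re_le_norm (planePart x)).trans hlt.le
    have h2 := (Complex.abs_im_le_norm (planePart x)).trans hlt.le
    simp only [planePart] at h1 h2
    rw [abs_neg] at h1
    have h3 := Real.log_le_iff_le_exp (norm_pos_iff.2 h0) |>.1 ((le_abs_self _).trans h1)
    refine max_le (h3.trans (by linarith [abs_nonneg M])) ?_
    rw [Real.norm_eq_abs]
    linarith [Real.exp_pos |M|]
  obtain ⟨Φ, hΦ⟩ := AmbientIsotopy.exists_of_compact_support Ψ hcont hbij hstart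
    (isCompact_closedBall _ _) hsupp
  exact ⟨Φ, fun z s => by rw [hΦ, key]; simp⟩

/-! ### Isotopies of closed braids -/

theorem apply_add_int_eq {m : ℕ} {π : Equiv.Perm (Fin m)} {p : ℝ → Fin m → ℂ}
    (hp : ∀ s k, p (s + 1) k = p s (π k)) (s : ℝ) (j : ℤ) (k : Fin m) :
    p (s + j) k = p s ((π ^ j) k) := by
  have hnat : ∀ (a : ℕ) (s : ℝ) k, p (s + a) k = p s ((π ^ a) k) := by
    intro a
    induction a with
    | zero => intro s k; simp
    | succ a ih =>
      intro s k
      rw [Nat.cast_succ, ← add_assoc, hp, ih, pow_succ, Equiv.Perm.mul_apply]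
  rcases Int.eq_nat_or_neg j with ⟨a, rfl | rfl⟩
  · simpa using hnat a s k
  · have := hnat a (s - a) ((π ^ (-(a : ℤ))) k)
    rw [sub_add_cancel, zpow_neg, zpow_natCast, ← Equiv.Perm.mul_apply, mul_inv_cancel,
      Equiv.Perm.one_apply] at this
    rw [zpow_neg, zpow_natCast, this]
    congr 1
    push_cast
    ring

/-- Two closed braids which are close to each other are related by an ambient isotopy. -/
theorem exists_isotopy_of_close {m : ℕ} {π : Equiv.Perm (Fin m)} {p q : ℝ → Fin m → ℂ}
    (hp : Continuous p) (hq : Continuous q) (hpπ : ∀ s k, p (s + 1) k = p s (π k))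
    (hqπ : ∀ s k, q (s + 1) k = q s (π k)) {δ : ℝ} (hδ : 0 < δ)
    (hsep : ∀ s k l, k ≠ l → δ ≤ dist (p s k) (p s l))
    (hclose : ∀ s k, ‖q s k - p s k‖ ≤ δ / (2 * m)) :
    ∃ Φ : AmbientIsotopy, ∀ s k, Φ.final (around (p s k) s) = around (q s k) s := by
  -- A tent of radius `δ` around each point carries it along. At `p s k` only the `k`-th tent is
  -- nonzero, because the points are `δ` apart. Each summand has Lipschitz constant at most `(1 / δ)
  -- * (δ / (2 * m))`, so the sum has constant at most `1 / 2`.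
  let f : ℝ → ℂ → ℂ := fun s z => ∑ k, max 0 (1 - dist z (p s k) / δ) • (q s k - p s k)
  have hpk : ∀ k, Continuous fun s => p s k := fun k => (continuous_apply k).comp hp
  have hqk : ∀ k, Continuous fun s => q s k := fun k => (continuous_apply k).comp hq
  have hc : Continuous fun x : ℝ × ℂ => f x.1 x.2 := by
    refine continuous_finsetSum _ fun k _ => ?_
    have h1 : Continuous fun x : ℝ × ℂ => p x.1 k := (hpk k).comp continuous_fst
    have h2 : Continuous fun x : ℝ × ℂ => q x.1 k := (hqk k).comp continuous_fst
    exact (continuous_const.max (continuous_const.sub ((continuous_snd.dist h1).div_const _))).smul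
      (h2.sub h1)
  have hper : ∀ s z, f (s + 1) z = f s z := by
    intro s z
    simp only [f, hpπ, hqπ]
    exact Equiv.sum_comp π fun k => max 0 (1 - dist z (p s k) / δ) • (q s k - p s k)
  have hlip : ∀ s, LipschitzWith (1 / 2) (f s) := by
    intro s
    refine LipschitzWith.of_dist_le_mul fun a b => ?_
    rw [dist_eq_norm, ← Finset.sum_sub_distrib]
    refine (norm_sum_le _ _).trans ?_
    have hterm : ∀ k ∈ Finset.univ, ‖max 0 (1 - dist a (p s k) / δ) • (q s k - p s k) -
        max 0 (1 - dist b (p s k) / δ) • (q s k - p s k)‖ ≤ dist a b / (2 * m) := by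
      intro k _
      rw [← sub_smul, norm_smul, Real.norm_eq_abs]
      have h1 : |max 0 (1 - dist a (p s k) / δ) - max 0 (1 - dist b (p s k) / δ)| ≤
          dist a b / δ := by
        rw [max_comm 0, max_comm 0]
        refine (abs_max_sub_max_le_abs (1 - dist a (p s k) / δ) (1 - dist b (p s k) / δ) 0).trans ?_
        rw [sub_sub_sub_cancel_left, ← sub_div, abs_div, abs_of_pos hδ]
        gcongr
        rw [abs_sub_comm]
        exact abs_dist_sub_le a b _
      calc _ ≤ dist a b / δ * (δ / (2 * m)) :=
            mul_le_mul h1 (hclose s k) (norm_nonneg _) (div_nonneg dist_nonneg hδ.le)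
        _ = _ := by field_simp
    refine (Finset.sum_le_sum hterm).trans ?_
    rw [Finset.sum_const, Finset.card_univ, Fintype.card_fin, nsmul_eq_mul]
    rcases Nat.eq_zero_or_pos m with rfl | hm
    · simp
    · have : (m : ℝ) ≠ 0 := by positivity
      push_cast
      field_simp
      exact le_rfl
  obtain ⟨C, hC⟩ := (isCompact_Icc (a := (0 : ℝ)) (b := 1)).exists_bound_of_continuousOn
    hp.continuousOn
  have hbound : ∀ s k, ‖p s k‖ ≤ C := by
    intro s k
    have h1 := apply_add_int_eq hpπ (Int.fract s) ⌊s⌋ k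
    rw [Int.fract_add_floor] at h1
    rw [h1]
    exact (norm_le_pi_norm _ _).trans (hC _ ⟨Int.fract_nonneg s, (Int.fract_lt_one s).le⟩)
  have hM : ∀ s z, C + δ ≤ ‖z‖ → f s z = 0 := by
    intro s z hz
    refine Finset.sum_eq_zero fun k _ => ?_
    have h1 : δ ≤ dist z (p s k) := by
      have := norm_sub_norm_le z (p s k)
      rw [dist_eq_norm]
      linarith [hbound s k]
    have h2 : 1 - dist z (p s k) / δ ≤ 0 := by
      rw [sub_nonpos, one_le_div hδ]; exact h1
    rw [max_eq_left h2, zero_smul]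
  obtain ⟨Φ, hΦ⟩ := exists_isotopy_around f hc hper (K := 1 / 2) (by
    rw [← NNReal.coe_lt_coe]; norm_num) hlip hM
  refine ⟨Φ, fun s k => ?_⟩
  rw [hΦ]
  congr 1
  have : f s (p s k) = q s k - p s k := by
    simp only [f]
    rw [Finset.sum_eq_single k]
    · simp
    · intro l _ hl
      have h2 : 1 - dist (p s k) (p s l) / δ ≤ 0 := by
        rw [sub_nonpos, one_le_div hδ]; exact hsep s k l hl.symm
      rw [max_eq_left h2, zero_smul]
    · simp
  rw [this, add_sub_cancel]

/-- Two closed braids which are joined by a continuous family of closed braids are related by an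
ambient isotopy. -/
theorem exists_isotopy_of_homotopy {m : ℕ} {π : Equiv.Perm (Fin m)}
    (H : unitInterval → ℝ → Fin m → ℂ) (hc : Continuous fun x : unitInterval × ℝ => H x.1 x.2)
    (hinj : ∀ u s, Function.Injective (H u s)) (hπ : ∀ u s k, H u (s + 1) k = H u s (π k)) :
    ∃ Φ : AmbientIsotopy, ∀ s k, Φ.final (around (H 0 s k) s) = around (H 1 s k) s := by
  -- This relation is symmetric and transitive, and it holds between `u` and all nearby `v`;
  -- connectedness of the interval then gives it between `0` and `1`.
  let P : unitInterval → unitInterval → Prop := fun u v =>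
    ∃ Φ : AmbientIsotopy, ∀ s k, Φ.final (around (H u s k) s) = around (H v s k) s
  have hsymm : ∀ u v, P u v → P v u := by
    rintro u v ⟨Φ, hΦ⟩
    exact ⟨Φ.symm, fun s k => by rw [← hΦ, Φ.final_symm]⟩
  refine PreconnectedSpace.induction₂' P (fun u => ?_) ⟨?_⟩ 0 1
  · have hcu : ∀ v, Continuous (H v) := fun v => hc.comp (continuous_const.prodMk continuous_id)
    have hcuk : ∀ k, Continuous fun s => H u s k := fun k => (continuous_apply k).comp (hcu u)
    obtain ⟨δ, hδ, hsep⟩ : ∃ δ : ℝ, 0 < δ ∧ ∀ s k l, k ≠ l → δ ≤ dist (H u s k) (H u s l) := by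
      have hcomp : IsCompact (Set.Icc (0 : ℝ) 1 ×ˢ {x : Fin m × Fin m | x.1 ≠ x.2}) :=
        isCompact_Icc.prod (Set.toFinite _).isCompact
      have hcont : Continuous fun x : ℝ × (Fin m × Fin m) =>
          dist (H u x.1 x.2.1) (H u x.1 x.2.2) := by
        rw [continuous_iff_continuousAt]
        rintro ⟨s, k, l⟩
        have hev : (fun x : ℝ × (Fin m × Fin m) => dist (H u x.1 x.2.1) (H u x.1 x.2.2))
            =ᶠ[𝓝 (s, k, l)] fun x => dist (H u x.1 k) (H u x.1 l) := by
          have : {x : ℝ × (Fin m × Fin m) | x.2 = (k, l)} ∈ 𝓝 (s, k, l) :=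
            ((isOpen_discrete {(k, l)}).preimage continuous_snd).mem_nhds rfl
          filter_upwards [this] with x hx
          rw [hx]
        exact (((hcuk k).comp continuous_fst).dist
          ((hcuk l).comp continuous_fst)).continuousAt.congr_of_eventuallyEq hev
      obtain ⟨δ, hδ, h⟩ := hcomp.exists_forall_le' hcont.continuousOn (a := 0) (by
        rintro ⟨s, k, l⟩ ⟨-, hkl⟩
        exact dist_pos.2 fun h => hkl (hinj u s h))
      refine ⟨δ, hδ, fun s k l hkl => ?_⟩
      have h1 := apply_add_int_eq (hπ u) (Int.fract s) ⌊s⌋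
      simp only [Int.fract_add_floor] at h1
      rw [h1, h1]
      exact h (Int.fract s, _, _) ⟨⟨Int.fract_nonneg s, (Int.fract_lt_one s).le⟩,
        fun h => hkl ((π ^ ⌊s⌋).injective h)⟩
    -- One period is compact, so closeness is uniform in `s`. The bound uses `m + 1` to stay
    -- positive when `m = 0`.
    have hclose : ∀ᶠ v in 𝓝 u, ∀ s ∈ Set.Icc (0 : ℝ) 1, ‖H v s - H u s‖ < δ / (2 * (m + 1)) := by
      refine isCompact_Icc.eventually_forall_of_forall_eventually fun s _ => ?_
      have hcc : Continuous fun x : unitInterval × ℝ => ‖H x.1 x.2 - H u x.2‖ :=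
        (hc.sub ((hcu u).comp continuous_snd)).norm
      exact (isOpen_lt hcc continuous_const).mem_nhds (by simp; positivity)
    filter_upwards [hclose] with v hv
    have hP : P u v := by
      refine exists_isotopy_of_close (hcu u) (hcu v) (hπ u) (hπ v) hδ hsep fun s k => ?_
      have h1 := apply_add_int_eq (hπ u) (Int.fract s) ⌊s⌋
      have h2 := apply_add_int_eq (hπ v) (Int.fract s) ⌊s⌋
      simp only [Int.fract_add_floor] at h1 h2
      rw [h1, h2]
      have hm : (0 : ℝ) < m := by exact_mod_cast k.pos
      calc _ ≤ ‖H v (Int.fract s) - H u (Int.fract s)‖ :=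
            norm_le_pi_norm (H v (Int.fract s) - H u (Int.fract s)) _
        _ ≤ δ / (2 * (m + 1)) := (hv _ ⟨Int.fract_nonneg s, (Int.fract_lt_one s).le⟩).le
        _ ≤ δ / (2 * m) := by gcongr; linarith
    exact ⟨hP, hsymm _ _ hP⟩
  · rintro u v w ⟨Φ, hΦ⟩ ⟨Ψ, hΨ⟩
    exact ⟨Φ.trans Ψ, fun s k => by rw [Φ.final_trans, hΦ, hΨ]⟩

/-! ### Recognizing isotopic links -/

theorem OrientedLink.curve_eq_iff (L : OrientedLink) {i j : L.ι} {s t : ℝ} :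
    L.curve i (s : UnitAddCircle) = L.curve j (t : UnitAddCircle) ↔ i = j ∧ ∃ a : ℤ, s = t + a := by
  constructor
  · intro h
    obtain ⟨h1, h2⟩ := Prod.ext_iff.1 (@OrientedLink.injective L (i, s) (j, t) h)
    refine ⟨h1, ?_⟩
    have h3 : ((s - t : ℝ) : UnitAddCircle) = 0 := by
      rw [AddCircle.coe_sub, sub_eq_zero]; exact h2
    obtain ⟨a, ha⟩ := (AddCircle.coe_eq_zero_iff 1).1 h3
    exact ⟨a, by rw [zsmul_one] at ha; linarith⟩
  · rintro ⟨rfl, a, rfl⟩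
    congr 1
    rw [AddCircle.coe_add]
    have : ((a : ℝ) : UnitAddCircle) = 0 := (AddCircle.coe_eq_zero_iff 1).2 ⟨a, by simp⟩
    rw [this, add_zero]

/-- An ambient isotopy that carries every component of `L` increasingly onto a component of `M`,
such that every component of `M` is met, is an isotopy of oriented links. -/
theorem OrientedLink.isotopic_of_curves {L M : OrientedLink} (Φ : AmbientIsotopy)
    (h : ∀ i, ∃ (j : M.ι) (G : ℝ ≃o ℝ), ∀ s : ℝ,
      Φ.final (L.curve i (s : UnitAddCircle)) = M.curve j (G s : UnitAddCircle))
    (hsurj : ∀ j, ∃ (i : L.ι) (s t : ℝ),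
      Φ.final (L.curve i (s : UnitAddCircle)) = M.curve j (t : UnitAddCircle)) :
    L.Isotopic M := by
  choose e G hG using h
  have he : Function.Bijective e := by
    constructor
    · intro i i' hii
      obtain ⟨s, hs⟩ := (G i').surjective (G i 0)
      have h1 : Φ.final (L.curve i ((0 : ℝ) : UnitAddCircle)) =
          Φ.final (L.curve i' (s : UnitAddCircle)) := by rw [hG, hG, hs, hii]
      exact (L.curve_eq_iff.1 (Φ.final_injective h1)).1
    · intro j
      obtain ⟨i, s, t, hst⟩ := hsurj j
      rw [hG] at hst
      exact ⟨i, (M.curve_eq_iff.1 hst).1⟩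
  refine ⟨Φ, Equiv.ofBijective e he, G, fun i s => ?_, fun i s => hG i s⟩
  -- That `G i` commutes with the unit shift is automatic. As the curve of `L` closes up, `G i (s +
  -- 1) - G i s` is a positive integer `a`. If `G i r = G i s + 1`, then `r - s` is a positive
  -- integer as well, so `s + 1 ≤ r` and `a ≤ 1`.
  have h1 : M.curve (e i) (G i (s + 1) : ℝ) = M.curve (e i) (G i s : ℝ) := by
    rw [← hG, ← hG]
    congr 1
    exact L.curve_eq_iff.2 ⟨rfl, 1, by simp⟩
  obtain ⟨-, a, ha⟩ := M.curve_eq_iff.1 h1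
  obtain ⟨r, hr⟩ := (G i).surjective (G i s + 1)
  have h2 : Φ.final (L.curve i (r : UnitAddCircle)) = Φ.final (L.curve i (s : UnitAddCircle)) := by
    rw [hG, hG, hr]
    exact M.curve_eq_iff.2 ⟨rfl, 1, by simp⟩
  obtain ⟨-, b, hb⟩ := L.curve_eq_iff.1 (Φ.final_injective h2)
  have hlt : G i s < G i (s + 1) := (G i).strictMono (by linarith)
  have ha1 : 1 ≤ a := by
    have : (0 : ℝ) < a := by linarith
    exact_mod_cast this
  have hrs : s < r := (G i).lt_iff_lt.1 (by linarith)
  have hb1 : 1 ≤ b := by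
    have : (0 : ℝ) < b := by linarith
    exact_mod_cast this
  have hle : G i (s + 1) ≤ G i r := (G i).monotone (by
    have : (1 : ℝ) ≤ b := by exact_mod_cast hb1
    linarith)
  have ha1' : (1 : ℝ) ≤ a := by exact_mod_cast ha1
  linarith

/-! ### Closing up -/

/-- The closed braid of a motion of `m` points during one unit of time whose last position is the
first one with its labels permuted by `π`. -/
def closeUp {m : ℕ} (π : Equiv.Perm (Fin m)) (P : unitInterval → Fin m → ℂ) (s : ℝ) (k : Fin m) :
    ℂ :=
  P ⟨Int.fract s, Int.fract_nonneg s, (Int.fract_lt_one s).le⟩ ((π ^ ⌊s⌋) k)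

/-- The value `x = 1` is allowed: at the seam the two adjacent turns give the same position. This is
what permits pasting over closed intervals. -/
theorem closeUp_eq {m : ℕ} {π : Equiv.Perm (Fin m)} {P : unitInterval → Fin m → ℂ}
    (hP : ∀ k, P 1 k = P 0 (π k)) {k : Fin m} {s : ℝ} {j : ℤ} {x : unitInterval}
    (h : s = j + x) : closeUp π P s k = P x ((π ^ j) k) := by
  rcases x.2.2.eq_or_lt with hx | hx
  · obtain rfl : x = 1 := Subtype.ext hx
    have hs' : s = ((j + 1 : ℤ) : ℝ) := by push_cast; exact h
    have h0 : (⟨Int.fract s, Int.fract_nonneg s, (Int.fract_lt_one s).le⟩ : unitInterval) = 0 :=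
      Subtype.ext (by rw [hs']; simp)
    rw [closeUp, h0, hs', Int.floor_intCast, hP, add_comm, zpow_add, zpow_one,
      Equiv.Perm.mul_apply]
  · have hf : ⌊s⌋ = j := Int.floor_eq_iff.2 ⟨by linarith [x.2.1], by linarith⟩
    have h0 : (⟨Int.fract s, Int.fract_nonneg s, (Int.fract_lt_one s).le⟩ : unitInterval) = x :=
      Subtype.ext (by change Int.fract s = x; rw [← Int.self_sub_floor, hf, h]; simp)
    rw [closeUp, h0, hf]

theorem closeUp_add_one {m : ℕ} (π : Equiv.Perm (Fin m)) (P : unitInterval → Fin m → ℂ) (s : ℝ)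
    (k : Fin m) : closeUp π P (s + 1) k = closeUp π P s (π k) := by
  simp only [closeUp, Int.fract_add_one, Int.floor_add_one]
  rw [zpow_add, zpow_one, Equiv.Perm.mul_apply]

theorem closeUp_injective {m : ℕ} (π : Equiv.Perm (Fin m)) {P : unitInterval → Fin m → ℂ}
    (hP : ∀ x, Function.Injective (P x)) (s : ℝ) : Function.Injective (closeUp π P s) :=
  (hP _).comp (π ^ ⌊s⌋).injective

/-- Pasting over the locally finite cover by the closed slabs `j ≤ s ≤ j + 1`. The parameter space
`X` covers homotopies as well as single motions. -/
theorem continuous_closeUp {m : ℕ} {X : Type*} [TopologicalSpace X] {π : Equiv.Perm (Fin m)}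
    {P : X → unitInterval → Fin m → ℂ}
    (hc : Continuous fun x : X × unitInterval => P x.1 x.2)
    (hP : ∀ u k, P u 1 k = P u 0 (π k)) :
    Continuous fun x : X × ℝ => closeUp π (P x.1) x.2 := by
  have hlf : LocallyFinite fun j : ℤ => {x : X × ℝ | x.2 ∈ Set.Icc (j : ℝ) (j + 1)} := by
    intro x
    refine ⟨{y | y.2 ∈ Set.Ioo (x.2 - 1) (x.2 + 1)}, (isOpen_Ioo.preimage continuous_snd).mem_nhds
      ⟨by linarith, by linarith⟩, ?_⟩
    refine (Set.finite_Icc (⌊x.2⌋ - 2) (⌊x.2⌋ + 2)).subset ?_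
    rintro j ⟨y, hy1, hy2⟩
    have h1 := Int.floor_le x.2
    have h2 := Int.lt_floor_add_one x.2
    have h3 : (⌊x.2⌋ : ℝ) - 2 ≤ j := by linarith [hy1.2, hy2.1]
    have h4 : (j : ℝ) ≤ ⌊x.2⌋ + 2 := by linarith [hy1.1, hy2.2]
    exact ⟨by exact_mod_cast h3, by exact_mod_cast h4⟩
  refine hlf.continuous (Set.eq_univ_of_forall fun x => Set.mem_iUnion.2
    ⟨⌊x.2⌋, Int.floor_le x.2, (Int.lt_floor_add_one x.2).le⟩)
    (fun j => isClosed_Icc.preimage continuous_snd) fun j => ?_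
  refine ContinuousOn.congr (f := fun (x : X × ℝ) k =>
    P x.1 (Set.projIcc 0 1 zero_le_one (x.2 - j)) ((π ^ j) k)) ?_ ?_
  · refine (continuous_pi fun k => (continuous_apply _).comp (hc.comp
      (f := fun x : X × ℝ => (x.1, Set.projIcc 0 1 zero_le_one (x.2 - j))) ?_)).continuousOn
    exact continuous_fst.prodMk (continuous_projIcc.comp (continuous_snd.sub continuous_const))
  · rintro ⟨u, s⟩ ⟨hs1, hs2⟩
    funext k
    refine closeUp_eq (hP u) ?_
    rw [Set.projIcc_of_mem _ ⟨by linarith, by linarith⟩]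
    simp

/-- A homotopy of motions, compatible with closing up, gives an ambient isotopy. -/
theorem exists_isotopy_closeUp {m : ℕ} {π : Equiv.Perm (Fin m)}
    (H : unitInterval → unitInterval → Fin m → ℂ)
    (hc : Continuous fun x : unitInterval × unitInterval => H x.1 x.2)
    (hinj : ∀ u x, Function.Injective (H u x)) (hπ : ∀ u k, H u 1 k = H u 0 (π k)) :
    ∃ Φ : AmbientIsotopy, ∀ s k, Φ.final (around (closeUp π (H 0) s k) s) =
      around (closeUp π (H 1) s k) s :=
  exists_isotopy_of_homotopy (fun u s k => closeUp π (H u) s k) (continuous_closeUp hc hπ)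
    (fun u s => closeUp_injective π (hinj u) s) fun u s k => closeUp_add_one π (H u) s k

namespace RoughBraid

/-- The positions of the strands of a rough braid. -/
def pos {m : ℕ} (β : RoughBraid m) (x : unitInterval) : Fin m → ℂ := (β.path x).1

theorem pos_one {m : ℕ} (β : RoughBraid m) (k : Fin m) : β.pos 1 k = β.pos 0 (β.perm k) := by
  rw [pos, pos, β.path.target, β.path.source]
  rfl

theorem pos_injective {m : ℕ} (β : RoughBraid m) (x : unitInterval) :
    Function.Injective (β.pos x) := (β.path x).2

theorem continuous_pos {m : ℕ} (β : RoughBraid m) : Continuous β.pos :=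
  continuous_subtype_val.comp β.path.continuous

theorem track_eq_closeUp {m : ℕ} (β : RoughBraid m) (k : Fin m) (s : ℝ) :
    β.track k s = closeUp β.perm β.pos s k := rfl

theorem track_add_int {m : ℕ} (β : RoughBraid m) (k : Fin m) (s : ℝ) (j : ℤ) :
    β.track k (s + j) = β.track ((β.perm ^ j) k) s :=
  apply_add_int_eq (p := closeUp β.perm β.pos) (closeUp_add_one _ _) s j k

/-- The curve of the closure through the `k`-th base point, parametrized by the angle. -/
theorem exists_closure_curve_eq {m : ℕ} (β : RoughBraid m) (k : Fin m) :
    ∃ (q : β.closure.ι) (g : ℝ ≃o ℝ), ∀ s : ℝ,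
      around (β.track k s) s = β.closure.curve q (g s : UnitAddCircle) := by
  let q : Quotient (Equiv.Perm.SameCycle.setoid β.perm) := Quotient.mk _ k
  obtain ⟨j, hj⟩ : Equiv.Perm.SameCycle β.perm q.out k := Quotient.exact (Quotient.out_eq q)
  have hp : (0 : ℝ) < β.period q.out := by exact_mod_cast β.period_pos q.out
  -- The strand `k` is reached from the representative `q.out` after `j` turns, and the curve in
  -- `closure` runs through a whole period of turns in unit time.
  let g : ℝ ≃o ℝ := (OrderIso.addRight (j : ℝ)).trans (OrderIso.divRight₀ _ hp)
  refine ⟨q, g, fun s => ?_⟩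
  have h1 : β.closure.curve q (g s : UnitAddCircle) = β.loop q.out (g s) := rfl
  have h2 : (β.period q.out : ℝ) * g s = s + j := by
    simp only [g, OrderIso.trans_apply, OrderIso.addRight_apply, OrderIso.divRight₀_apply]
    field_simp
  rw [h1, loop, h2, track_add_int, hj, around_add_int]

/-- The curve of the closure with index `q`, parametrized by the angle. -/
theorem closure_curve_eq {m : ℕ} (β : RoughBraid m) (q : β.closure.ι) :
    ∃ (k : Fin m) (g : ℝ ≃o ℝ), ∀ s : ℝ,
      β.closure.curve q (s : UnitAddCircle) = around (β.track k (g s)) (g s) := by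
  let q' : Quotient (Equiv.Perm.SameCycle.setoid β.perm) := q
  have hp : (0 : ℝ) < β.period q'.out := by exact_mod_cast β.period_pos q'.out
  exact ⟨q'.out, OrderIso.mulLeft₀ _ hp, fun s => rfl⟩

/-- An ambient isotopy that carries the strands of the closure of `β` increasingly to strands of the
closure of `γ`, such that every strand is met, is an isotopy of the closures. -/
theorem isotopic_closure {m m' : ℕ} {β : RoughBraid m} {γ : RoughBraid m'} (Φ : AmbientIsotopy)
    (h : ∀ k, ∃ (l : Fin m') (G : ℝ ≃o ℝ), ∀ s : ℝ,
      Φ.final (around (β.track k s) s) = around (γ.track l (G s)) (G s))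
    (hsurj : ∀ l, ∃ (k : Fin m) (s t : ℝ),
      Φ.final (around (β.track k s) s) = around (γ.track l t) t) :
    β.closure.Isotopic γ.closure := by
  refine OrientedLink.isotopic_of_curves Φ (fun q => ?_) fun q => ?_
  · obtain ⟨k, g, hg⟩ := β.closure_curve_eq q
    obtain ⟨l, G, hG⟩ := h k
    obtain ⟨q', g', hg'⟩ := γ.exists_closure_curve_eq l
    exact ⟨q', (g.trans G).trans g', fun s => by
      rw [hg, hG, hg']; rfl⟩
  · obtain ⟨l, g, hg⟩ := γ.closure_curve_eq q
    obtain ⟨k, s, t, hst⟩ := hsurj l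
    obtain ⟨q', g', hg'⟩ := β.exists_closure_curve_eq k
    refine ⟨q', g' s, g.symm t, ?_⟩
    rw [← hg', hst, hg, OrderIso.apply_symm_apply]

/-- A variant for braids with the same number of strands and angle-preserving isotopies. -/
theorem isotopic_closure_of_track {m : ℕ} {β γ : RoughBraid m} (Φ : AmbientIsotopy)
    (τ : Equiv.Perm (Fin m))
    (h : ∀ k s, Φ.final (around (β.track k s) s) = around (γ.track (τ k) s) s) :
    β.closure.Isotopic γ.closure :=
  isotopic_closure Φ (fun k => ⟨τ k, OrderIso.refl ℝ, fun s => h k s⟩)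
    fun l => ⟨τ.symm l, 0, 0, by rw [h, Equiv.apply_symm_apply]⟩

/-- Homotopic rough braids have the same permutation. -/
theorem Homotopic.perm_eq {m : ℕ} {β γ : RoughBraid m} (h : β.Homotopic γ) : β.perm = γ.perm := by
  obtain ⟨F⟩ := h
  have h1 : β.path 1 = γ.path 1 :=
    (F.eq_fst 0 (by simp : (1 : unitInterval) ∈ ({0, 1} : Set unitInterval))).symm.trans
      (F.eq_snd 0 (by simp : (1 : unitInterval) ∈ ({0, 1} : Set unitInterval)))
  rw [β.path.target, γ.path.target] at h1
  refine Equiv.ext fun k => (basePt m).2 ?_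
  exact congrFun (congrArg Subtype.val h1) k

/-- Homotopic rough braids have isotopic closures. -/
theorem Homotopic.isotopic_closure {m : ℕ} {β γ : RoughBraid m} (h : β.Homotopic γ) :
    β.closure.Isotopic γ.closure := by
  have hp := h.perm_eq
  obtain ⟨F⟩ := h
  have hF : ∀ u (x : unitInterval), x ∈ ({0, 1} : Set unitInterval) → F (u, x) = β.path x :=
    fun u x hx => F.eq_fst u hx
  obtain ⟨Φ, hΦ⟩ := exists_isotopy_closeUp (π := β.perm) (fun u x => (F (u, x)).1)
    (continuous_subtype_val.comp F.continuous) (fun u x => (F (u, x)).2) (fun u k => by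
      rw [hF u 1 (by simp), hF u 0 (by simp)]; exact β.pos_one k)
  refine isotopic_closure_of_track Φ 1 fun k s => ?_
  have h0 : (fun x => (F (0, x)).1) = β.pos := by
    funext x
    rw [F.apply_zero]; rfl
  have h1 : (fun x => (F (1, x)).1) = γ.pos := by
    funext x
    rw [F.apply_one]; rfl
  have := hΦ s k
  rw [h0, h1] at this
  rw [track_eq_closeUp, this, hp]
  rfl

theorem mul_pos_of_le {m : ℕ} (β γ : RoughBraid m) {x y : unitInterval} (h : (y : ℝ) = 2 * x) :
    (mul β γ).pos x = β.pos y := by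
  have hx : (x : ℝ) ≤ 1 / 2 := by linarith [y.2.2]
  change ((β.path.trans (γ.path.map (continuous_relabel β.perm))) x).1 = _
  rw [Path.trans_apply, dif_pos hx]
  congr 2
  exact Subtype.ext h.symm

/-- The midpoint is included here and in `mul_pos_of_le`, so either formula may be used there. -/
theorem mul_pos_of_ge {m : ℕ} (β γ : RoughBraid m) {x y : unitInterval} (h : (y : ℝ) = 2 * x - 1)
    (k : Fin m) : (mul β γ).pos x k = γ.pos y (β.perm k) := by
  have hx : 1 / 2 ≤ (x : ℝ) := by linarith [y.2.1]
  rcases hx.eq_or_lt with hx | hx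
  · obtain rfl : y = 0 := Subtype.ext (by rw [h, ← hx]; norm_num)
    rw [mul_pos_of_le β γ (y := 1) (by rw [← hx]; norm_num), pos_one, pos, pos, β.path.source,
      γ.path.source]
  · change ((β.path.trans (γ.path.map (continuous_relabel β.perm))) x).1 k = _
    rw [Path.trans_apply, dif_neg (by linarith)]
    have : (⟨2 * (x : ℝ) - 1, unitInterval.two_mul_sub_one_mem_iff.2 ⟨hx.le, x.2.2⟩⟩ :
      unitInterval) = y := Subtype.ext h.symm
    change (γ.path _).1 (β.perm k) = _
    rw [this]
    rfl

/-- The closure of a product does not depend on the order of the factors. -/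
theorem isotopic_closure_mul_comm {m : ℕ} (β γ : RoughBraid m) :
    (mul β γ).closure.Isotopic (mul γ β).closure := by
  set p := closeUp (mul β γ).perm (mul β γ).pos with hp
  have hpc : Continuous p :=
    (continuous_closeUp (X := Unit) (P := fun _ => (mul β γ).pos)
      ((mul β γ).continuous_pos.comp continuous_snd) fun _ => (mul β γ).pos_one).comp
      (continuous_const.prodMk continuous_id : Continuous fun s : ℝ => ((), s))
  -- Starting the closed braid up to half a turn later is a homotopy of closed braids. After a full
  -- half turn `γ` comes first, and the strand labelled `k` is the strand `β.perm k` of `mul γ β`.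
  obtain ⟨Φ, hΦ⟩ := exists_isotopy_of_homotopy (π := (mul β γ).perm)
    (fun u s => p (s + u / 2))
    (hpc.comp (by fun_prop : Continuous fun x : unitInterval × ℝ => x.2 + (x.1 : ℝ) / 2))
    (fun u s => closeUp_injective _ (mul β γ).pos_injective _)
    (fun u s k => by rw [add_right_comm, hp, closeUp_add_one])
  refine isotopic_closure_of_track Φ β.perm fun k s => ?_
  have h1 := hΦ s k
  simp only [Set.Icc.coe_zero, zero_div, add_zero, Set.Icc.coe_one] at h1
  rw [track_eq_closeUp, ← hp, h1, track_eq_closeUp]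
  congr 1
  have hconj : ∀ j : ℤ, ((mul γ β).perm ^ j) (β.perm k) = β.perm (((mul β γ).perm ^ j) k) := by
    intro j
    have h : SemiconjBy β.perm (γ.perm * β.perm) (β.perm * γ.perm) := by
      simp [SemiconjBy, mul_assoc]
    have h2 := h.zpow_right j
    have h3 := congrArg (fun e : Equiv.Perm (Fin m) => e k) h2
    exact h3.symm
  set x : unitInterval := ⟨Int.fract s, Int.fract_nonneg s, (Int.fract_lt_one s).le⟩ with hx
  have hs : s = ⌊s⌋ + (x : ℝ) := (Int.floor_add_fract s).symm
  rw [closeUp_eq (mul γ β).pos_one hs, hconj]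
  rcases le_total (x : ℝ) (1 / 2) with hh | hh
  · have hy : x.1 + 1 / 2 ∈ unitInterval := ⟨by linarith [x.2.1], by linarith⟩
    have hz : 2 * x.1 ∈ unitInterval := ⟨by linarith [x.2.1], by linarith⟩
    rw [hp, closeUp_eq (mul β γ).pos_one (j := ⌊s⌋) (x := ⟨_, hy⟩)
      (by rw [← add_assoc, ← hs]), mul_pos_of_le γ β (y := ⟨_, hz⟩) rfl,
      mul_pos_of_ge β γ (y := ⟨_, hz⟩) (by simp only; ring)]
  · have hy : x.1 - 1 / 2 ∈ unitInterval := ⟨by linarith, by linarith [x.2.2]⟩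
    have hz : 2 * x.1 - 1 ∈ unitInterval := ⟨by linarith, by linarith [x.2.2]⟩
    rw [hp, closeUp_eq (mul β γ).pos_one (j := ⌊s⌋ + 1) (x := ⟨_, hy⟩)
      (by push_cast; linarith [hs]), mul_pos_of_ge γ β (y := ⟨_, hz⟩) rfl,
      mul_pos_of_le β γ (y := ⟨_, hz⟩) (by simp only; ring), add_comm, zpow_add, zpow_one]
    rfl

end RoughBraid

namespace RoughBraid

/-! ### The monoid of rough braids up to homotopy -/

/-- The endpoint of a rough braid depends on its permutation, so it enters the type of its path.
Comparing with `p` and `q` pointwise avoids transport between such types. -/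
theorem homotopic_of_path {m : ℕ} {x y : Conf m} {p q : Path x y} (h : p.Homotopic q)
    {β γ : RoughBraid m} (hβ : ∀ s, β.path s = p s) (hγ : ∀ s, γ.path s = q s) :
    β.Homotopic γ := by
  have h1 : β.path.toContinuousMap = p.toContinuousMap := ContinuousMap.ext hβ
  have h2 : γ.path.toContinuousMap = q.toContinuousMap := ContinuousMap.ext hγ
  rw [Homotopic, h1, h2]
  exact h

theorem homotopic_equivalence (m : ℕ) : Equivalence (Homotopic (m := m)) where
  refl _ := ContinuousMap.HomotopicRel.refl _
  symm h := ContinuousMap.HomotopicRel.symm h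
  trans h h' := ContinuousMap.HomotopicRel.trans h h'

/-- The relation of homotopy on rough braids. -/
def homotopySetoid (m : ℕ) : Setoid (RoughBraid m) := ⟨Homotopic, homotopic_equivalence m⟩

theorem Homotopic.mul {m : ℕ} {β β' γ γ' : RoughBraid m} (h : β.Homotopic β')
    (h' : γ.Homotopic γ') : (mul β γ).Homotopic (mul β' γ') := by
  have e := h.perm_eq
  have e' := h'.perm_eq
  obtain ⟨π, p⟩ := β
  obtain ⟨π', p'⟩ := β'
  obtain ⟨ρ, q⟩ := γ
  obtain ⟨ρ', q'⟩ := γ'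
  obtain rfl : π = π' := e
  obtain rfl : ρ = ρ' := e'
  have h1 : p.Homotopic p' := h
  have h2 : q.Homotopic q' := h'
  exact homotopic_of_path (h1.hcomp (h2.map ⟨relabel π, continuous_relabel π⟩)) (fun _ => rfl)
    fun _ => rfl

theorem mul_assoc_homotopic {m : ℕ} (β γ δ : RoughBraid m) :
    (mul (mul β γ) δ).Homotopic (mul β (mul γ δ)) := by
  refine homotopic_of_path ⟨Path.Homotopy.transAssoc β.path
    (γ.path.map (continuous_relabel β.perm))
    ((δ.path.map (continuous_relabel γ.perm)).map (continuous_relabel β.perm))⟩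
    (fun _ => rfl) fun s => ?_
  rw [← Path.map_trans]
  rfl

theorem one_mul_homotopic {m : ℕ} (β : RoughBraid m) : (mul (one m) β).Homotopic β :=
  homotopic_of_path ⟨Path.Homotopy.reflTrans β.path⟩ (fun _ => rfl) fun _ => rfl

theorem mul_one_homotopic {m : ℕ} (β : RoughBraid m) : (mul β (one m)).Homotopic β :=
  homotopic_of_path ⟨Path.Homotopy.transRefl β.path⟩ (fun _ => rfl) fun _ => rfl

/-- Rough braids up to homotopy. -/
def BraidClass (m : ℕ) : Type := Quotient (homotopySetoid m)

/-- The homotopy class of a rough braid. -/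
def toClass {m : ℕ} (β : RoughBraid m) : BraidClass m := Quotient.mk (homotopySetoid m) β

theorem toClass_eq_iff {m : ℕ} {β γ : RoughBraid m} : β.toClass = γ.toClass ↔ β.Homotopic γ :=
  ⟨fun h => Quotient.exact h, fun h => Quotient.sound (s := homotopySetoid m) h⟩

instance (m : ℕ) : Monoid (BraidClass m) where
  mul := Quotient.map₂ mul fun _ _ h _ _ h' => Homotopic.mul h h'
  one := toClass (one m)
  mul_assoc a b c := by
    induction a using Quotient.inductionOn
    induction b using Quotient.inductionOn
    induction c using Quotient.inductionOn
    exact toClass_eq_iff.2 (mul_assoc_homotopic _ _ _)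
  one_mul a := by
    induction a using Quotient.inductionOn
    exact toClass_eq_iff.2 (one_mul_homotopic _)
  mul_one a := by
    induction a using Quotient.inductionOn
    exact toClass_eq_iff.2 (mul_one_homotopic _)

theorem toClass_mul {m : ℕ} (β γ : RoughBraid m) :
    (mul β γ).toClass = β.toClass * γ.toClass := rfl

theorem toClass_one (m : ℕ) : (one m).toClass = 1 := rfl

theorem gen_pos {n : ℕ} (i : Fin n) (ε : Bool) (x : unitInterval) :
    (gen i ε).pos x = twist i ((if ε then Real.pi else -Real.pi) * (x : ℝ)) := rfl

theorem gen_mul_gen_not {n : ℕ} (i : Fin n) (ε : Bool) :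
    (gen i ε).toClass * (gen i !ε).toClass = 1 := by
  rw [← toClass_mul, ← toClass_one, toClass_eq_iff]
  refine homotopic_of_path ⟨(Path.Homotopy.reflTransSymm (gen i ε).path).symm⟩ (fun s => ?_)
    fun _ => rfl
  refine Subtype.ext (funext fun k => ?_)
  change ((gen i ε).path.trans ((gen i !ε).path.map (continuous_relabel _)) s).1 k = _
  rw [Path.trans_apply, Path.trans_apply]
  split_ifs with h
  · rfl
  · change twist i _ (Equiv.swap i.castSucc i.succ k) = twist i _ k
    generalize (⟨2 * (s : ℝ) - 1, _⟩ : unitInterval) = y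
    -- Running a half twist backwards is the opposite half twist with its two strands exchanged: the
    -- sign in this identity swaps the two antipodal points.
    have he : ∀ θ : ℝ, Complex.exp (((if ε then Real.pi else -Real.pi) * (1 - θ) : ℝ) * Complex.I) =
        -Complex.exp (((if !ε then Real.pi else -Real.pi) * θ : ℝ) * Complex.I) := by
      intro θ
      have hpi : Complex.exp (((if ε then Real.pi else -Real.pi : ℝ) : ℂ) * Complex.I) = -1 := by
        cases ε <;> simp [Complex.exp_neg, Complex.exp_pi_mul_I]
      rw [← neg_one_mul (Complex.exp _), ← hpi, ← Complex.exp_add]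
      congr 1
      cases ε <;> · push_cast; simp; ring
    have hy : ((unitInterval.symm y : unitInterval) : ℝ) = 1 - y := rfl
    unfold twist
    rw [hy, he]
    have hne : i.castSucc ≠ i.succ := (Fin.castSucc_lt_succ).ne
    by_cases h1 : k = i.castSucc
    · subst h1
      rw [Equiv.swap_apply_left, if_neg hne.symm, if_pos rfl, if_pos rfl]
      ring
    · by_cases h2 : k = i.succ
      · subst h2
        rw [Equiv.swap_apply_right, if_pos rfl, if_neg h1, if_pos rfl]
        ring
      · rw [Equiv.swap_apply_of_ne_of_ne h1 h2]
        simp [h1, h2]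

/-! ### Braids in which each pair of strands crosses at most once -/

/-- The plane without the closed lower half of the imaginary axis. -/
def cutPlane : Set ℂ := {d | ¬ (d.re = 0 ∧ d.im ≤ 0)}

/-- The configurations in which each later point is above an earlier one, or beside it. -/
def cutConf (m : ℕ) : Set (Fin m → ℂ) := {p | ∀ k l, k < l → p l - p k ∈ cutPlane}

/-- The centre stacks the points vertically in the order of their labels. Its differences are
positive multiples of `I`, and adding such a vector never leads from `cutPlane` into the removed
half-axis. -/
theorem starConvex_cutConf (m : ℕ) :
    StarConvex ℝ (fun k : Fin m => ((k : ℕ) : ℂ) * Complex.I) (cutConf m) := by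
  intro p hp a b ha hb hab k l hkl
  have hd := hp k l hkl
  have hlt : (0 : ℝ) < (l : ℕ) - (k : ℕ) := by
    rw [sub_pos]; exact_mod_cast hkl
  rintro ⟨h1, h2⟩
  simp only [Pi.add_apply, Pi.smul_apply, Complex.sub_re, Complex.sub_im, Complex.add_re,
    Complex.add_im, Complex.real_smul, Complex.mul_re, Complex.mul_im, Complex.ofReal_re,
    Complex.ofReal_im, Complex.natCast_re, Complex.natCast_im, Complex.I_re, Complex.I_im] at h1 h2
  rcases hb.eq_or_lt with rfl | hb
  · obtain rfl : a = 1 := by linarith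
    linarith
  · have h3 : (p l - p k).re = 0 := by
      rw [Complex.sub_re]
      have : b * ((p l).re - (p k).re) = 0 := by linarith
      exact (mul_eq_zero.1 this).resolve_left hb.ne'
    have h4 : 0 < (p l - p k).im := by
      by_contra! h
      exact hd ⟨h3, h⟩
    rw [Complex.sub_im] at h4
    nlinarith [mul_nonneg ha hlt.le, mul_pos hb h4]

theorem injective_of_mem_cutConf {m : ℕ} {p : Fin m → ℂ} (hp : p ∈ cutConf m) :
    Function.Injective p := by
  intro k l h
  by_contra hne
  rcases lt_or_gt_of_ne hne with hlt | hlt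
  · exact hp k l hlt (by simp [h])
  · exact hp l k hlt (by simp [h])

/-- Two rough braids with the same permutation that stay in the star-shaped set of configurations
`cutConf` are homotopic. -/
theorem homotopic_of_mem_cutConf {m : ℕ} {β γ : RoughBraid m} (hp : β.perm = γ.perm)
    (hβ : ∀ x, β.pos x ∈ cutConf m) (hγ : ∀ x, γ.pos x ∈ cutConf m) : β.Homotopic γ := by
  have h0 : (basePt m).1 ∈ cutConf m := by
    have := hβ 0
    rwa [pos, β.path.source] at this
  have h1 : (relabel β.perm (basePt m)).1 ∈ cutConf m := by
    have := hβ 1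
    rwa [pos, β.path.target] at this
  let p : Path (⟨_, h0⟩ : cutConf m) ⟨_, h1⟩ :=
    { toFun := fun x => ⟨β.pos x, hβ x⟩
      continuous_toFun := Continuous.subtype_mk β.continuous_pos _
      source' := by simp only [pos, β.path.source]
      target' := by simp only [pos, β.path.target] }
  let q : Path (⟨_, h0⟩ : cutConf m) ⟨_, h1⟩ :=
    { toFun := fun x => ⟨γ.pos x, hγ x⟩
      continuous_toFun := Continuous.subtype_mk γ.continuous_pos _
      source' := by simp only [pos, γ.path.source]
      target' := by simp only [pos, γ.path.target, hp] }
  -- In a contractible space any two paths with the same ends are homotopic; the homotopy is then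
  -- pushed to `Conf m`.
  have : ContractibleSpace (cutConf m) := (starConvex_cutConf m).contractibleSpace ⟨_, h0⟩
  let f : C(cutConf m, Conf m) :=
    ⟨fun c => ⟨c.1, injective_of_mem_cutConf c.2⟩, Continuous.subtype_mk continuous_subtype_val _⟩
  exact homotopic_of_path ((SimplyConnectedSpace.paths_homotopic p q).map f) (fun _ => rfl)
    fun _ => rfl

/-- For the turning pair, taken in the admissible order, the difference is `exp (θ I)`, on the
closed upper half circle. The turning strands keep their real parts in `[i, i + 1]`, so every other
pair has distinct real parts. -/
theorem twist_sub_mem_cutPlane {n : ℕ} (i : Fin n) {θ : ℝ} (h0 : 0 ≤ θ) (hπ : θ ≤ Real.pi)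
    {k l : Fin (n + 1)} (hkl : k ≠ l) (h : ¬ (l = i.castSucc ∧ k = i.succ)) :
    twist i θ l - twist i θ k ∈ cutPlane := by
  have hs := Real.sin_nonneg_of_nonneg_of_le_pi h0 hπ
  have hc1 := Real.cos_le_one θ
  have hc2 := Real.neg_one_le_cos θ
  have hre : (Complex.exp (θ * Complex.I)).re = Real.cos θ := Complex.exp_ofReal_mul_I_re θ
  have him : (Complex.exp (θ * Complex.I)).im = Real.sin θ := Complex.exp_ofReal_mul_I_im θ
  have hne : i.castSucc ≠ i.succ := (Fin.castSucc_lt_succ).ne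
  have key : ∀ j : Fin (n + 1), j ≠ i.castSucc → j ≠ i.succ →
      ((j : ℕ) : ℝ) + 1 ≤ (i : ℕ) ∨ ((i : ℕ) : ℝ) + 2 ≤ (j : ℕ) := by
    intro j h1 h2
    have h1' : (j : ℕ) ≠ i := fun h => h1 (Fin.ext h)
    have h2' : (j : ℕ) ≠ i + 1 := fun h => h2 (Fin.ext h)
    rcases lt_or_ge (j : ℕ) i with h | h
    · left; exact_mod_cast h
    · right; exact_mod_cast (by omega : (i : ℕ) + 2 ≤ j)
  have hhalf : ∀ z : ℂ, (1 / 2 * z).re = 1 / 2 * z.re := fun z => by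
    rw [show (1 / 2 : ℂ) = ((1 / 2 : ℝ) : ℂ) by push_cast; rfl, Complex.re_ofReal_mul]
  have hhalf' : ((1 : ℂ) / 2).re = 1 / 2 := by norm_num
  rintro ⟨h1, h2⟩
  unfold twist at h1 h2
  rcases eq_or_ne l i.castSucc with hl | hl
  · have hk1 : k ≠ i.castSucc := fun h' => hkl (h'.trans hl.symm)
    have hk2 : k ≠ i.succ := fun h' => h ⟨hl, h'⟩
    rw [if_pos hl, if_neg hk1, if_neg hk2, Complex.sub_re, Complex.sub_re, Complex.add_re, hhalf,
      hre, hhalf', Complex.natCast_re, Complex.natCast_re] at h1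
    rcases key k hk1 hk2 with h3 | h3 <;> linarith
  · rcases eq_or_ne l i.succ with hl' | hl'
    · rw [if_neg hl, if_pos hl'] at h1 h2
      rcases eq_or_ne k i.castSucc with hk | hk
      · rw [if_pos hk] at h1 h2
        have hd : (((i : ℕ) : ℂ) + 1 / 2 + 1 / 2 * Complex.exp (θ * Complex.I) -
            (((i : ℕ) : ℂ) + 1 / 2 - 1 / 2 * Complex.exp (θ * Complex.I))) =
            Complex.exp (θ * Complex.I) := by ring
        rw [hd, hre] at h1
        rw [hd, him] at h2
        have := Real.sin_sq_add_cos_sq θ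
        rw [h1, le_antisymm h2 hs] at this
        norm_num at this
      · have hk2 : k ≠ i.succ := fun h' => hkl (h'.trans hl'.symm)
        rw [if_neg hk, if_neg hk2, Complex.sub_re, Complex.add_re, Complex.add_re, hhalf,
          hre, hhalf', Complex.natCast_re, Complex.natCast_re] at h1
        rcases key k hk hk2 with h3 | h3 <;> linarith
    · rw [if_neg hl, if_neg hl'] at h1
      rcases eq_or_ne k i.castSucc with hk | hk
      · rw [if_pos hk, Complex.sub_re, Complex.sub_re, Complex.add_re, hhalf, hre, hhalf',
          Complex.natCast_re, Complex.natCast_re] at h1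
        rcases key l hl hl' with h3 | h3 <;> linarith
      · rcases eq_or_ne k i.succ with hk2 | hk2
        · rw [if_neg hk, if_pos hk2, Complex.sub_re, Complex.add_re, Complex.add_re, hhalf, hre,
            hhalf', Complex.natCast_re, Complex.natCast_re] at h1
          rcases key l hl hl' with h3 | h3 <;> linarith
        · rw [if_neg hk, if_neg hk2, Complex.sub_re, Complex.natCast_re, Complex.natCast_re,
            sub_eq_zero] at h1
          exact hkl (Fin.ext (by exact_mod_cast h1.symm))

/-- With its labels permuted by `σ`, the rough braid `β` stays in `cutConf`. -/
def StaysIn {m : ℕ} (β : RoughBraid m) (σ : Equiv.Perm (Fin m)) : Prop :=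
  ∀ x k l, k < l → β.pos x (σ l) - β.pos x (σ k) ∈ cutPlane

theorem StaysIn.mul {m : ℕ} {β γ : RoughBraid m} {σ : Equiv.Perm (Fin m)} (h : β.StaysIn σ)
    (h' : γ.StaysIn (β.perm * σ)) : (RoughBraid.mul β γ).StaysIn σ := by
  intro x k l hkl
  rcases le_total (x : ℝ) (1 / 2) with hx | hx
  · have hy : 2 * x.1 ∈ unitInterval := ⟨by linarith [x.2.1], by linarith⟩
    rw [mul_pos_of_le β γ (y := ⟨_, hy⟩) rfl]
    exact h _ _ _ hkl
  · have hy : 2 * x.1 - 1 ∈ unitInterval := ⟨by linarith, by linarith [x.2.2]⟩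
    rw [mul_pos_of_ge β γ (y := ⟨_, hy⟩) rfl, mul_pos_of_ge β γ (y := ⟨_, hy⟩) rfl]
    exact h' _ _ _ hkl

/-- Here `σ` sends the label of a strand to its current position. The hypothesis says that the two
strands about to cross are still in the order of their labels, that is, have not crossed before. -/
theorem staysIn_gen {n : ℕ} (i : Fin n) {σ : Equiv.Perm (Fin (n + 1))}
    (h : σ⁻¹ i.castSucc < σ⁻¹ i.succ) : (gen i true).StaysIn σ := by
  intro x k l hkl
  rw [gen_pos]
  refine twist_sub_mem_cutPlane i ?_ ?_ (fun h' => hkl.ne (σ.injective h'))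
    fun ⟨h1, h2⟩ => ?_
  · rw [if_pos rfl]; exact mul_nonneg Real.pi_pos.le x.2.1
  · rw [if_pos rfl]; exact mul_le_of_le_one_right Real.pi_pos.le x.2.2
  · rw [← h1, ← h2, ← Equiv.Perm.mul_apply, ← Equiv.Perm.mul_apply, inv_mul_cancel] at h
    exact lt_asymm hkl h

theorem swap_braid {α : Type*} [DecidableEq α] {a b c : α} (hab : a ≠ b) (hbc : b ≠ c)
    (hac : a ≠ c) : Equiv.swap a b * Equiv.swap b c * Equiv.swap a b =
      Equiv.swap b c * Equiv.swap a b * Equiv.swap b c := by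
  rw [Equiv.swap_mul_swap_mul_swap hab hac, Equiv.swap_comm a b, Equiv.swap_comm b c,
    Equiv.swap_mul_swap_mul_swap hbc.symm hac.symm, Equiv.swap_comm]

/-- As in `gen_braid`, both sides are positive words with the same permutation in which no pair of
strands crosses twice, so both stay in `cutConf`. -/
theorem gen_comm {n : ℕ} {i j : Fin n} (h : i.val + 2 ≤ j.val) :
    (gen i true).toClass * (gen j true).toClass = (gen j true).toClass * (gen i true).toClass := by
  rw [← toClass_mul, ← toClass_mul, toClass_eq_iff]
  have n1 : i.castSucc ≠ j.castSucc := fun h' => by have := congrArg Fin.val h'; simp at this; omega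
  have n2 : i.castSucc ≠ j.succ := fun h' => by have := congrArg Fin.val h'; simp at this; omega
  have n3 : i.succ ≠ j.castSucc := fun h' => by have := congrArg Fin.val h'; simp at this; omega
  have n4 : i.succ ≠ j.succ := fun h' => by have := congrArg Fin.val h'; simp at this; omega
  have hi : (gen i true).perm = Equiv.swap i.castSucc i.succ := rfl
  have hj : (gen j true).perm = Equiv.swap j.castSucc j.succ := rfl
  have hperm : ∀ β γ : RoughBraid (n + 1), (mul β γ).perm = γ.perm * β.perm := fun _ _ => rfl
  have s1 := Equiv.swap_apply_of_ne_of_ne n1 n2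
  have s2 := Equiv.swap_apply_of_ne_of_ne n3 n4
  have s3 := Equiv.swap_apply_of_ne_of_ne n1.symm n3.symm
  have s4 := Equiv.swap_apply_of_ne_of_ne n2.symm n4.symm
  refine homotopic_of_mem_cutConf ?_ ?_ ?_
  · rw [hperm, hperm, hi, hj]
    rw [Equiv.mul_swap_eq_swap_mul, s1, s2]
  · refine StaysIn.mul (σ := 1) (staysIn_gen i ?_) (staysIn_gen j ?_)
    · simp
    · rw [hi]; simp [s3, s4]
  · refine StaysIn.mul (σ := 1) (staysIn_gen j ?_) (staysIn_gen i ?_)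
    · simp
    · rw [hj]; simp [s1, s2]

theorem gen_braid {n : ℕ} {i j : Fin n} (h : i.val + 1 = j.val) :
    (gen i true).toClass * (gen j true).toClass * (gen i true).toClass =
      (gen j true).toClass * (gen i true).toClass * (gen j true).toClass := by
  rw [← toClass_mul, ← toClass_mul, ← toClass_mul, ← toClass_mul, toClass_eq_iff]
  have hij : j.castSucc = i.succ := Fin.ext h.symm
  have hab : i.castSucc < i.succ := Fin.castSucc_lt_succ
  have hbc : i.succ < j.succ := by rw [← hij]; exact Fin.castSucc_lt_succ
  have hi : (gen i true).perm = Equiv.swap i.castSucc i.succ := rfl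
  have hj : (gen j true).perm = Equiv.swap i.succ j.succ := by rw [← hij]; rfl
  have hperm : ∀ β γ : RoughBraid (n + 1), (mul β γ).perm = γ.perm * β.perm := fun _ _ => rfl
  have hac := hab.trans hbc
  have h1 := swap_braid hab.ne hbc.ne hac.ne
  have sa : Equiv.swap i.succ j.succ i.castSucc = i.castSucc :=
    Equiv.swap_apply_of_ne_of_ne hab.ne hac.ne
  have sc : Equiv.swap i.castSucc i.succ j.succ = j.succ :=
    Equiv.swap_apply_of_ne_of_ne hac.ne' hbc.ne'
  refine homotopic_of_mem_cutConf (by rw [hperm, hperm, hperm, hperm, hi, hj, ← mul_assoc, h1,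
    mul_assoc]) ?_ ?_
  · refine StaysIn.mul (σ := 1) (StaysIn.mul (staysIn_gen i ?_) (staysIn_gen j ?_))
      (staysIn_gen i ?_)
    · simp
    · rw [hi, hij]; simpa [sc] using hac
    · rw [hperm, hi, hj]; simpa [sa, sc] using hbc
  · refine StaysIn.mul (σ := 1) (StaysIn.mul (staysIn_gen j ?_) (staysIn_gen i ?_))
      (staysIn_gen j ?_)
    · rw [hij]; simpa using hbc
    · rw [hj]; simpa [sa] using hac
    · rw [hperm, hi, hj, hij]; simp [sa, sc]

/-! ### The class of an element of the braid group -/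

/-- The class of the half twist, as a unit of the monoid of braid classes. -/
def genUnit {n : ℕ} (i : Fin n) : (BraidClass (n + 1))ˣ where
  val := (gen i true).toClass
  inv := (gen i false).toClass
  val_inv := gen_mul_gen_not i true
  inv_val := gen_mul_gen_not i false

/-- The homomorphism that takes an element of `B(A_n)` to the class of its geometric braids. -/
def classHom (n : ℕ) : BraidA n →* (BraidClass (n + 1))ˣ :=
  PresentedGroup.toGroup (f := genUnit) <| lift_eq_one (by
    rintro _ _ (⟨i, j, h⟩ | ⟨i, j, h⟩) <;> simp only [map_mul, FreeGroup.lift_apply_of] <;>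
      refine Units.ext ?_ <;> simp only [Units.val_mul, genUnit]
    · exact gen_comm h
    · exact gen_braid h)

theorem classHom_mk {n : ℕ} (w : List (Fin n × Bool)) :
    (classHom n (PresentedGroup.mk _ (FreeGroup.mk w)) : BraidClass (n + 1)) =
      (ofWord w).toClass := by
  have h1 : ∀ u, classHom n (PresentedGroup.mk _ u) = FreeGroup.lift genUnit u := fun _ => rfl
  rw [h1]
  induction w with
  | nil => rfl
  | cons a w ih =>
    obtain ⟨i, ε⟩ := a
    rw [ofWord, toClass_mul, ← ih]
    have : FreeGroup.mk ((i, ε) :: w) = FreeGroup.mk [(i, ε)] * FreeGroup.mk w := by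
      rw [FreeGroup.mul_mk]; rfl
    rw [this, map_mul, Units.val_mul]
    congr 1
    cases ε <;> simp [genUnit, FreeGroup.lift_mk]

theorem Represents.toClass_eq {n : ℕ} {β : RoughBraid (n + 1)} {b : BraidA n}
    (h : β.Represents b) : β.toClass = classHom n b := by
  obtain ⟨w, rfl, hw⟩ := h
  rw [classHom_mk, toClass_eq_iff]
  exact hw

theorem represents_ofWord {n : ℕ} (w : List (Fin n × Bool)) :
    (ofWord w).Represents (PresentedGroup.mk _ (FreeGroup.mk w)) :=
  ⟨w, rfl, ContinuousMap.HomotopicRel.refl _⟩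

theorem exists_word {n : ℕ} (b : BraidA n) :
    ∃ w : List (Fin n × Bool), PresentedGroup.mk (relators (RelA n)) (FreeGroup.mk w) = b := by
  obtain ⟨u, hu⟩ := PresentedGroup.mk_surjective _ b
  exact ⟨u.toWord, by rw [FreeGroup.mk_toWord, hu]⟩

/-- A rough braid represents `b` if and only if its class is that of `b`. -/
theorem represents_iff {n : ℕ} {β : RoughBraid (n + 1)} {b : BraidA n} :
    β.Represents b ↔ β.toClass = classHom n b := by
  refine ⟨Represents.toClass_eq, fun h => ?_⟩
  obtain ⟨w, rfl⟩ := exists_word b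
  exact ⟨w, rfl, toClass_eq_iff.1 (h.trans (classHom_mk w))⟩

end RoughBraid

open RoughBraid

/-! ### Well-definedness and conjugation invariance of closures -/

/-- The closure of an element of the braid group is well defined. -/
theorem IsClosure.unique {n : ℕ} {b : BraidA n} {ℓ ℓ' : Link} (h : IsClosure b ℓ)
    (h' : IsClosure b ℓ') : ℓ = ℓ' := by
  obtain ⟨β, hβ, rfl⟩ := h
  obtain ⟨γ, hγ, rfl⟩ := h'
  refine Quotient.sound (s := linkSetoid) ?_
  exact (toClass_eq_iff.1 (hβ.toClass_eq.trans hγ.toClass_eq.symm)).isotopic_closure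

/-- The closure is invariant under conjugation. -/
theorem IsClosure.conj {n : ℕ} {b : BraidA n} {ℓ : Link} (h : IsClosure b ℓ) (c : BraidA n) :
    IsClosure (c * b * c⁻¹) ℓ := by
  obtain ⟨β, hβ, rfl⟩ := h
  obtain ⟨w, hw⟩ := exists_word c
  obtain ⟨w', hw'⟩ := exists_word c⁻¹
  have hγ : (ofWord w).toClass = classHom n c := represents_iff.1 (hw ▸ represents_ofWord w)
  have hγ' : (ofWord w').toClass = classHom n c⁻¹ := represents_iff.1 (hw' ▸ represents_ofWord w')
  refine ⟨mul (mul (ofWord w) β) (ofWord w'), represents_iff.2 ?_, ?_⟩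
  · rw [toClass_mul, toClass_mul, hγ, hγ', hβ.toClass_eq, map_mul, map_mul, Units.val_mul,
      Units.val_mul]
  · refine Quotient.sound (s := linkSetoid) ?_
    -- Commuting the last factor to the front gives `c⁻¹ * (c * b)`, whose class is that of `b`.
    refine OrientedLink.isotopic_equivalence.symm
      (OrientedLink.isotopic_equivalence.trans (isotopic_closure_mul_comm _ _) ?_)
    refine (toClass_eq_iff.1 ?_).isotopic_closure
    rw [toClass_mul, toClass_mul, hγ, hγ', ← mul_assoc, ← Units.val_mul, ← map_mul,
      inv_mul_cancel, map_one, Units.val_one, one_mul]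

/-! ### Pushing inside a cylinder around the axis -/

/-- The cut-off function that is `1` up to `ρ` and `0` from `R` on. -/
def cutoff (R ρ r : ℝ) : ℝ := max 0 (min 1 ((R - r) / (R - ρ)))

theorem cutoff_of_le {R ρ r : ℝ} (h : ρ < R) (hr : r ≤ ρ) : cutoff R ρ r = 1 := by
  have : 1 ≤ (R - r) / (R - ρ) := (one_le_div (by linarith)).2 (by linarith)
  rw [cutoff, min_eq_left this, max_eq_right zero_le_one]

theorem cutoff_of_ge {R ρ r : ℝ} (h : ρ < R) (hr : R ≤ r) : cutoff R ρ r = 0 := by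
  have : (R - r) / (R - ρ) ≤ 0 := div_nonpos_of_nonpos_of_nonneg (by linarith) (by linarith)
  exact max_eq_left ((min_le_right _ _).trans this)

theorem abs_cutoff_sub_le {R ρ : ℝ} (h : ρ < R) (r r' : ℝ) :
    |cutoff R ρ r - cutoff R ρ r'| ≤ |r - r'| / (R - ρ) := by
  have h1 : ∀ a b : ℝ, |max 0 (min 1 a) - max 0 (min 1 b)| ≤ |a - b| := by
    intro a b
    rw [max_comm 0, max_comm 0, min_comm 1, min_comm 1]
    exact (abs_max_sub_max_le_abs _ _ _).trans (by
      simpa using abs_min_sub_min_le_max a 1 b 1)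
  refine (h1 _ _).trans (le_of_eq ?_)
  rw [← sub_div, sub_sub_sub_cancel_left, abs_div, abs_of_pos (sub_pos.2 h), abs_sub_comm]

/-- The horizontal displacement `v h` at the height `h`, cut off at the radius `R`, gives an ambient
isotopy. -/
theorem exists_isotopy_horizontal {R ρ : ℝ} (hρ : 0 ≤ ρ) (hR : 3 * ρ < R) (v : ℝ → ℂ)
    (hv : Continuous v) (hb : ∀ h, ‖v h‖ ≤ 2 * ρ) {C : ℝ} (hC : ∀ h, C ≤ |h| → v h = 0) :
    ∃ Φ : AmbientIsotopy, ∀ x : Space, Φ.final x = (x.1 + cutoff R ρ ‖x.1‖ • v x.2, x.2) := by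
  have hlt : ρ < R := by linarith
  let Ψ : unitInterval → Space → Space := fun u x =>
    (x.1 + (u : ℝ) • cutoff R ρ ‖x.1‖ • v x.2, x.2)
  have hcut : Continuous (cutoff R ρ) := by unfold cutoff; fun_prop
  have hK0 : 0 ≤ 2 * ρ / (R - ρ) := div_nonneg (by linarith) (by linarith)
  -- The cut-off has slope at most `1 / (R - ρ)` and the displacement length at most `2 * ρ`; `3 * ρ
  -- < R` is exactly the condition for a contraction.
  have hK1 : 2 * ρ / (R - ρ) < 1 := (div_lt_one (by linarith)).2 (by linarith)
  have hL : ∀ (u : unitInterval) (h : ℝ),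
      Function.Bijective fun w : ℂ => w + (u : ℝ) • cutoff R ρ ‖w‖ • v h := by
    intro u h
    refine bijective_add_of_lipschitz (K := ⟨_, hK0⟩) hK1
      (LipschitzWith.of_dist_le_mul fun a b => ?_)
    rw [dist_smul₀, Real.norm_of_nonneg u.2.1, dist_eq_norm, ← sub_smul, norm_smul]
    have h1 : ‖cutoff R ρ ‖a‖ - cutoff R ρ ‖b‖‖ ≤ dist a b / (R - ρ) := by
      rw [Real.norm_eq_abs]
      refine (abs_cutoff_sub_le hlt _ _).trans ?_
      rw [dist_eq_norm]
      exact div_le_div_of_nonneg_right (abs_norm_sub_norm_le a b) (by linarith)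
    calc (u : ℝ) * (‖cutoff R ρ ‖a‖ - cutoff R ρ ‖b‖‖ * ‖v h‖)
        ≤ 1 * (dist a b / (R - ρ) * (2 * ρ)) := by
          refine mul_le_mul u.2.2 (mul_le_mul h1 (hb h) (norm_nonneg _) ?_) (by positivity)
            zero_le_one
          exact div_nonneg dist_nonneg (by linarith)
      _ = 2 * ρ / (R - ρ) * dist a b := by ring
  have hbij : ∀ u, Function.Bijective (Ψ u) := by
    intro u
    constructor
    · rintro ⟨a, h⟩ ⟨b, h'⟩ hab
      obtain ⟨h1, h2⟩ := Prod.ext_iff.1 hab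
      obtain rfl : h = h' := h2
      exact Prod.ext ((hL u h).1 h1) rfl
    · rintro ⟨b, h⟩
      obtain ⟨a, ha⟩ := (hL u h).2 b
      exact ⟨(a, h), Prod.ext ha rfl⟩
  have hcont : Continuous fun p : unitInterval × Space => Ψ p.1 p.2 := by
    have h1 : Continuous fun p : unitInterval × Space => cutoff R ρ ‖p.2.1‖ :=
      hcut.comp (by fun_prop)
    have h2 : Continuous fun p : unitInterval × Space => v p.2.2 := hv.comp (by fun_prop)
    have h3 : Continuous fun p : unitInterval × Space => (p.1 : ℝ) := by fun_prop
    exact ((continuous_fst.comp continuous_snd).add (h3.smul (h1.smul h2))).prodMk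
      (continuous_snd.comp continuous_snd)
  obtain ⟨Φ, hΦ⟩ := AmbientIsotopy.exists_of_compact_support Ψ hcont hbij
    (fun x => by simp [Ψ]) (K := Metric.closedBall 0 (max R C)) (isCompact_closedBall _ _) (by
      intro u x hx
      rw [mem_closedBall_zero_iff, Prod.norm_def, not_le, lt_max_iff] at hx
      have : cutoff R ρ ‖x.1‖ • v x.2 = 0 := by
        rcases hx with hx | hx
        · rw [cutoff_of_ge hlt ((le_max_left _ _).trans hx.le), zero_smul]
        · rw [hC _ ((le_max_right _ _).trans hx.le), smul_zero]
      exact Prod.ext (by simp only [Ψ, this, smul_zero, add_zero]) rfl)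
  exact ⟨Φ, fun x => by rw [hΦ]; simp [Ψ]⟩

/-! ### The curl -/

/-- The height of the curl at the time `5/4 + t`. -/
def curlHeight (t : ℝ) : ℝ :=
  min (min (max (max (8 / 5 * t) (-1)) (-12 - 16 * t)) 1) (12 - 16 * t)

/-- The curl, for times in `[1/2, 2]`: it starts at `n`, descends, approaches the axis, rises
around it, leaves it and descends to `n`. -/
def curl (n : ℕ) (t : ℝ) : ℂ :=
  ((n + 2 * max 0 (min 1 (11 - 16 * |t - 5 / 4|)) : ℝ) : ℂ) +
    ((curlHeight (t - 5 / 4) : ℝ) : ℂ) * Complex.I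

theorem curl_re (n : ℕ) (t : ℝ) :
    (curl n t).re = n + 2 * max 0 (min 1 (11 - 16 * |t - 5 / 4|)) := by
  rw [curl, Complex.add_re, Complex.ofReal_re, Complex.re_ofReal_mul, Complex.I_re, mul_zero,
    add_zero]

theorem curl_im (n : ℕ) (t : ℝ) : (curl n t).im = curlHeight (t - 5 / 4) := by
  rw [curl, Complex.add_im, Complex.ofReal_im, Complex.im_ofReal_mul, Complex.I_im, mul_one,
    zero_add]

theorem continuous_curl (n : ℕ) : Continuous (curl n) := by
  have h1 : Continuous fun t : ℝ => (n : ℝ) + 2 * max 0 (min 1 (11 - 16 * |t - 5 / 4|)) := by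
    fun_prop
  have h2 : Continuous fun t : ℝ => curlHeight (t - 5 / 4) := by unfold curlHeight; fun_prop
  exact (Complex.continuous_ofReal.comp h1).add
    ((Complex.continuous_ofReal.comp h2).mul continuous_const)

theorem le_curl_re (n : ℕ) (t : ℝ) : n ≤ (curl n t).re := by
  rw [curl_re]
  linarith [le_max_left 0 (min 1 (11 - 16 * |t - 5 / 4|))]

theorem curl_re_of_abs_le (n : ℕ) {t : ℝ} (h : |t - 5 / 4| ≤ 5 / 8) : (curl n t).re = n + 2 := by
  rw [curl_re, min_eq_left (by linarith), max_eq_right zero_le_one, mul_one]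

theorem curl_re_of_le_abs (n : ℕ) {t : ℝ} (h : 11 / 16 ≤ |t - 5 / 4|) : (curl n t).re = n := by
  rw [curl_re, max_eq_left ((min_le_right _ _).trans (by linarith)), mul_zero, add_zero]

/-- On `[-3/4, 3/4]` the height is piecewise linear: from `0` down to `-1` at `-11/16`, constant
until `-5/8`, up to `1` at `5/8`, constant until `11/16`, back to `0`. The curl changes its distance
from the axis only on the two constant stretches. -/
theorem curlHeight_of_abs_le {t : ℝ} (h : |t| ≤ 5 / 8) : curlHeight t = 8 / 5 * t := by
  obtain ⟨h1, h2⟩ := abs_le.1 h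
  rw [curlHeight, max_eq_left (by linarith : (-1 : ℝ) ≤ 8 / 5 * t),
    max_eq_left (by linarith : -12 - 16 * t ≤ 8 / 5 * t),
    min_eq_left (by linarith : 8 / 5 * t ≤ 1), min_eq_left (by linarith)]

theorem curlHeight_eq_one {t : ℝ} (h1 : 5 / 8 ≤ t) (h2 : t ≤ 11 / 16) : curlHeight t = 1 := by
  rw [curlHeight, max_eq_left (by linarith : (-1 : ℝ) ≤ 8 / 5 * t),
    max_eq_left (by linarith : -12 - 16 * t ≤ 8 / 5 * t),
    min_eq_right (by linarith : 1 ≤ 8 / 5 * t), min_eq_left (by linarith)]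

theorem curlHeight_eq_neg_one {t : ℝ} (h1 : -(11 / 16) ≤ t) (h2 : t ≤ -(5 / 8)) :
    curlHeight t = -1 := by
  rw [curlHeight, max_eq_right (by linarith : 8 / 5 * t ≤ -1),
    max_eq_left (by linarith : -12 - 16 * t ≤ -1), min_eq_left (by norm_num : (-1 : ℝ) ≤ 1),
    min_eq_left (by linarith)]

/-- With `curlHeight_neg`, this separates the two passes of the curl over the same angle: for `1/2 <
x < 1` it is below height `0` at the time `x` and above it at `x + 1`. -/
theorem curlHeight_pos {t : ℝ} (h1 : 0 < t) (h2 : t < 3 / 4) : 0 < curlHeight t := by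
  refine lt_min (lt_min ?_ one_pos) (by linarith)
  exact lt_of_lt_of_le (by linarith : 0 < 8 / 5 * t) ((le_max_left _ _).trans (le_max_left _ _))

theorem curlHeight_neg {t : ℝ} (h1 : -(3 / 4) < t) (h2 : t < 0) : curlHeight t < 0 := by
  refine lt_of_le_of_lt ((min_le_left _ _).trans (min_le_left _ _)) ?_
  exact max_lt (max_lt (by linarith) (by norm_num)) (by linarith)

theorem curl_half (n : ℕ) : curl n (1 / 2) = n := by
  apply Complex.ext
  · rw [curl_re_of_le_abs n (by norm_num [abs_of_nonpos])]; simp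
  · rw [curl_im, curlHeight]; norm_num

theorem curl_two (n : ℕ) : curl n 2 = n := by
  apply Complex.ext
  · rw [curl_re_of_le_abs n (by norm_num [abs_of_nonneg])]; simp
  · rw [curl_im, curlHeight]; norm_num

/-- The time change which makes one more turn around the axis during `[5/8, 7/8]`. -/
def slowDown (x : ℝ) : ℝ := max x (min (5 * x - 5 / 2) (x + 1))

theorem slowDown_of_le {x : ℝ} (h : x ≤ 5 / 8) : slowDown x = x :=
  max_eq_left ((min_le_left _ _).trans (by linarith))

/-- The interval `[5/8, 7/8]` is stretched onto `[5/8, 15/8]`, the times `t` with `|t - 5/4| ≤ 5/8`,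
when the curl is nearest to the axis and rises from `-1` to `1`. -/
theorem slowDown_of_mem {x : ℝ} (h : 5 / 8 ≤ x) (h' : x ≤ 7 / 8) : slowDown x = 5 * x - 5 / 2 := by
  rw [slowDown, min_eq_left (by linarith), max_eq_right (by linarith)]

theorem slowDown_of_ge {x : ℝ} (h : 7 / 8 ≤ x) : slowDown x = x + 1 := by
  rw [slowDown, min_eq_right (by linarith), max_eq_right (by linarith)]

theorem continuous_slowDown : Continuous slowDown := by unfold slowDown; fun_prop

theorem strictMono_slowDown : StrictMono slowDown := by
  intro x y h
  exact max_lt_max h (min_lt_min (by linarith) (by linarith))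

/-- The ambient isotopy which removes the curl: it carries the arc that goes less than once around
the axis to the curl. -/
theorem exists_isotopy_curl (n : ℕ) : ∃ Φ : AmbientIsotopy,
    (∀ (z : ℂ) (s : ℝ), z.re ≤ n → Φ.final (around z s) = around z s) ∧
    ∀ x ∈ Set.Icc (1 / 2 : ℝ) 1, Φ.final (around (curl n (slowDown x)) x) =
      around (curl n (slowDown x)) (slowDown x) := by
  set R := Real.exp (-n) with hR
  set ρ := Real.exp (-(n + 2)) with hρ
  have hρ0 : 0 < ρ := Real.exp_pos _
  -- The radii `R` and `ρ` belong to the real parts `n` and `n + 2`; the gap of `2` suffices because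
  -- `exp 2 > 3`.
  have h3 : 3 * ρ < R := by
    have h1 : R = ρ * Real.exp 2 := by rw [hR, hρ, ← Real.exp_add]; congr 1; ring
    have h2 : (3 : ℝ) < Real.exp 2 := by
      have := Real.add_one_lt_exp (x := 2) (by norm_num)
      linarith
    rw [h1]; nlinarith
  have hlt : ρ < R := by linarith
  let c : ℝ → ℝ := fun h => max (-1) (min 1 h)
  let e : ℝ → ℂ := fun a => Complex.exp (2 * Real.pi * a * Complex.I)
  have hen : ∀ a, ‖e a‖ = 1 := fun a => by
    have : (2 * Real.pi * a * Complex.I : ℂ) = ((2 * Real.pi * a : ℝ) : ℂ) * Complex.I := by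
      push_cast; ring
    simp only [e]
    rw [this, Complex.norm_exp_ofReal_mul_I]
  have hper : ∀ a, e (a + 1) = e a := fun a => by
    simp only [e]
    rw [Complex.exp_eq_exp_iff_exists_int]
    exact ⟨1, by push_cast; ring⟩
  -- The rising part of either arc meets each level once. At the time `x` its height is `h = 8 * x -
  -- 6`, so `x = 3/4 + h/8` is the angle on the short arc and `5 * x - 5/2 = 5/4 + 5 * h / 8` the
  -- angle on the helix; `v h` is the translation from one point to the other.
  let v : ℝ → ℂ := fun h => ρ • (e (5 / 4 + 5 * c h / 8) - e (3 / 4 + c h / 8))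
  have hv : Continuous v := by
    have hc : Continuous c := by fun_prop
    have he : Continuous e := by fun_prop
    have h1 : Continuous fun h => 5 / 4 + 5 * c h / 8 := by fun_prop
    have h2 : Continuous fun h => 3 / 4 + c h / 8 := by fun_prop
    exact ((he.comp h1).sub (he.comp h2)).const_smul ρ
  -- At height `-1` the two angles are equal, and at height `1` they differ by a full turn.
  have hv0 : ∀ h : ℝ, 1 ≤ |h| → v h = 0 := by
    intro h hh
    have : e (5 / 4 + 5 * c h / 8) = e (3 / 4 + c h / 8) := by
      rcases le_abs.1 hh with h1 | h1
      · have : c h = 1 := by simp [c, h1]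
        rw [this, ← hper (3 / 4 + 1 / 8)]; norm_num
      · have : c h = -1 := by
          simp only [c]
          rw [min_eq_right (by linarith), max_eq_left (by linarith)]
        rw [this]; norm_num
    simp only [v, this, sub_self, smul_zero]
  obtain ⟨Φ, hΦ⟩ := exists_isotopy_horizontal (R := R) hρ0.le h3 v hv (fun h => by
    simp only [v]
    rw [norm_smul, Real.norm_of_nonneg hρ0.le, mul_comm]
    refine mul_le_mul_of_nonneg_right ((norm_sub_le _ _).trans ?_) hρ0.le
    rw [hen, hen]; norm_num) hv0
  have hnorm : ∀ z s, ‖(around z s).1‖ = Real.exp (-z.re) := fun z s => by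
    simp only [around]
    rw [norm_mul, hen s, mul_one, Complex.norm_real, Real.norm_of_nonneg (Real.exp_pos _).le]
  have hfix : ∀ (z : ℂ) (s : ℝ), z.re ≤ n → Φ.final (around z s) = around z s := by
    intro z s hz
    rw [hΦ, hnorm, cutoff_of_ge hlt (Real.exp_le_exp.2 (by linarith)), zero_smul, add_zero]
  have hfix' : ∀ z s, 1 ≤ |z.im| → Φ.final (around z s) = around z s := by
    intro z s hz
    have : v (around z s).2 = 0 := hv0 _ hz
    rw [hΦ, this, smul_zero, add_zero]
  -- The rest of the curl is fixed: it is at height `1` or `-1` while it moves radially, and outside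
  -- the cylinder of radius `R` afterwards.
  have hends : ∀ t s, 5 / 8 ≤ |t - 5 / 4| →
      Φ.final (around (curl n t) s) = around (curl n t) s := by
    intro t s ht
    rcases le_total (11 / 16) |t - 5 / 4| with h1 | h1
    · exact hfix _ _ (curl_re_of_le_abs n h1).le
    · apply hfix'
      rw [curl_im]
      rcases le_total 0 (t - 5 / 4) with h2 | h2
      · rw [abs_of_nonneg h2] at ht h1
        rw [curlHeight_eq_one ht h1]; simp
      · rw [abs_of_nonpos h2] at ht h1
        rw [curlHeight_eq_neg_one (by linarith) (by linarith)]; simp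
  refine ⟨Φ, hfix, fun x hx => ?_⟩
  rcases le_total x (5 / 8) with h1 | h1
  · rw [slowDown_of_le h1]
    refine hends _ _ ?_
    rw [abs_of_nonpos (by linarith)]; linarith
  · rcases le_total x (7 / 8) with h2 | h2
    · have hT := slowDown_of_mem h1 h2
      rw [hT]
      have habs : |5 * x - 5 / 2 - 5 / 4| ≤ 5 / 8 := abs_le.2 ⟨by linarith, by linarith⟩
      have hre := curl_re_of_abs_le n habs
      have him : (curl n (5 * x - 5 / 2)).im = 8 * x - 6 := by
        rw [curl_im, curlHeight_of_abs_le habs]; ring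
      have hc : c (8 * x - 6) = 8 * x - 6 := by
        simp only [c]
        rw [min_eq_right (by linarith), max_eq_right (by linarith)]
      rw [hΦ, hnorm, hre, cutoff_of_le hlt le_rfl, one_smul]
      refine Prod.ext ?_ rfl
      have hv' : v (around (curl n (5 * x - 5 / 2)) x).2 = ρ • (e (5 * x - 5 / 2) - e x) := by
        have : (around (curl n (5 * x - 5 / 2)) x).2 = 8 * x - 6 := him
        rw [this]
        simp only [v]
        rw [hc]
        congr 3 <;> ring
      rw [hv']
      have hfst : ∀ s, (around (curl n (5 * x - 5 / 2)) s).1 = ρ • e s := fun s => by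
        simp only [around]
        rw [hre, Complex.real_smul]
      simp only [hfst]
      rw [← smul_add, add_sub_cancel]
    · rw [slowDown_of_ge h2]
      have := around_add_int (curl n (x + 1)) x 1
      rw [Int.cast_one] at this
      rw [this]
      refine hends _ _ ?_
      rw [abs_of_nonneg (by linarith)]; linarith

/-! ### Linear homotopies of closed braids -/

/-- Two motions of points in which the differences of the positions of any two points always have
real parts, or imaginary parts, of the same sign are related by an ambient isotopy. -/
theorem exists_isotopy_linear {m : ℕ} {π : Equiv.Perm (Fin m)} {P Q : unitInterval → Fin m → ℂ}
    (hP : Continuous P) (hQ : Continuous Q) (hPπ : ∀ k, P 1 k = P 0 (π k))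
    (hQπ : ∀ k, Q 1 k = Q 0 (π k)) (hinj : ∀ x, Function.Injective (P x))
    (h : ∀ x k l, k ≠ l → P x k - P x l = Q x k - Q x l ∨
      0 < (P x k - P x l).re * (Q x k - Q x l).re ∨ 0 < (P x k - P x l).im * (Q x k - Q x l).im) :
    ∃ Φ : AmbientIsotopy, ∀ s k, Φ.final (around (closeUp π P s k) s) =
      around (closeUp π Q s k) s := by
  let H : unitInterval → unitInterval → Fin m → ℂ := fun u x =>
    (1 - (u : ℝ)) • P x + (u : ℝ) • Q x
  suffices ∃ Φ : AmbientIsotopy, ∀ s k,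
      Φ.final (around (closeUp π (H 0) s k) s) = around (closeUp π (H 1) s k) s by
    simpa [H] using this
  refine exists_isotopy_closeUp H ?_ ?_ ?_
  · have h1 : Continuous fun x : unitInterval × unitInterval => P x.2 := hP.comp continuous_snd
    have h2 : Continuous fun x : unitInterval × unitInterval => Q x.2 := hQ.comp continuous_snd
    have h3 : Continuous fun x : unitInterval × unitInterval => (x.1 : ℝ) := by fun_prop
    exact ((continuous_const.sub h3).smul h1).add (h3.smul h2)
  · intro u x k l hkl
    by_contra hne
    have hz : (1 - (u : ℝ)) • (P x k - P x l) + (u : ℝ) • (Q x k - Q x l) = 0 := by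
      have := sub_eq_zero.2 hkl
      simp only [H, Pi.add_apply, Pi.smul_apply] at this
      rw [← this, smul_sub, smul_sub]; ring
    -- A convex combination of two reals of the same sign does not vanish, so the linear homotopy
    -- keeps the points distinct.
    have key : ∀ a b : ℝ, 0 < a * b → (1 - (u : ℝ)) * a + u * b ≠ 0 := by
      intro a b hab h0
      have h1 : (1 - (u : ℝ)) * (a * a) + u * (a * b) = 0 := by
        linear_combination a * h0
      have ha : 0 < a * a := mul_self_pos.2 (left_ne_zero_of_mul hab.ne')
      rcases u.2.1.eq_or_lt with hu | hu
      · rw [← hu] at h1; linarith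
      · have := mul_pos hu hab
        have := mul_nonneg (sub_nonneg.2 u.2.2) ha.le
        linarith
    rcases h x k l hne with h | h | h
    · rw [← h, ← add_smul, sub_add_cancel, one_smul, sub_eq_zero] at hz
      exact hne (hinj x hz)
    · refine key _ _ h ?_
      have := congrArg Complex.re hz
      simpa using this
    · refine key _ _ h ?_
      have := congrArg Complex.im hz
      simpa using this
  · intro u k
    simp only [H, Pi.add_apply, Pi.smul_apply, hPπ, hQπ]

/-! ### Changing the time -/

/-- Used to count turns: `c j` is the number of turns of the stabilized braid during the `j`-th turn
of the original one. -/
theorem exists_int_sum (c : ℤ → ℤ) : ∃ N : ℤ → ℤ, N 0 = 0 ∧ ∀ j, N (j + 1) = N j + c j := by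
  refine ⟨fun j => match j with
    | .ofNat a => ∑ i ∈ Finset.range a, c i
    | .negSucc a => -∑ i ∈ Finset.range (a + 1), c (.negSucc i), by simp, ?_⟩
  rintro (a | a)
  · exact Finset.sum_range_succ _ _
  · rcases a with _ | a
    · simp
    · have : Int.negSucc (a + 1) + 1 = Int.negSucc a := rfl
      simp only [this]
      rw [Finset.sum_range_succ _ (a + 1)]
      ring

/-- Increasing functions on unit intervals fit together to an increasing bijection of the line. -/
theorem exists_orderIso_of_pieces (N : ℤ → ℤ) (hN : ∀ j, N j < N (j + 1)) (τ : ℤ → ℝ → ℝ)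
    (hmono : ∀ j, StrictMono (τ j)) (hc : ∀ j, Continuous (τ j)) (h0 : ∀ j, τ j 0 = 0)
    (h1 : ∀ j, τ j 1 = N (j + 1) - N j) :
    ∃ G : ℝ ≃o ℝ, ∀ s, G s = N ⌊s⌋ + τ ⌊s⌋ (Int.fract s) := by
  have hNm : StrictMono N := strictMono_int_of_lt_succ hN
  let g : ℝ → ℝ := fun s => N ⌊s⌋ + τ ⌊s⌋ (Int.fract s)
  have hlt : ∀ s, g s < N (⌊s⌋ + 1) := fun s => by
    have := hmono ⌊s⌋ (Int.fract_lt_one s)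
    rw [h1] at this
    simp only [g]; linarith
  have hle : ∀ s, (N ⌊s⌋ : ℝ) ≤ g s := fun s => by
    have := (hmono ⌊s⌋).monotone (Int.fract_nonneg s)
    rw [h0] at this
    simp only [g]; linarith
  have hg : StrictMono g := by
    intro s t hst
    rcases (Int.floor_mono hst.le).eq_or_lt with h | h
    · have hf : Int.fract s < Int.fract t := by
        rw [← Int.self_sub_floor, ← Int.self_sub_floor, h]; linarith
      simp only [g, h]
      linarith [hmono ⌊t⌋ hf]
    · have : (N (⌊s⌋ + 1) : ℝ) ≤ N ⌊t⌋ := by exact_mod_cast hNm.monotone h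
      linarith [hlt s, hle t]
  have hsurj : Function.Surjective g := by
    intro y
    -- A strictly increasing integer sequence is unbounded on both sides, so every `y` lies between
    -- consecutive values of `N`; the intermediate value theorem applies to that piece.
    have hid : ∀ a : ℕ, N 0 + a ≤ N a ∧ N (-a) ≤ N 0 - a := by
      intro a
      induction a with
      | zero => simp
      | succ a ih =>
        have e1 := hN a
        have e2 := hN (-((a + 1 : ℕ) : ℤ))
        have : -((a + 1 : ℕ) : ℤ) + 1 = -(a : ℤ) := by push_cast; ring
        rw [this] at e2
        push_cast at e1 e2 ⊢
        omega
    obtain ⟨j, hj, hmax⟩ := Int.exists_greatest_of_bdd (P := fun j => (N j : ℝ) ≤ y) (by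
      obtain ⟨a, ha⟩ := exists_nat_gt (y - N 0)
      refine ⟨a, fun z hz => ?_⟩
      by_contra! hlt
      have : (N a : ℝ) ≤ N z := by exact_mod_cast hNm.monotone hlt.le
      have h2 : ((N 0 + a : ℤ) : ℝ) ≤ N a := by exact_mod_cast (hid a).1
      push_cast at h2
      linarith) (by
      obtain ⟨a, ha⟩ := exists_nat_gt (N 0 - y)
      refine ⟨-a, ?_⟩
      have h2 : (N (-a) : ℝ) ≤ ((N 0 - a : ℤ) : ℝ) := by exact_mod_cast (hid a).2
      push_cast at h2
      linarith)
    have hj' : y < N (j + 1) := by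
      by_contra! h
      have := hmax _ h
      omega
    have hy : y - N j ∈ Set.Icc (τ j 0) (τ j 1) := by
      rw [h0, h1]
      constructor <;> linarith
    obtain ⟨x, hx, hxy⟩ := intermediate_value_Icc zero_le_one (hc j).continuousOn hy
    have hx1 : x < 1 := by
      rcases hx.2.eq_or_lt with h | h
      · rw [h, h1] at hxy; linarith
      · exact h
    have hf : ⌊(j : ℝ) + x⌋ = j := Int.floor_eq_iff.2 ⟨by linarith [hx.1], by linarith⟩
    have hfr : Int.fract ((j : ℝ) + x) = x := by rw [← Int.self_sub_floor, hf]; ring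
    refine ⟨j + x, ?_⟩
    simp only [g]
    rw [hf, hfr, hxy]; ring
  exact ⟨hg.orderIsoOfSurjective g hsurj, fun s => rfl⟩

namespace RoughBraid

/-! ### Stabilization -/

/-- The rough braid `β'` is `β` with one more strand added on the right, which does not move; and
the strands of `β` stay to the left of its last base point. -/
structure IsStabilization {n : ℕ} (β : RoughBraid (n + 1)) (β' : RoughBraid (n + 2)) : Prop where
  re_le : ∀ x k, (β.pos x k).re ≤ n
  pos_castSucc : ∀ x k, β'.pos x k.castSucc = β.pos x k
  pos_last : ∀ x, β'.pos x (Fin.last (n + 1)) = n + 1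
  perm_castSucc : ∀ k, β'.perm k.castSucc = (β.perm k).castSucc
  perm_last : β'.perm (Fin.last (n + 1)) = Fin.last (n + 1)

theorem pos_zero {m : ℕ} (β : RoughBraid m) (k : Fin m) : β.pos 0 k = ((k : ℕ) : ℂ) := by
  rw [pos, β.path.source]; rfl

theorem twist_castSucc_of_castSucc {n : ℕ} (i : Fin n) (θ : ℝ) (k : Fin (n + 1)) :
    twist i.castSucc θ k.castSucc = twist i θ k := by
  have h1 : k.castSucc = i.castSucc.castSucc ↔ k = i.castSucc := by simp [Fin.ext_iff]
  have h2 : k.castSucc = i.castSucc.succ ↔ k = i.succ := by simp [Fin.ext_iff]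
  simp only [twist, h1, h2, Fin.val_castSucc]

theorem twist_re_le {n : ℕ} (i : Fin n) (θ : ℝ) (k : Fin (n + 1)) : (twist i θ k).re ≤ n := by
  have hi : ((i : ℕ) : ℝ) + 1 ≤ n := by exact_mod_cast i.2
  have hk : ((k : ℕ) : ℝ) ≤ n := by exact_mod_cast Nat.lt_succ_iff.1 k.2
  have hre : (Complex.exp (θ * Complex.I)).re = Real.cos θ := Complex.exp_ofReal_mul_I_re θ
  have hhalf : ∀ z : ℂ, (1 / 2 * z).re = 1 / 2 * z.re := fun z => by
    rw [show (1 / 2 : ℂ) = ((1 / 2 : ℝ) : ℂ) by push_cast; rfl, Complex.re_ofReal_mul]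
  have hhalf' : ((1 : ℂ) / 2).re = 1 / 2 := by norm_num
  unfold twist
  split_ifs
  · rw [Complex.sub_re, Complex.add_re, hhalf, hre, hhalf', Complex.natCast_re]
    linarith [Real.neg_one_le_cos θ]
  · rw [Complex.add_re, Complex.add_re, hhalf, hre, hhalf', Complex.natCast_re]
    linarith [Real.cos_le_one θ]
  · rw [Complex.natCast_re]; exact hk

theorem isStabilization_gen {n : ℕ} (i : Fin n) (ε : Bool) :
    IsStabilization (gen i ε) (gen i.castSucc ε) where
  re_le x k := twist_re_le i _ k
  pos_castSucc x k := twist_castSucc_of_castSucc i _ k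
  pos_last x := by
    have h1 : Fin.last (n + 1) ≠ i.castSucc.castSucc := by
      intro h; have := congrArg Fin.val h; simp at this; omega
    have h2 : Fin.last (n + 1) ≠ i.castSucc.succ := by
      intro h; have := congrArg Fin.val h; simp at this; omega
    rw [gen_pos, twist, if_neg h1, if_neg h2]
    simp
  perm_castSucc k := by
    change Equiv.swap i.castSucc.castSucc i.castSucc.succ k.castSucc =
      (Equiv.swap i.castSucc i.succ k).castSucc
    rw [Fin.succ_castSucc, (Fin.castSucc_injective (n + 1)).map_swap]
  perm_last := by
    refine Equiv.swap_apply_of_ne_of_ne ?_ ?_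
    · intro h; have := congrArg Fin.val h; simp at this; omega
    · intro h; have := congrArg Fin.val h; simp at this; omega

theorem isStabilization_one (n : ℕ) : IsStabilization (one (n + 1)) (one (n + 2)) where
  re_le x k := by
    change (((k : ℕ) : ℂ)).re ≤ n
    rw [Complex.natCast_re]
    exact_mod_cast Nat.lt_succ_iff.1 k.2
  pos_castSucc x k := rfl
  pos_last x := by
    change (((Fin.last (n + 1) : Fin (n + 2)) : ℕ) : ℂ) = n + 1
    simp
  perm_castSucc k := rfl
  perm_last := rfl

protected theorem IsStabilization.mul {n : ℕ} {β γ : RoughBraid (n + 1)}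
    {β' γ' : RoughBraid (n + 2)}
    (h : IsStabilization β β') (h' : IsStabilization γ γ') :
    IsStabilization (RoughBraid.mul β γ) (RoughBraid.mul β' γ') := by
  have hcases : ∀ x : unitInterval, (∃ y : unitInterval, (y : ℝ) = 2 * x) ∨
      ∃ y : unitInterval, (y : ℝ) = 2 * x - 1 := fun x => by
    rcases le_total (x : ℝ) (1 / 2) with hx | hx
    · exact Or.inl ⟨⟨2 * x.1, by linarith [x.2.1], by linarith⟩, rfl⟩
    · exact Or.inr ⟨⟨2 * x.1 - 1, by linarith, by linarith [x.2.2]⟩, rfl⟩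
  refine ⟨fun x k => ?_, fun x k => ?_, fun x => ?_, fun k => ?_, ?_⟩
  · rcases hcases x with ⟨y, hy⟩ | ⟨y, hy⟩
    · rw [mul_pos_of_le β γ hy]; exact h.re_le _ _
    · rw [mul_pos_of_ge β γ hy]; exact h'.re_le _ _
  · rcases hcases x with ⟨y, hy⟩ | ⟨y, hy⟩
    · rw [mul_pos_of_le β γ hy, mul_pos_of_le β' γ' hy, h.pos_castSucc]
    · rw [mul_pos_of_ge β γ hy, mul_pos_of_ge β' γ' hy, h.perm_castSucc, h'.pos_castSucc]
  · rcases hcases x with ⟨y, hy⟩ | ⟨y, hy⟩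
    · rw [mul_pos_of_le β' γ' hy, h.pos_last]
    · rw [mul_pos_of_ge β' γ' hy, h.perm_last, h'.pos_last]
  · change γ'.perm (β'.perm _) = (γ.perm (β.perm k)).castSucc
    rw [h.perm_castSucc, h'.perm_castSucc]
  · change γ'.perm (β'.perm _) = _
    rw [h.perm_last, h'.perm_last]

theorem isStabilization_ofWord {n : ℕ} (w : List (Fin n × Bool)) :
    IsStabilization (ofWord w) (ofWord (w.map fun a => (a.1.castSucc, a.2))) := by
  induction w with
  | nil => exact isStabilization_one n
  | cons a w ih => exact (isStabilization_gen a.1 a.2).mul ih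

/-- The first half of a unit of time, as a unit of time. -/
def firstHalf (x : unitInterval) : unitInterval := Set.projIcc 0 1 zero_le_one (2 * (x : ℝ))

theorem coe_firstHalf {x : unitInterval} (h : (x : ℝ) ≤ 1 / 2) : (firstHalf x : ℝ) = 2 * x := by
  rw [firstHalf, Set.projIcc_of_mem _ ⟨by linarith [x.2.1], by linarith⟩]

theorem continuous_firstHalf : Continuous firstHalf :=
  continuous_projIcc.comp (by fun_prop)

theorem firstHalf_zero : firstHalf 0 = 0 := Subtype.ext (by rw [coe_firstHalf] <;> simp)

theorem firstHalf_of_eq {x : unitInterval} (h : (x : ℝ) = 1 / 2) : firstHalf x = 1 :=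
  Subtype.ext (by rw [coe_firstHalf h.le, h]; norm_num)

/-! ### Standard forms of the two closures, with a short and a long curl -/

section

variable {n : ℕ} (β : RoughBraid (n + 1)) (β' : RoughBraid (n + 2))

/-- The braid `β` in the first half of the time; in the second half the last strand makes the curl
with the additional turn cut out. -/
def shortCurl (x : unitInterval) (k : Fin (n + 1)) : ℂ :=
  if (x : ℝ) ≤ 1 / 2 then β.pos (firstHalf x) k
  else if β.perm k = Fin.last n then curl n (slowDown x) else ((β.perm k : ℕ) : ℂ)

/-- The braid `β` in the first half of the time; the strands that arrive at the last two
positions make the curl, one after the other. -/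
def longCurl (x : unitInterval) (k : Fin (n + 2)) : ℂ :=
  if (x : ℝ) ≤ 1 / 2 then Fin.snoc (α := fun _ => ℂ) (β.pos (firstHalf x)) (curl n (x + 1)) k
  else if β'.perm k = Fin.last (n + 1) then curl n (x + 1)
  else if β'.perm k = (Fin.last n).castSucc then curl n x else ((β'.perm k : ℕ) : ℂ)

theorem shortCurl_of_le {x : unitInterval} (h : (x : ℝ) ≤ 1 / 2) (k : Fin (n + 1)) :
    β.shortCurl x k = β.pos (firstHalf x) k := if_pos h

theorem shortCurl_of_ge {x : unitInterval} (h : 1 / 2 ≤ (x : ℝ)) (k : Fin (n + 1)) :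
    β.shortCurl x k =
      if β.perm k = Fin.last n then curl n (slowDown x) else ((β.perm k : ℕ) : ℂ) := by
  rcases h.eq_or_lt with h | h
  · rw [shortCurl_of_le β h.symm.le, firstHalf_of_eq h.symm, pos_one, pos_zero, ← h,
      slowDown_of_le (by norm_num), curl_half]
    split_ifs with h'
    · rw [h']; simp
    · rfl
  · exact if_neg (not_le.2 h)

theorem continuous_shortCurl : Continuous β.shortCurl := by
  refine continuous_pi fun k => ?_
  refine Continuous.if_le ?_ ?_ (by fun_prop) continuous_const fun x hx => ?_
  · exact (continuous_apply k).comp (β.continuous_pos.comp continuous_firstHalf)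
  · split_ifs
    · exact (continuous_curl n).comp (continuous_slowDown.comp continuous_subtype_val)
    · exact continuous_const
  · rw [← shortCurl_of_le β hx.le, shortCurl_of_ge β hx.ge]

theorem shortCurl_one (k : Fin (n + 1)) : β.shortCurl 1 k = β.shortCurl 0 (β.perm k) := by
  rw [shortCurl_of_ge β (by norm_num), shortCurl_of_le β (by simp), firstHalf_zero, pos_zero]
  split_ifs with h
  · rw [Set.Icc.coe_one, slowDown_of_ge (by norm_num), one_add_one_eq_two, curl_two, h]; simp
  · rfl

end

section

variable {n : ℕ} {β : RoughBraid (n + 1)} {β' : RoughBraid (n + 2)}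

theorem IsStabilization.longCurl_of_ge (hs : IsStabilization β β') {x : unitInterval}
    (h : 1 / 2 ≤ (x : ℝ)) (k : Fin (n + 2)) :
    longCurl β β' x k = if β'.perm k = Fin.last (n + 1) then curl n (x + 1)
      else if β'.perm k = (Fin.last n).castSucc then curl n x else ((β'.perm k : ℕ) : ℂ) := by
  rcases h.eq_or_lt with h | h
  · rw [longCurl, if_pos h.symm.le, firstHalf_of_eq h.symm]
    induction k using Fin.lastCases with
    | last => rw [Fin.snoc_last, if_pos hs.perm_last]
    | cast k =>
      rw [Fin.snoc_castSucc, hs.perm_castSucc, if_neg (Fin.castSucc_ne_last _), pos_one, pos_zero,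
        ← h, curl_half]
      split_ifs with h'
      · rw [Fin.castSucc_inj.1 h']; simp
      · rfl
  · exact if_neg (not_le.2 h)

theorem longCurl_of_le {x : unitInterval} (h : (x : ℝ) ≤ 1 / 2) :
    longCurl β β' x = Fin.snoc (α := fun _ => ℂ) (β.pos (firstHalf x)) (curl n (x + 1)) :=
  funext fun _ => if_pos h

theorem IsStabilization.continuous_longCurl (hs : IsStabilization β β') :
    Continuous (longCurl β β') := by
  refine continuous_pi fun k => ?_
  have h1 : Continuous fun x : unitInterval => curl n ((x : ℝ) + 1) :=
    (continuous_curl n).comp (by fun_prop)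
  refine Continuous.if_le ?_ ?_ (by fun_prop) continuous_const fun x hx => ?_
  · induction k using Fin.lastCases with
    | last => simpa only [Fin.snoc_last] using h1
    | cast k =>
      simp only [Fin.snoc_castSucc]
      exact (continuous_apply k).comp (β.continuous_pos.comp continuous_firstHalf)
  · split_ifs
    · exact h1
    · exact (continuous_curl n).comp continuous_subtype_val
    · exact continuous_const
  · rw [← longCurl_of_le (β' := β') hx.le, hs.longCurl_of_ge hx.ge]

/-- The permutation of the stabilized braid. -/
theorem stabilized_perm_apply (k : Fin (n + 2)) : (mul β' (gen (Fin.last n) true)).perm k =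
    Equiv.swap (Fin.last n).castSucc (Fin.last (n + 1)) (β'.perm k) := rfl

/-- A strand that begins the curl is, one turn later, where the last strand starts, at the curl's
time `1`; the last strand ends the curl at the point `n`. This exchange is the swap contributed by
the added generator. -/
theorem IsStabilization.longCurl_one (hs : IsStabilization β β') (k : Fin (n + 2)) :
    longCurl β β' 1 k = longCurl β β' 0 ((mul β' (gen (Fin.last n) true)).perm k) := by
  rw [hs.longCurl_of_ge (by norm_num), longCurl_of_le (by simp), firstHalf_zero,
    stabilized_perm_apply]
  generalize β'.perm k = l
  split_ifs with h1 h2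
  · rw [h1, Equiv.swap_apply_right, Fin.snoc_castSucc, pos_zero, Set.Icc.coe_one,
      one_add_one_eq_two, curl_two]
    simp
  · rw [h2, Equiv.swap_apply_left, Fin.snoc_last]
    simp
  · rw [Equiv.swap_apply_of_ne_of_ne h2 h1]
    induction l using Fin.lastCases with
    | last => exact absurd rfl h1
    | cast l => rw [Fin.snoc_castSucc, pos_zero]; rfl

/-- The difference of the positions of two points does not change, or it has a real part or an
imaginary part that does not change its sign. -/
def SameSide (p q p' q' : ℂ) : Prop :=
  p - q = p' - q' ∨ 0 < (p - q).re * (p' - q').re ∨ 0 < (p - q).im * (p' - q').im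

theorem SameSide.symm {p q p' q' : ℂ} (h : SameSide p q p' q') : SameSide q p q' p' := by
  unfold SameSide at *
  rw [← neg_sub p q, ← neg_sub p' q', neg_inj, Complex.neg_re, Complex.neg_re, Complex.neg_im,
    Complex.neg_im, neg_mul_neg, neg_mul_neg]
  exact h

theorem sameSide_of_re_lt {p q p' q' : ℂ} (h : q.re < p.re) (h' : q'.re < p'.re) :
    SameSide p q p' q' := by
  refine Or.inr (Or.inl (mul_pos ?_ ?_))
  · rw [Complex.sub_re]; linarith
  · rw [Complex.sub_re]; linarith

/-- The trivial factor provides a half turn of rest in which to make the curl. The curl keeps real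
part at least `n`, so it stays to the right of the other strands. -/
theorem exists_isotopy_shortCurl (β : RoughBraid (n + 1)) :
    ∃ Φ : AmbientIsotopy, ∀ s k, Φ.final (around ((mul β (one (n + 1))).track k s) s) =
      around (closeUp β.perm β.shortCurl s k) s := by
  refine exists_isotopy_linear (π := β.perm) (mul β (one (n + 1))).continuous_pos
    β.continuous_shortCurl (mul β (one (n + 1))).pos_one β.shortCurl_one
    (mul β (one (n + 1))).pos_injective fun x k l hkl => ?_
  change SameSide _ _ _ _
  rcases le_total (x : ℝ) (1 / 2) with hx | hx
  · left
    rw [mul_pos_of_le _ _ (coe_firstHalf hx), shortCurl_of_le β hx, shortCurl_of_le β hx]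
  · have hpos : ∀ k, (mul β (one (n + 1))).pos x k = ((β.perm k : ℕ) : ℂ) := fun k => by
      rw [mul_pos_of_ge β (one (n + 1)) (y := ⟨2 * x.1 - 1, by linarith, by linarith [x.2.2]⟩) rfl]
      rfl
    rw [hpos, hpos, shortCurl_of_ge β hx, shortCurl_of_ge β hx]
    have hne : β.perm k ≠ β.perm l := fun h => hkl (β.perm.injective h)
    have key : ∀ i j : Fin (n + 1), i = Fin.last n → j ≠ Fin.last n →
        SameSide ((i : ℕ) : ℂ) ((j : ℕ) : ℂ) (curl n (slowDown x)) ((j : ℕ) : ℂ) := by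
      rintro i j rfl hj
      have hlt : ((j : ℕ) : ℝ) < n := by exact_mod_cast Fin.val_lt_last hj
      refine sameSide_of_re_lt ?_ ?_
      · simpa using Fin.val_lt_last hj
      · rw [Complex.natCast_re]; exact hlt.trans_le (le_curl_re n _)
    generalize β.perm k = i at *
    generalize β.perm l = j at *
    by_cases hi : i = Fin.last n
    · have hj : j ≠ Fin.last n := fun h => hne (hi.trans h.symm)
      rw [if_pos hi, if_neg hj]
      exact key i j hi hj
    · rw [if_neg hi]
      by_cases hj : j = Fin.last n
      · rw [if_pos hj]
        exact (key j i hj hi).symm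
      · rw [if_neg hj]
        exact Or.inl rfl

/-- All pairs except the two twisting strands are separated by real parts. For that pair the
difference in the half twist is `exp (θ I)`, and in the curl the later pass lies above the earlier
one, so the imaginary parts agree in sign. -/
theorem IsStabilization.exists_isotopy_longCurl (hs : IsStabilization β β') :
    ∃ Φ : AmbientIsotopy, ∀ s k,
      Φ.final (around ((mul β' (gen (Fin.last n) true)).track k s) s) =
        around (closeUp (mul β' (gen (Fin.last n) true)).perm (longCurl β β') s k) s := by
  set L := mul β' (gen (Fin.last n) true) with hL
  refine exists_isotopy_linear (π := L.perm) L.continuous_pos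
    hs.continuous_longCurl L.pos_one hs.longCurl_one L.pos_injective fun x k l hkl => ?_
  change SameSide _ _ _ _
  rcases le_or_gt (x : ℝ) (1 / 2) with hx | hx
  · rw [hL, mul_pos_of_le _ _ (coe_firstHalf hx), longCurl_of_le hx]
    have key : ∀ k : Fin (n + 1), SameSide (β'.pos (firstHalf x) (Fin.last (n + 1)))
        (β'.pos (firstHalf x) k.castSucc) (curl n (x + 1)) (β.pos (firstHalf x) k) := by
      intro k
      have h1 := hs.re_le (firstHalf x) k
      rw [hs.pos_last, hs.pos_castSucc]
      refine sameSide_of_re_lt ?_ ?_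
      · rw [Complex.add_re, Complex.natCast_re, Complex.one_re]; linarith
      · rw [curl_re_of_abs_le n (abs_le.2 ⟨by linarith [x.2.1], by linarith⟩)]; linarith
    induction k using Fin.lastCases with
    | last =>
      induction l using Fin.lastCases with
      | last => exact absurd rfl hkl
      | cast l => rw [Fin.snoc_last, Fin.snoc_castSucc]; exact key l
    | cast k =>
      induction l using Fin.lastCases with
      | last => rw [Fin.snoc_last, Fin.snoc_castSucc]; exact (key k).symm
      | cast l =>
        rw [Fin.snoc_castSucc, Fin.snoc_castSucc, hs.pos_castSucc, hs.pos_castSucc]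
        exact Or.inl rfl
  · set θ : ℝ := Real.pi * (2 * x - 1) with hθ
    have hpos : ∀ k, L.pos x k = twist (Fin.last n) θ (β'.perm k) := fun k => by
      rw [hL, mul_pos_of_ge β' _ (y := ⟨2 * x.1 - 1, by linarith, by linarith [x.2.2]⟩) rfl]
      rfl
    have hne : β'.perm k ≠ β'.perm l := fun h => hkl (β'.perm.injective h)
    rw [hpos, hpos, hs.longCurl_of_ge hx.le, hs.longCurl_of_ge hx.le]
    generalize β'.perm k = i at *
    generalize β'.perm l = j at *
    let V : Fin (n + 2) → ℂ := fun i => if i = Fin.last (n + 1) then curl n (x + 1)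
      else if i = (Fin.last n).castSucc then curl n x else ((i : ℕ) : ℂ)
    change SameSide _ _ (V i) (V j)
    set A : Fin (n + 2) := Fin.last (n + 1) with hA
    set B : Fin (n + 2) := (Fin.last n).castSucc with hB
    have hAB : A ≠ B := (Fin.castSucc_ne_last _).symm
    have hre : (Complex.exp (θ * Complex.I)).re = Real.cos θ := Complex.exp_ofReal_mul_I_re θ
    have him : (Complex.exp (θ * Complex.I)).im = Real.sin θ := Complex.exp_ofReal_mul_I_im θ
    have hc1 := Real.cos_le_one θ
    have hc2 := Real.neg_one_le_cos θ
    have hhalf : ∀ z : ℂ, (1 / 2 * z).re = 1 / 2 * z.re := fun z => by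
      rw [show (1 / 2 : ℂ) = ((1 / 2 : ℝ) : ℂ) by push_cast; rfl, Complex.re_ofReal_mul]
    have hhalf' : ((1 : ℂ) / 2).re = 1 / 2 := by norm_num
    have tB : twist (Fin.last n) θ B = (n : ℂ) + 1 / 2 - 1 / 2 * Complex.exp (θ * Complex.I) := by
      rw [twist, if_pos rfl]; simp
    have tA : twist (Fin.last n) θ A = (n : ℂ) + 1 / 2 + 1 / 2 * Complex.exp (θ * Complex.I) := by
      rw [twist, if_neg hAB, if_pos (Fin.succ_last n).symm]; simp
    have tC : ∀ i, i ≠ A → i ≠ B → twist (Fin.last n) θ i = ((i : ℕ) : ℂ) := by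
      intro i h1 h2
      rw [twist, if_neg h2, if_neg (fun h => h1 (h.trans (Fin.succ_last n)))]
    have vA : V A = curl n (x + 1) := if_pos rfl
    have vB : V B = curl n x := (if_neg hAB.symm).trans (if_pos rfl)
    have vC : ∀ i, i ≠ A → i ≠ B → V i = ((i : ℕ) : ℂ) := fun i h1 h2 =>
      (if_neg h1).trans (if_neg h2)
    have hlt : ∀ i, i ≠ A → i ≠ B → ((i : ℕ) : ℝ) < n := by
      intro i h1 h2
      have h3 : (i : ℕ) ≠ n + 1 := fun h => h1 (Fin.ext h)
      have h4 : (i : ℕ) ≠ n := fun h => h2 (Fin.ext h)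
      exact_mod_cast (by omega : (i : ℕ) < n)
    have kAB : SameSide (twist (Fin.last n) θ A) (twist (Fin.last n) θ B) (V A) (V B) := by
      rw [tA, tB, vA, vB]
      have hd : ((n : ℂ) + 1 / 2 + 1 / 2 * Complex.exp (θ * Complex.I) -
          ((n : ℂ) + 1 / 2 - 1 / 2 * Complex.exp (θ * Complex.I))) =
          Complex.exp (θ * Complex.I) := by ring
      unfold SameSide
      rw [hd]
      -- At `x = 1` the twist has imaginary part zero, so real parts are compared: both differences
      -- point to the left.
      rcases x.2.2.eq_or_lt with h1 | h1
      · right; left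
        have hθ1 : θ = Real.pi := by rw [hθ, h1]; ring
        rw [hre, hθ1, Real.cos_pi, Complex.sub_re, h1, one_add_one_eq_two, curl_two,
          Complex.natCast_re, curl_re_of_abs_le n (by norm_num [abs_of_nonpos])]
        linarith
      · right; right
        rw [him, Complex.sub_im, curl_im, curl_im]
        refine mul_pos (Real.sin_pos_of_pos_of_lt_pi ?_ ?_) ?_
        · exact mul_pos Real.pi_pos (by linarith)
        · nlinarith [Real.pi_pos]
        · have h2 := curlHeight_pos (t := x + 1 - 5 / 4) (by linarith) (by linarith)
          have h3 := curlHeight_neg (t := x - 5 / 4) (by linarith) (by linarith)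
          linarith
    have kAC : ∀ i, i ≠ A → i ≠ B →
        SameSide (twist (Fin.last n) θ A) (twist (Fin.last n) θ i) (V A) (V i) := by
      intro i h1 h2
      have h3 := hlt i h1 h2
      rw [tA, tC i h1 h2, vA, vC i h1 h2]
      refine sameSide_of_re_lt ?_ ?_
      · rw [Complex.add_re, Complex.add_re, hhalf, hre, hhalf', Complex.natCast_re,
          Complex.natCast_re]
        linarith
      · rw [Complex.natCast_re]; linarith [le_curl_re n ((x : ℝ) + 1)]
    have kBC : ∀ i, i ≠ A → i ≠ B →
        SameSide (twist (Fin.last n) θ B) (twist (Fin.last n) θ i) (V B) (V i) := by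
      intro i h1 h2
      have h3 := hlt i h1 h2
      rw [tB, tC i h1 h2, vB, vC i h1 h2]
      refine sameSide_of_re_lt ?_ ?_
      · rw [Complex.sub_re, Complex.add_re, hhalf, hre, hhalf', Complex.natCast_re,
          Complex.natCast_re]
        linarith
      · rw [Complex.natCast_re]; linarith [le_curl_re n (x : ℝ)]
    by_cases hiA : i = A
    · subst hiA
      by_cases hjB : j = B
      · subst hjB; exact kAB
      · exact kAC j hne.symm hjB
    · by_cases hjA : j = A
      · subst hjA
        by_cases hiB : i = B
        · subst hiB; exact kAB.symm
        · exact (kAC i hiA hiB).symm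
      · by_cases hiB : i = B
        · subst hiB; exact kBC j hjA hne.symm
        · by_cases hjB : j = B
          · subst hjB; exact (kBC i hiA hiB).symm
          · rw [tC i hiA hiB, tC j hjA hjB, vC i hiA hiB, vC j hjA hjB]
            exact Or.inl rfl

end

end RoughBraid

/-! ### Matching the strands, and invariance under stabilization -/

namespace RoughBraid

section

variable {n : ℕ} {β : RoughBraid (n + 1)} {β' : RoughBraid (n + 2)}

theorem IsStabilization.stabilized_perm_castSucc (hs : IsStabilization β β') {k : Fin (n + 1)}
    (hk : β.perm k ≠ Fin.last n) :
    (mul β' (gen (Fin.last n) true)).perm k.castSucc = (β.perm k).castSucc := by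
  rw [stabilized_perm_apply, hs.perm_castSucc]
  exact Equiv.swap_apply_of_ne_of_ne (fun h => hk (Fin.castSucc_inj.1 h)) (Fin.castSucc_ne_last _)

theorem IsStabilization.stabilized_perm_castSucc_of_eq (hs : IsStabilization β β')
    {k : Fin (n + 1)} (hk : β.perm k = Fin.last n) :
    (mul β' (gen (Fin.last n) true)).perm k.castSucc = Fin.last (n + 1) := by
  rw [stabilized_perm_apply, hs.perm_castSucc, hk, Equiv.swap_apply_left]

theorem IsStabilization.stabilized_perm_last (hs : IsStabilization β β') :
    (mul β' (gen (Fin.last n) true)).perm (Fin.last (n + 1)) = (Fin.last n).castSucc := by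
  rw [stabilized_perm_apply, hs.perm_last, Equiv.swap_apply_right]

/-- The time at which the curl with the additional turn is where the one without it is at the time
`x`. -/
def turnTime (β : RoughBraid (n + 1)) (k : Fin (n + 1)) (x : ℝ) : ℝ :=
  if β.perm k = Fin.last n then slowDown x else x

/-- The isotopy `exists_isotopy_curl` takes one standard form to the other. Only the strand arriving
at `Fin.last n` is affected, and only its angle changes, from `x` to `slowDown x`. -/
theorem IsStabilization.final_around_shortCurl (hs : IsStabilization β β') {Φ : AmbientIsotopy}
    (hfix : ∀ (z : ℂ) (s : ℝ), z.re ≤ n → Φ.final (around z s) = around z s)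
    (hcurl : ∀ x ∈ Set.Icc (1 / 2 : ℝ) 1, Φ.final (around (curl n (slowDown x)) x) =
      around (curl n (slowDown x)) (slowDown x)) (k : Fin (n + 1)) (x : unitInterval) :
    Φ.final (around (β.shortCurl x k) x) =
      around (closeUp (mul β' (gen (Fin.last n) true)).perm (longCurl β β') (β.turnTime k x)
        k.castSucc) (β.turnTime k x) := by
  rcases le_total (x : ℝ) (1 / 2) with hx | hx
  · have hτ : β.turnTime k x = x := by
      rw [turnTime, slowDown_of_le (by linarith), ite_self]
    rw [hτ, closeUp_eq hs.longCurl_one (j := 0) (x := x) (by simp), zpow_zero,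
      Equiv.Perm.one_apply, longCurl_of_le hx, Fin.snoc_castSucc, shortCurl_of_le β hx]
    exact hfix _ _ (hs.re_le _ _)
  · rw [shortCurl_of_ge β hx]
    by_cases hk : β.perm k = Fin.last n
    · rw [turnTime, if_pos hk, if_pos hk, hcurl x ⟨hx, x.2.2⟩]
      congr 1
      have hT1 : 1 / 2 ≤ slowDown x := by
        have := strictMono_slowDown.monotone hx
        rwa [slowDown_of_le (by norm_num)] at this
      have hT2 : slowDown x ≤ 2 := by
        have := strictMono_slowDown.monotone x.2.2
        rw [slowDown_of_ge (x := 1) (by norm_num)] at this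
        linarith
      generalize slowDown (x : ℝ) = T at *
      -- The curl takes the times `[1/2, 2]`: the second half of the strand's own turn, then the
      -- whole next turn, which it spends as the added last strand.
      rcases le_total T 1 with h | h
      · rw [closeUp_eq hs.longCurl_one (j := 0) (x := ⟨T, by linarith, h⟩) (by simp), zpow_zero,
          Equiv.Perm.one_apply, hs.longCurl_of_ge hT1, hs.perm_castSucc,
          if_neg (Fin.castSucc_ne_last _), hk, if_pos rfl]
      · rw [closeUp_eq hs.longCurl_one (j := 1) (x := ⟨T - 1, by linarith, by linarith⟩) (by simp),
          zpow_one, hs.stabilized_perm_castSucc_of_eq hk]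
        rcases le_total (T - 1) (1 / 2) with h' | h'
        · rw [longCurl_of_le h', Fin.snoc_last, sub_add_cancel]
        · rw [hs.longCurl_of_ge h', if_pos hs.perm_last, sub_add_cancel]
    · rw [turnTime, if_neg hk, if_neg hk, closeUp_eq hs.longCurl_one (j := 0) (x := x) (by simp),
        zpow_zero, Equiv.Perm.one_apply, hs.longCurl_of_ge hx, hs.perm_castSucc,
        if_neg (Fin.castSucc_ne_last _), if_neg (fun h => hk (Fin.castSucc_inj.1 h)),
        Fin.val_castSucc]
      refine hfix _ _ ?_
      rw [Complex.natCast_re]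
      exact_mod_cast Nat.lt_succ_iff.1 (β.perm k).2

/-- Following a strand of the stabilized braid takes one or two turns for each turn of `β`. -/
theorem IsStabilization.exists_time_change (hs : IsStabilization β β') (k : Fin (n + 1)) :
    ∃ (N : ℤ → ℤ) (G : ℝ ≃o ℝ),
      (∀ j : ℤ, ((mul β' (gen (Fin.last n) true)).perm ^ N j) k.castSucc =
        ((β.perm ^ j) k).castSucc) ∧
      ∀ s, G s = N ⌊s⌋ + β.turnTime ((β.perm ^ ⌊s⌋) k) (Int.fract s) := by
  set π := (mul β' (gen (Fin.last n) true)).perm with hπ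
  have hsucc : ∀ j : ℤ, β.perm ((β.perm ^ j) k) = (β.perm ^ (j + 1)) k := fun j => by
    rw [add_comm j, zpow_add, zpow_one, Equiv.Perm.mul_apply]
  -- A turn of `β` that ends at `Fin.last n` needs a second turn in the stabilized braid, along the
  -- added strand.
  let c : ℤ → ℤ := fun j => if β.perm ((β.perm ^ j) k) = Fin.last n then 2 else 1
  have hstep : ∀ j, (π ^ c j) ((β.perm ^ j) k).castSucc = ((β.perm ^ (j + 1)) k).castSucc := by
    intro j
    rw [← hsucc]
    by_cases h : β.perm ((β.perm ^ j) k) = Fin.last n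
    · have h2 : π ^ (2 : ℤ) = π * π := zpow_two π
      simp only [c, if_pos h]
      rw [h2, Equiv.Perm.mul_apply, hs.stabilized_perm_castSucc_of_eq h, hs.stabilized_perm_last, h]
    · simp only [c, if_neg h]
      rw [zpow_one, hs.stabilized_perm_castSucc h]
  obtain ⟨N, hN0, hN⟩ := exists_int_sum c
  have hpow : ∀ j : ℤ, (π ^ N j) k.castSucc = ((β.perm ^ j) k).castSucc := by
    -- An equivalence, so that induction runs both forwards and backwards from `N 0 = 0`.
    have hiff : ∀ j : ℤ, (π ^ N (j + 1)) k.castSucc = ((β.perm ^ (j + 1)) k).castSucc ↔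
        (π ^ N j) k.castSucc = ((β.perm ^ j) k).castSucc := by
      intro j
      rw [hN, add_comm (N j), zpow_add, Equiv.Perm.mul_apply, ← hstep]
      exact (π ^ c j).injective.eq_iff
    intro j
    induction j using Int.induction_on with
    | zero => simp [hN0]
    | succ i ih => exact (hiff i).2 ih
    | pred i ih => exact (hiff _).1 (by rw [sub_add_cancel]; exact ih)
  obtain ⟨G, hG⟩ := exists_orderIso_of_pieces N (fun j => by
      rw [hN]; simp only [c]; split_ifs <;> omega)
    (fun j => β.turnTime ((β.perm ^ j) k)) (fun j => by
      unfold turnTime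
      split_ifs
      · exact strictMono_slowDown
      · exact strictMono_id) (fun j => by
      unfold turnTime
      split_ifs
      · exact continuous_slowDown
      · exact continuous_id) (fun j => by
      unfold turnTime
      split_ifs
      · exact slowDown_of_le (by norm_num)
      · rfl) (fun j => by
      rw [hN]
      simp only [turnTime, c]
      split_ifs
      · rw [slowDown_of_ge (by norm_num)]; push_cast; ring
      · push_cast; ring)
  exact ⟨N, G, hpow, hG⟩

/-- Stabilization does not change the closure. -/
theorem IsStabilization.isotopic_closure (hs : IsStabilization β β') :
    (mul β (one (n + 1))).closure.Isotopic (mul β' (gen (Fin.last n) true)).closure := by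
  obtain ⟨Φ₁, h₁⟩ := exists_isotopy_shortCurl β
  obtain ⟨Φ₂, hfix, hcurl⟩ := exists_isotopy_curl n
  obtain ⟨Φ₃, h₃⟩ := hs.exists_isotopy_longCurl
  have key : ∀ k, ∃ G : ℝ ≃o ℝ, ∀ s,
      ((Φ₁.trans Φ₂).trans Φ₃.symm).final (around ((mul β (one (n + 1))).track k s) s) =
        around ((mul β' (gen (Fin.last n) true)).track k.castSucc (G s)) (G s) := by
    intro k
    obtain ⟨N, G, hpow, hG⟩ := hs.exists_time_change k
    refine ⟨G, fun s => ?_⟩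
    rw [AmbientIsotopy.final_trans, AmbientIsotopy.final_trans, h₁]
    have h4 := hs.final_around_shortCurl hfix hcurl ((β.perm ^ ⌊s⌋) k)
      ⟨Int.fract s, Int.fract_nonneg s, (Int.fract_lt_one s).le⟩
    have h5 : ∀ z, around z s = around z (Int.fract s) := fun z => by
      conv_lhs => rw [← Int.fract_add_floor s]
      exact around_add_int z _ _
    rw [closeUp, h5, h4, ← hpow, ← apply_add_int_eq (closeUp_add_one _ _),
      ← around_add_int _ _ (N ⌊s⌋), add_comm (β.turnTime _ _), ← hG, ← h₃, Φ₃.final_symm]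
  refine RoughBraid.isotopic_closure ((Φ₁.trans Φ₂).trans Φ₃.symm) (fun k => ?_) fun l => ?_
  · obtain ⟨G, hG⟩ := key k
    exact ⟨k.castSucc, G, hG⟩
  · induction l using Fin.lastCases with
    | last =>
      -- The added strand starts at no base point of `β`; it continues, one turn later, the strand
      -- that arrives at `Fin.last n`.
      obtain ⟨G, hG⟩ := key (β.perm⁻¹ (Fin.last n))
      refine ⟨β.perm⁻¹ (Fin.last n), G.symm 1, 0, ?_⟩
      have hk : β.perm (β.perm⁻¹ (Fin.last n)) = Fin.last n := by
        rw [← Equiv.Perm.mul_apply, mul_inv_cancel, Equiv.Perm.one_apply]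
      have h6 := (mul β' (gen (Fin.last n) true)).track_add_int
        (β.perm⁻¹ (Fin.last n)).castSucc 0 1
      rw [zpow_one, hs.stabilized_perm_castSucc_of_eq hk] at h6
      rw [hG, OrderIso.apply_symm_apply, ← h6, ← around_add_int _ 0 1]
      simp
    | cast k =>
      obtain ⟨G, hG⟩ := key k
      exact ⟨k, 0, G 0, hG 0⟩

end

end RoughBraid

open RoughBraid

/-! ### Adding a strand in the braid groups, and the Markov moves for affine braids -/

/-- The homomorphism `B(A_n) → B(A_{n+1})`, `σ_i ↦ σ_i`. -/
def inclA (n : ℕ) : BraidA n →* BraidA (n + 1) :=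
  PresentedGroup.toGroup (f := fun i => PresentedGroup.of i.castSucc) <| lift_eq_one (by
    rintro _ _ (⟨i, j, h⟩ | ⟨i, j, h⟩) <;> simp only [map_mul, FreeGroup.lift_apply_of]
    · simpa [PresentedGroup.of] using mk_eq_of_rel (RelA.comm i.castSucc j.castSucc h)
    · simpa [PresentedGroup.of] using mk_eq_of_rel (RelA.braid i.castSucc j.castSucc h))

theorem inclA_of {n : ℕ} (i : Fin n) :
    inclA n (PresentedGroup.of i) = PresentedGroup.of i.castSucc :=
  PresentedGroup.toGroup.of _

theorem inclA_mk {n : ℕ} (w : List (Fin n × Bool)) :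
    inclA n (PresentedGroup.mk _ (FreeGroup.mk w)) =
      PresentedGroup.mk _ (FreeGroup.mk (w.map fun a => (a.1.castSucc, a.2))) := by
  have h1 : (inclA n).comp (PresentedGroup.mk _) =
      (PresentedGroup.mk _).comp (FreeGroup.map Fin.castSucc) := by
    refine FreeGroup.ext_hom _ _ fun i => ?_
    simp only [MonoidHom.comp_apply, FreeGroup.map.of]
    exact inclA_of i
  have h2 := DFunLike.congr_fun h1 (FreeGroup.mk w)
  simpa only [MonoidHom.comp_apply, FreeGroup.map.mk] using h2

/-- The closure is invariant under stabilization. -/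
theorem IsClosure.stabilize {n : ℕ} {b : BraidA n} {ℓ : Link} (h : IsClosure b ℓ) :
    IsClosure (inclA n b * PresentedGroup.of (Fin.last n)) ℓ := by
  obtain ⟨w, rfl⟩ := exists_word b
  set w' := w.map fun a => (a.1.castSucc, a.2) with hw'
  refine ⟨mul (ofWord w') (gen (Fin.last n) true), represents_iff.2 ?_, ?_⟩
  · rw [inclA_mk, map_mul, Units.val_mul, classHom_mk, toClass_mul]
    congr 1
    have : classHom (n + 1) (PresentedGroup.of (Fin.last n)) = genUnit (Fin.last n) :=
      PresentedGroup.toGroup.of _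
    rw [this]
    rfl
  -- The link may be computed from the word followed by the trivial braid, which leaves room for the
  -- curl.
  · have h1 : IsClosure (PresentedGroup.mk _ (FreeGroup.mk w))
        (Quotient.mk linkSetoid (mul (ofWord w) (one (n + 1))).closure) := by
      refine ⟨_, represents_iff.2 ?_, rfl⟩
      rw [toClass_mul, toClass_one, mul_one, classHom_mk]
    rw [h.unique h1]
    exact Quotient.sound (s := linkSetoid) (isStabilization_ofWord w).isotopic_closure

/-! ### The homomorphisms -/

theorem affToB_sAff {n i : ℕ} (h : i < n) : affToB n (sAff n i) = sB n i := by
  rw [sAff, dif_pos h]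
  exact PresentedGroup.toGroup.of _

theorem affToB_aAff (n : ℕ) : affToB n (aAff n) = aB n := PresentedGroup.toGroup.of _

theorem bToA_sB {n i : ℕ} (h : i < n) : bToA n (sB n i) = PresentedGroup.of (Fin.succ ⟨i, h⟩) := by
  rw [sB, dif_pos h]
  exact PresentedGroup.toGroup.of _

theorem bToA_tB (n : ℕ) : bToA n (tB n) = PresentedGroup.of 0 ^ 2 := PresentedGroup.toGroup.of _

/-- The Dynkin automorphism becomes conjugation in `B(B_{n+1})`. -/
theorem affToB_dynkin {n : ℕ} (hn : 1 ≤ n) (y : BraidAff n) :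
    affToB n (dynkin n y) = phiB n * affToB n y * (phiB n)⁻¹ := by
  have h : (affToB n).comp (dynkin n) =
      (MulAut.conj (phiB n)).toMonoidHom.comp (affToB n) := by
    refine PresentedGroup.ext fun g => ?_
    have hd : dynkin n (PresentedGroup.of g) = _ := PresentedGroup.toGroup.of _
    have ha : affToB n (PresentedGroup.of g) = _ := PresentedGroup.toGroup.of _
    simp only [MonoidHom.comp_apply, MulEquiv.coe_toMonoidHom, MulAut.conj_apply]
    rw [hd, ha]
    rcases g with i | _
    · dsimp only
      split_ifs with hi
      · rw [affToB_sAff hi, phiB_shift hi, mul_inv_cancel_right]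
      · rw [affToB_aAff, aB]
        congr 3
        omega
    · dsimp only
      rw [affToB_sAff hn, phiB_aB hn, mul_inv_cancel_right]
  exact DFunLike.congr_fun h y

/-- The element `t σ_1 ⋯ σ_n` of `B(B_{n+2})`. -/
def phiBIncl (n : ℕ) : BraidB (n + 1) := tB (n + 1) * prodB (n + 1) n

/-- The last factor of `phiB (n + 1)` commutes with the conjugated generator and drops out. The
remaining conjugator involves only the earlier generators, so it comes from the braid group with one
strand fewer. -/
theorem aB_succ (n : ℕ) : aB (n + 1) = phiBIncl n * sB (n + 1) n * (phiBIncl n)⁻¹ := by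
  have h : phiB (n + 1) = phiBIncl n * sB (n + 1) n := by
    change tB (n + 1) * prodB (n + 1) (n + 1) = _
    rw [prodB_succ, phiBIncl, mul_assoc]
  rw [aB, h, Nat.add_sub_cancel]
  group

/-- The right side is the word of `aB n`, read in the larger group. With `u`, `v` the last two
generators, `u` commutes with the part of the conjugator before `v`, and the braid relation gives `u
v u v⁻¹ u⁻¹ = v`. -/
theorem conj_aB_succ {n : ℕ} (hn : 1 ≤ n) :
    sB (n + 1) n * aB (n + 1) * (sB (n + 1) n)⁻¹ =
      phiBIncl n * sB (n + 1) (n - 1) * (phiBIncl n)⁻¹ := by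
  obtain ⟨k, rfl⟩ : ∃ k, n = k + 1 := ⟨n - 1, by omega⟩
  rw [aB_succ, Nat.add_sub_cancel]
  have h1 : phiBIncl (k + 1) = tB (k + 2) * prodB (k + 2) k * sB (k + 2) k := by
    rw [phiBIncl, prodB_succ, mul_assoc]
  have h2 : sB (k + 2) (k + 1) * (tB (k + 2) * prodB (k + 2) k) =
      tB (k + 2) * prodB (k + 2) k * sB (k + 2) (k + 1) := by
    rw [← mul_assoc, sB_comm_t (by omega), mul_assoc, ← prodB_comm (by omega), mul_assoc]
  have h3 := sB_braid (n := k + 2) (i := k) (by omega)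
  rw [h1]
  change sB (k + 2) (k + 1) * (_ * sB (k + 2) (k + 1) * _) * (sB (k + 2) (k + 1))⁻¹ =
    _ * sB (k + 2) k * _
  generalize tB (k + 2) * prodB (k + 2) k = p at *
  generalize sB (k + 2) (k + 1) = u at *
  generalize sB (k + 2) k = v at *
  have h4 : u * v * u * v⁻¹ * u⁻¹ = v := by rw [← h3]; group
  calc u * (p * v * u * (p * v)⁻¹) * u⁻¹ = (u * p) * v * u * v⁻¹ * (u * p)⁻¹ := by group
    _ = p * (u * v * u * v⁻¹ * u⁻¹) * p⁻¹ := by rw [h2]; group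
    _ = p * v * p⁻¹ := by rw [h4]
    _ = p * v * v * (p * v)⁻¹ := by group

theorem bToA_sB_succ {n i : ℕ} (h : i < n) :
    bToA (n + 1) (sB (n + 1) i) = inclA (n + 1) (bToA n (sB n i)) := by
  rw [bToA_sB h, bToA_sB (by omega : i < n + 1), inclA_of]
  rfl

theorem bToA_tB_succ (n : ℕ) : bToA (n + 1) (tB (n + 1)) = inclA (n + 1) (bToA n (tB n)) := by
  rw [bToA_tB, bToA_tB, map_pow, inclA_of]
  rfl

theorem bToA_phiBIncl (n : ℕ) : bToA (n + 1) (phiBIncl n) = inclA (n + 1) (bToA n (phiB n)) := by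
  have h : ∀ k ≤ n, bToA (n + 1) (prodB (n + 1) k) = inclA (n + 1) (bToA n (prodB n k)) := by
    intro k hk
    induction k with
    | zero => simp [prodB]
    | succ k ih =>
      rw [prodB_succ, prodB_succ, map_mul, map_mul, map_mul, ih (by omega),
        bToA_sB_succ (by omega)]
  change _ = inclA (n + 1) (bToA n (tB n * prodB n n))
  rw [phiBIncl, map_mul, map_mul, map_mul, h n le_rfl, bToA_tB_succ]

/-- Viewing an affine braid in the next affine braid group means adding a strand. -/
theorem affToA_affIncl {n : ℕ} (hn : 1 ≤ n) (x : BraidAff n) :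
    affToA (n + 1) (affIncl n x) = inclA (n + 1) (affToA n x) := by
  have h : (affToA (n + 1)).comp (affIncl n) = (inclA (n + 1)).comp (affToA n) := by
    refine PresentedGroup.ext fun g => ?_
    have hd : affIncl n (PresentedGroup.of g) = _ := PresentedGroup.toGroup.of _
    have ha : affToB n (PresentedGroup.of g) = _ := PresentedGroup.toGroup.of _
    simp only [MonoidHom.comp_apply, affToA]
    rw [hd, ha]
    rcases g with i | _
    · dsimp only
      rw [affToB_sAff (by omega), bToA_sB_succ i.2]
    · dsimp only
      have h1 : affToB (n + 1) (sAff (n + 1) n * aAff (n + 1) * (sAff (n + 1) n)⁻¹) =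
          phiBIncl n * sB (n + 1) (n - 1) * (phiBIncl n)⁻¹ := by
        rw [map_mul, map_mul, map_inv, affToB_sAff (by omega), affToB_aAff, conj_aB_succ hn]
      rw [h1, aB]
      simp only [map_mul, map_inv]
      rw [bToA_phiBIncl, bToA_sB_succ (by omega)]
  exact DFunLike.congr_fun h x

end

end AffineLink

/-- For an affine braid `x ∈ B(Ã_n)`, `n ≥ 1`: if `φ_{n+1}(y) = x` then `ŷ = x̂`; and the closure of
`x a_{n+2} ∈ B(Ã_{n+1})`, where `x` is viewed in `B(Ã_{n+1})` through `F_{n+1}`, is `x̂`. -/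
theorem mainTheorem6 (n : ℕ) (hn : 1 ≤ n) (x : BraidAff n) :
    (∀ y : BraidAff n, dynkin n y = x →
      ∀ ℓ ℓ' : Link, IsAffineClosure y ℓ → IsAffineClosure x ℓ' → ℓ = ℓ') ∧
    (∀ ℓ ℓ' : Link, IsAffineClosure (affIncl n x * aAff (n + 1)) ℓ → IsAffineClosure x ℓ' →
      ℓ = ℓ') := by
  constructor
  · rintro y rfl ℓ ℓ' hy hx
    have h : affToA n (dynkin n y) =
        bToA n (phiB n) * affToA n y * (bToA n (phiB n))⁻¹ := by
      rw [affToA, MonoidHom.comp_apply, affToB_dynkin hn, map_mul, map_mul, map_inv]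
      rfl
    rw [IsAffineClosure, h] at hx
    exact IsClosure.unique (IsClosure.conj hy _) hx
  · intro ℓ ℓ' h hx
    -- With `g` the image of `phiB n` and `σ` the last generator, the product is `g (g⁻¹ x g · σ)
    -- g⁻¹`: conjugate, stabilize, conjugate back.
    have hb := ((IsClosure.conj hx (bToA n (phiB n))⁻¹).stabilize).conj
      (inclA (n + 1) (bToA n (phiB n)))
    refine IsClosure.unique h ?_
    convert hb using 1
    have ha : affToA (n + 1) (aAff (n + 1)) = inclA (n + 1) (bToA n (phiB n)) *
        PresentedGroup.of (Fin.last (n + 1)) * (inclA (n + 1) (bToA n (phiB n)))⁻¹ := by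
      rw [affToA, MonoidHom.comp_apply, affToB_aAff, aB_succ, map_mul, map_mul, map_inv,
        bToA_phiBIncl, bToA_sB (by omega)]
      rfl
    rw [map_mul, ha, affToA_affIncl hn, map_mul, map_mul, inv_inv, map_inv]
    group
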